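/- **Model.** Base stations (BSs) and eavesdroppers form two independent homogeneous Poisson point processes in $\mathbb{R}^2$ with intensities $\lambda_B,\lambda_E>0$; the typical user is at the origin $o$. Each link of length $r$ is, independently of the others, line-of-sight (LOS, $j=L$) with probability $C\in[0,1]$ if $r\le D$ and $0$ if $r>D$ (where $D>0$), and otherwise non-line-of-sight (NLOS, $j=N$). It has path loss $L=C_jr^{-\alpha_j}$ ($C_j,\alpha_j>0$) and an independent channel gain distributed as $\mathrm{gamma}(N_j,1)$, with $N_j\ge1$ an integer. We assume $C_ND^{-\alpha_N}\le C_LD^{-\alpha_L}$ (which holds whenever $C_N<C_L$, $\alpha_L<\alpha_N$ and $D\ge1$). The user is served by the BS $x^*$ that maximizes $L(x,o)$ over all BSs $x$. With transmit power $P_t>0$, noise power $N_0>0$ and array gains $M_s,m_s>0$, put $\mathrm{SNR}_U=P_tM_sL(x^*,o)h_{x^*o}/N_0$ and, for an eavesdropper at $z$, $\mathrm{SNR}_{E_z}=P_tG_zL(x^*,z)g_{x^*z}/N_0$. Here $h,g$ are the channel gains of the links; the $G_z$ are independent of each other and of everything else, with $G_z=M_s$ if $|\theta_z|\le\theta_b$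 and $G_z=m_s$ otherwise, where $\theta_z$ is uniform on $[-180^\circ,180^\circ]$ and $0^\circ\le\theta_b\le180^\circ$. For thresholds $T_c,T_e>0$ let $p_{con}=\Pr(\mathrm{SNR}_U\ge T_c)$ and $p_{sec,n}=\Pr(\sup_z\mathrm{SNR}_{E_z}\le T_e)$, the supremum being over all eavesdroppers. **Notation.** $\gamma(a,x)$ and $\Gamma(a,x)$ are the lower and upper incomplete gamma functions and $\mathbb I$ is the indicator function. With $\mu=(C_N/C_L)^{1/\alpha_N}D^{\alpha_L/\alpha_N}$, the NLOS and LOS association probabilities are $$A_N=\int_0^\mu\Big(e^{-\pi C\lambda_B(C_L/C_N)^{2/\alpha_L}x^{2\alpha_N/\alpha_L}}-e^{-\pi C\lambda_BD^2}\Big)2\pi(1-C)\lambda_Bx\,e^{-\pi(1-C)\lambda_Bx^2}dx+e^{-\pi C\lambda_BD^2},\qquad A_L=1-A_N,$$ and the densities of the distance to the serving BS, given that it is LOS (for $0\le r\le D$) or NLOS (for $r\ge0$), are $$f_{r_L}(r)=\frac{2\pi C\lambda_Br}{A_L}\,e^{-(1-C)\lambda_B\pi(C_N/C_L)^{2/\alpha_N}r^{2\alpha_L/\alpha_N}}e^{-C\lambda_B\pi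 r^2},$$ $$f_{r_N}(r)=\frac{2\pi\lambda_Bre^{-\pi\lambda_Br^2}\big((1-C)e^{\pi C\lambda_B(r^2-D^2)}\mathbb I(r\le D)+\mathbb I(r\ge D)\big)}{A_N}$$ $$\qquad\qquad+\frac{2\pi(1-C)\lambda_Bre^{-(1-C)\lambda_B\pi r^2}\big(e^{-C\lambda_B\pi(C_L/C_N)^{2/\alpha_L}r^{2\alpha_N/\alpha_L}}-e^{-C\lambda_B\pi D^2}\big)}{A_N}\,\mathbb I(r\le\mu).$$ Put $q_L=C$, $q_N=1-C$, $\pi_{M_s}=\theta_b/180^\circ$, $\pi_{m_s}=1-\pi_{M_s}$. For $t>0$ and $V\in\{M_s,m_s\}$ let $$\Omega_{j,\mathrm{in}}(V,t)=\pi_V\frac{(VC_jt)^{2/\alpha_j}}{\alpha_j}\sum_{m=0}^{N_j-1}\frac{\gamma\big(m+\frac2{\alpha_j},\frac{D^{\alpha_j}}{VC_jt}\big)}{m!},$$ let $\Omega_{j,\mathrm{out}}(V,t)$ be the same expression with $\Gamma(\cdot,\cdot)$ in place of $\gamma(\cdot,\cdot)$, and $$\Lambda_E(0,t)=2\pi\lambda_E\sum_{V\in\{M_s,m_s\}}\big(q_L\Omega_{L,\mathrm{in}}(V,t)+q_N\Omega_{N,\mathrm{in}}(V,t)+\Omega_{N,\mathrm{out}}(V,t)\big),$$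 where the main-lobe and side-lobe terms are both kept even if $M_s=m_s$. **Theorem 2.** In this non-colluding, noise-limited setting, $$p_{con}=A_L\int_0^D\frac{\Gamma\big(N_L,\frac{N_0T_cr^{\alpha_L}}{P_tM_sC_L}\big)}{\Gamma(N_L)}f_{r_L}(r)\,dr+A_N\int_0^\infty\frac{\Gamma\big(N_N,\frac{N_0T_cr^{\alpha_N}}{P_tM_sC_N}\big)}{\Gamma(N_N)}f_{r_N}(r)\,dr$$ (the first term being $0$ if $C=0$, when $A_L=0$), and $$p_{sec,n}=\exp\Big(-\Lambda_E\Big(0,\frac{P_t}{T_eN_0}\Big)\Big).$$ -/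

import Mathlib

open MeasureTheory ProbabilityTheory

noncomputable section

namespace MmWave

/-! ### Incomplete gamma functions and Poisson point processes -/

/-- The upper incomplete gamma function `Γ(a, x)`. -/
def upperGamma (a x : ℝ) : ℝ := ∫ t in Set.Ioi x, t ^ (a - 1) * Real.exp (-t)

/-- The lower incomplete gamma function `γ(a, x)`. -/
def lowerGamma (a x : ℝ) : ℝ := ∫ t in Set.Ioc 0 x, t ^ (a - 1) * Real.exp (-t)

/-- The Euclidean plane. -/
abbrev Plane : Type := EuclideanSpace ℝ (Fin 2)

/-- The number of points of the sequence `x` that lie in `B`. -/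
def pointCount (x : ℕ → Plane) (B : Set Plane) : ℕ∞ := Set.encard {i | x i ∈ B}

/-- The random points `X 0, X 1, …` form a homogeneous Poisson point process of intensity `lam` in
the plane: the numbers of points in pairwise disjoint Borel sets of finite area are independent
Poisson variables, with mean `lam` times the area. (For `lam > 0` such a process almost surely has
infinitely many points, so that its points can be listed by `ℕ`.) -/
structure IsHomogeneousPPP {Ω : Type*} [MeasurableSpace Ω] (P : Measure Ω) (lam : ℝ)
    (X : ℕ → Ω → Plane) : Prop where
  measurable : ∀ i, Measurable (X i)
  count_law : ∀ (k : ℕ) (B : Fin k → Set Plane), (∀ j, MeasurableSet (B j)) →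
    (∀ j, volume (B j) ≠ ⊤) → (Pairwise fun j l => Disjoint (B j) (B l)) → ∀ n : Fin k → ℕ,
      P.real {ω | ∀ j, pointCount (fun i => X i ω) (B j) = (n j : ℕ∞)} =
        ∏ j, Real.exp (-(lam * volume.real (B j))) * (lam * volume.real (B j)) ^ (n j)
          / (Nat.factorial (n j) : ℝ)

/-! ### The network -/

/-- The parameters of the network. -/
structure Params where
  /-- intensity of the base stations (BSs) -/
  lamB : ℝ
  /-- intensity of the eavesdroppers -/
  lamE : ℝ
  /-- probability that a link of length at most `D` is line-of-sight (LOS) -/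
  C : ℝ
  /-- radius beyond which every link is non-line-of-sight (NLOS) -/
  D : ℝ
  /-- path loss intercept of LOS links -/
  CL : ℝ
  /-- path loss intercept of NLOS links -/
  CN : ℝ
  /-- path loss exponent of LOS links -/
  aL : ℝ
  /-- path loss exponent of NLOS links -/
  aN : ℝ
  /-- Nakagami parameter of LOS links -/
  NL : ℕ
  /-- Nakagami parameter of NLOS links -/
  NN : ℕ
  /-- array gain of the main lobe -/
  Ms : ℝ
  /-- array gain of the side lobes -/
  ms : ℝ
  /-- beam width of the main lobe, in degrees -/
  thetaB : ℝ
  /-- transmit power of a BS -/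
  Pt : ℝ
  /-- noise power -/
  N0 : ℝ
  lamB_pos : 0 < lamB
  lamE_pos : 0 < lamE
  C_nonneg : 0 ≤ C
  C_le_one : C ≤ 1
  D_pos : 0 < D
  CL_pos : 0 < CL
  CN_pos : 0 < CN
  aL_pos : 0 < aL
  aN_pos : 0 < aN
  NL_pos : 0 < NL
  NN_pos : 0 < NN
  Ms_pos : 0 < Ms
  ms_pos : 0 < ms
  thetaB_nonneg : 0 ≤ thetaB
  thetaB_le : thetaB ≤ 180
  Pt_pos : 0 < Pt
  N0_pos : 0 < N0

/-- The probability `q_L(r)` that a link of length `r` is LOS. -/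
def Params.qLOS (p : Params) (r : ℝ) : ℝ := if r ≤ p.D then p.C else 0

/-- The directivity gain `G_b(θ)`, with the angle `θ` off the boresight in degrees. -/
def Params.arrayGain (p : Params) (θ : ℝ) : ℝ := if |θ| ≤ p.thetaB then p.Ms else p.ms

open Classical in
/-- The path loss `L` of a link of length `r` that is LOS or not. -/
def Params.pathLoss (p : Params) (los : Prop) (r : ℝ) : ℝ :=
  if los then p.CL * r ^ (-p.aL) else p.CN * r ^ (-p.aN)

/-- Names of the random marks of the links. The link from BS `i` to the typical authorized user
carries a blockage variable and one small-scale channel gain for each of the two states LOS and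
NLOS; the link from BS `i` to eavesdropper `k` carries in addition the angle off the boresight. -/
inductive Mark : Type
  | userBlock (i : ℕ)
  | userGainL (i : ℕ)
  | userGainN (i : ℕ)
  | eveBlock (i k : ℕ)
  | eveGainL (i k : ℕ)
  | eveGainN (i k : ℕ)
  | eveAngle (i k : ℕ)

/-- The laws of the marks: blockage variables are uniform on `[0, 1]`, angles are uniform on
`[-180, 180]`, and gains are gamma distributed with shape `NL` or `NN` and scale `1`. -/
def Params.markLaw (p : Params) : Mark → Measure ℝ
  | .userBlock _ => volume.restrict (Set.Icc 0 1)
  | .userGainL _ => gammaMeasure p.NL 1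
  | .userGainN _ => gammaMeasure p.NN 1
  | .eveBlock _ _ => volume.restrict (Set.Icc 0 1)
  | .eveGainL _ _ => gammaMeasure p.NL 1
  | .eveGainN _ _ => gammaMeasure p.NN 1
  | .eveAngle _ _ => (360 : ENNReal)⁻¹ • volume.restrict (Set.Icc (-180) 180)

/-- A realization of the random network on the probability space `(Ω, P)`: two independent
homogeneous Poisson processes of BSs and eavesdroppers, and independent marks of all links, which
are independent of the two processes. The typical authorized user is at the origin. -/
structure Network (p : Params) {Ω : Type*} [MeasurableSpace Ω] (P : Measure Ω) where
  /-- positions of the BSs -/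
  bs : ℕ → Ω → Plane
  /-- positions of the eavesdroppers -/
  eve : ℕ → Ω → Plane
  /-- marks of the links -/
  mark : Mark → Ω → ℝ
  bs_poisson : IsHomogeneousPPP P p.lamB bs
  eve_poisson : IsHomogeneousPPP P p.lamE eve
  mark_measurable : ∀ a, Measurable (mark a)
  mark_law : ∀ a, P.map (mark a) = p.markLaw a
  mark_indep : iIndepFun mark P
  bs_indep_eve : IndepFun (fun ω i => bs i ω) (fun ω k => eve k ω) P
  points_indep_mark :
    IndepFun (fun ω => ((fun i => bs i ω), (fun k => eve k ω))) (fun ω a => mark a ω) P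

namespace Network

variable {p : Params} {Ω : Type*} [MeasurableSpace Ω] {P : Measure Ω} (M : Network p P)

/-- The link from BS `i` to the typical user is LOS: given the positions this has probability
`q_L` of the length of the link. -/
def userLOS (i : ℕ) (ω : Ω) : Prop := M.mark (.userBlock i) ω < p.qLOS ‖M.bs i ω‖

/-- The link from BS `i` to eavesdropper `k` is LOS. -/
def eveLOS (i k : ℕ) (ω : Ω) : Prop :=
  M.mark (.eveBlock i k) ω < p.qLOS ‖M.bs i ω - M.eve k ω‖

/-- The path loss from BS `i` to the typical user. -/
def userLoss (i : ℕ) (ω : Ω) : ℝ := p.pathLoss (M.userLOS i ω) ‖M.bs i ω‖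

/-- The path loss from BS `i` to eavesdropper `k`. -/
def eveLoss (i k : ℕ) (ω : Ω) : ℝ := p.pathLoss (M.eveLOS i k ω) ‖M.bs i ω - M.eve k ω‖

open Classical in
/-- The small-scale channel gain from BS `i` to the typical user. -/
def userGain (i : ℕ) (ω : Ω) : ℝ :=
  if M.userLOS i ω then M.mark (.userGainL i) ω else M.mark (.userGainN i) ω

open Classical in
/-- The small-scale channel gain from BS `i` to eavesdropper `k`. -/
def eveGain (i k : ℕ) (ω : Ω) : ℝ :=
  if M.eveLOS i k ω then M.mark (.eveGainL i k) ω else M.mark (.eveGainN i k) ω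

/-- The index of the serving BS, which maximizes `L` over all BSs. (The maximizer almost surely
exists and is unique.) -/
def serving (ω : Ω) : ℕ := sInf {i | ∀ j, M.userLoss j ω ≤ M.userLoss i ω}

/-- The received SNR of the typical user. -/
def snrUser (ω : Ω) : ℝ :=
  p.Pt * p.Ms * M.userLoss (M.serving ω) ω * M.userGain (M.serving ω) ω / p.N0

/-- The received SNR of eavesdropper `k`, with respect to the serving BS. -/
def snrEve (k : ℕ) (ω : Ω) : ℝ :=
  p.Pt * p.arrayGain (M.mark (.eveAngle (M.serving ω) k) ω) * M.eveLoss (M.serving ω) k ω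
    * M.eveGain (M.serving ω) k ω / p.N0

/-- The connection probability for the SNR threshold `Tc`. -/
def pCon (Tc : ℝ) : ℝ := P.real {ω | Tc ≤ M.snrUser ω}

/-- The secrecy probability for the SNR threshold `Te`, with non-colluding eavesdroppers. -/
def pSec (Te : ℝ) : ℝ := P.real {ω | (⨆ k, (M.snrEve k ω : EReal)) ≤ (Te : EReal)}

end Network

/-! ### The closed forms -/

namespace Params

variable (p : Params)

/-- `A_N`, the probability that the typical user is served by a NLOS BS. -/
def AN : ℝ :=
  (∫ x in (0 : ℝ)..((p.CL / p.CN) ^ (-(1 / p.aN)) * p.D ^ (p.aL / p.aN)),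
    (Real.exp (-(Real.pi * p.C * p.lamB * (p.CL / p.CN) ^ (2 / p.aL) * x ^ (2 * p.aN / p.aL)))
      - Real.exp (-(Real.pi * p.C * p.lamB * p.D ^ 2)))
    * (2 * Real.pi * (1 - p.C) * p.lamB * x) * Real.exp (-(Real.pi * (1 - p.C) * p.lamB * x ^ 2)))
  + Real.exp (-(Real.pi * p.C * p.lamB * p.D ^ 2))

/-- `A_L`, the probability that the typical user is served by a LOS BS. -/
def AL : ℝ := 1 - p.AN

/-- `f_{r_L}`, the density on `[0, D]` of the distance to the serving BS given that it is LOS. -/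
def fL (r : ℝ) : ℝ :=
  Real.exp (-((1 - p.C) * p.lamB * Real.pi * (p.CN / p.CL) ^ (2 / p.aN) * r ^ (2 * p.aL / p.aN)))
    * (2 * Real.pi * p.C * p.lamB * r) * Real.exp (-(p.C * p.lamB * Real.pi * r ^ 2)) / p.AL

/-- `f_{r_N}`, the density on `[0, ∞)` of the distance to the serving BS given that it is NLOS. -/
def fN (r : ℝ) : ℝ :=
  2 * Real.pi * p.lamB * r * Real.exp (-(Real.pi * p.lamB * r ^ 2))
      * ((1 - p.C) * Real.exp (Real.pi * p.C * p.lamB * (r ^ 2 - p.D ^ 2))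
            * (if r ≤ p.D then 1 else 0)
          + (if p.D ≤ r then 1 else 0)) / p.AN
    + 2 * Real.pi * (1 - p.C) * p.lamB * r * Real.exp (-((1 - p.C) * p.lamB * Real.pi * r ^ 2))
      * (Real.exp (-(p.C * p.lamB * Real.pi * (p.CL / p.CN) ^ (2 / p.aL) * r ^ (2 * p.aN / p.aL)))
          - Real.exp (-(p.C * p.lamB * Real.pi * p.D ^ 2))) / p.AN
      * (if r ≤ (p.CN / p.CL) ^ (1 / p.aN) * p.D ^ (p.aL / p.aN) then 1 else 0)

/-- `Ω_{j,in}(V, t)`, for the gain `V` of probability `pr` and links with path loss intercept `c`,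
exponent `a` and Nakagami parameter `n`. -/
def omegaIn (pr V c a : ℝ) (n : ℕ) (t : ℝ) : ℝ :=
  pr * ((V * c * t) ^ (2 / a) / a)
    * ∑ m ∈ Finset.range n, lowerGamma (m + 2 / a) (p.D ^ a / (V * c * t)) / (Nat.factorial m : ℝ)

/-- `Ω_{j,out}(V, t)`, with the same conventions. -/
def omegaOut (pr V c a : ℝ) (n : ℕ) (t : ℝ) : ℝ :=
  pr * ((V * c * t) ^ (2 / a) / a)
    * ∑ m ∈ Finset.range n, upperGamma (m + 2 / a) (p.D ^ a / (V * c * t)) / (Nat.factorial m : ℝ)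

/-- The probability of the main lobe gain. -/
def prMain : ℝ := p.thetaB / 180

/-- The probability of the side lobe gain. -/
def prSide : ℝ := (180 - p.thetaB) / 180

/-- The intensity measure `Λ_E(0, t)` of the path loss process with fading. -/
def LambdaE (t : ℝ) : ℝ :=
  2 * Real.pi * p.lamE *
    (p.C * (p.omegaIn p.prMain p.Ms p.CL p.aL p.NL t + p.omegaIn p.prSide p.ms p.CL p.aL p.NL t)
      + (1 - p.C)
        * (p.omegaIn p.prMain p.Ms p.CN p.aN p.NN t + p.omegaIn p.prSide p.ms p.CN p.aN p.NN t)
      + p.omegaOut p.prMain p.Ms p.CN p.aN p.NN t + p.omegaOut p.prSide p.ms p.CN p.aN p.NN t)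

end Params

end MmWave

end

open MeasureTheory ProbabilityTheory

noncomputable section

namespace MmWave

open Filter Topology
open scoped ENNReal NNReal

/-! ### Counts of a Poisson process -/

/-! Both probabilities come from void probabilities of independently marked Poisson processes. For a
measurable function g with values in [0, 1] and finite integral, E ∏ (1 - g(X_i)) = exp(-λ ∫ g)
(`lintegral_seqProd`): for simple g this is independence of the counts together with the Poisson
generating function, and monotone approximation gives the rest. If g(y) is the probability that a
point at y carries a mark putting it in B, conditioning on the positions shows that no marked point
lies in B with probability exp(-λ ∫ g) (`measure_forall_notMem`).

Connection. A LOS link of length r is as strong as a NLOS link of length `nlosLength r`. Every BS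
thus has an effective length, and the serving BS minimizes it. For a point process with the void
probabilities of a Poisson process of intensity ν, the minimizer of T lies in A with probability ∫_A
exp(-ν{T ≤ T(y)}) dν(y) (`measure_minimizer_mem`). Void probabilities alone suffice for this: over a
strip s < T ≤ t the two sides have increments that differ by at most the square of the ν-mass of the
strip, and a function whose increments are quadratically small relative to a continuous monotone
function is constant (`eq_of_abs_sub_le_sq`). Take for A the marked BSs with SNR at least T_c.
Integrating out the marks produces gamma tails, polar coordinates leave a radial integral, and the
exponential weights are A_L f_L and A_N f_N (`fL_mul_AL`, `fN_mul_AN`). The assumption on the path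
losses at D enters as μ ≤ D, which decides the minima in the mean number of stronger BSs.

Secrecy. The serving index depends only on the BS positions and the blockage variables of the user
links, hence is independent of the eavesdroppers and of the marks of their links to any fixed BS s.
Given that s serves, secrecy says that the marked eavesdroppers, seen from BS s, avoid the detection
set. Translation and reflection invariance of area make this void probability independent of the
position of s, so summing over s leaves exp(-Λ) (`pSec_eq`). The exponent is evaluated by
substituting u = r^a / K, which turns the gamma tails into incomplete gamma functions
(`setIntegral_mul_gammaTail`). -/

lemma measurable_pointCount {Ω : Type*} [MeasurableSpace Ω] {X : ℕ → Ω → Plane}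
    (hX : ∀ i, Measurable (X i)) {B : Set Plane} (hB : MeasurableSet B) :
    Measurable fun ω => pointCount (fun i => X i ω) B := by
  refine measurable_encard.comp (measurable_set_iff.2 fun i => ?_)
  exact (measurable_mem.2 hB).comp (hX i)

namespace IsHomogeneousPPP

variable {Ω : Type*} [MeasurableSpace Ω] {P : Measure Ω} {lam : ℝ}
  {X : ℕ → Ω → Plane}

lemma count_law_fintype (h : IsHomogeneousPPP P lam X) {ι : Type*} [Fintype ι]
    (B : ι → Set Plane) (hm : ∀ j, MeasurableSet (B j)) (hf : ∀ j, volume (B j) ≠ ⊤)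
    (hd : Pairwise fun j l => Disjoint (B j) (B l)) (n : ι → ℕ) :
    P.real {ω | ∀ j, pointCount (fun i => X i ω) (B j) = (n j : ℕ∞)} =
      ∏ j, Real.exp (-(lam * volume.real (B j))) * (lam * volume.real (B j)) ^ (n j)
        / (Nat.factorial (n j) : ℝ) := by
  let e := Fintype.equivFin ι
  have := h.count_law _ (fun j => B (e.symm j)) (fun j => hm _) (fun j => hf _)
    (fun j l hjl => hd (by simpa using hjl)) (fun j => n (e.symm j))
  rw [e.symm.prod_comp (fun j => Real.exp (-(lam * volume.real (B j))) *
    (lam * volume.real (B j)) ^ (n j) / (Nat.factorial (n j) : ℝ))] at this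
  rw [← this]
  congr 1
  ext ω
  exact (e.symm.forall_congr_right (q := fun j => pointCount (fun i => X i ω) (B j) = (n j : ℕ∞))).symm

lemma count_single (h : IsHomogeneousPPP P lam X) {B : Set Plane} (hm : MeasurableSet B)
    (hf : volume B ≠ ⊤) (n : ℕ) :
    P.real {ω | pointCount (fun i => X i ω) B = (n : ℕ∞)} =
      Real.exp (-(lam * volume.real B)) * (lam * volume.real B) ^ n / (Nat.factorial n : ℝ) := by
  simpa using h.count_law_fintype (ι := Unit) (fun _ => B) (fun _ => hm) (fun _ => hf)
    (fun j l hjl => (hjl rfl).elim) (fun _ => n)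

variable [IsProbabilityMeasure P]

/-- The defining law speaks of finite counts only. Since the Poisson weights already sum to 1, no
mass is left for an infinite count. -/
lemma ae_pointCount_ne_top (h : IsHomogeneousPPP P lam X) (hl : 0 ≤ lam) {B : Set Plane}
    (hm : MeasurableSet B) (hf : volume B ≠ ⊤) :
    ∀ᵐ ω ∂P, pointCount (fun i => X i ω) B ≠ ⊤ := by
  have hN := measurable_pointCount h.measurable hm
  have hr : 0 ≤ lam * volume.real B := by positivity
  let r : ℝ≥0 := (lam * volume.real B).toNNReal
  have hset : {ω | pointCount (fun i => X i ω) B ≠ ⊤}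
      = ⋃ n : ℕ, {ω | pointCount (fun i => X i ω) B = (n : ℕ∞)} := by
    ext ω
    simp only [Set.mem_ofPred_eq, Set.mem_iUnion]
    rw [ENat.ne_top_iff_exists]
    exact exists_congr fun n => eq_comm
  have hmeas : ∀ n : ℕ, MeasurableSet {ω | pointCount (fun i => X i ω) B = (n : ℕ∞)} :=
    fun n => hN (measurableSet_singleton _)
  have h1 : P {ω | pointCount (fun i => X i ω) B ≠ ⊤} = 1 := by
    rw [hset, measure_iUnion _ hmeas]
    · have : ∀ n : ℕ, P {ω | pointCount (fun i => X i ω) B = (n : ℕ∞)} = poissonMeasure r {n} := by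
        intro n
        rw [poissonMeasure_singleton, ← ofReal_measureReal, h.count_single hm hf,
          Real.coe_toNNReal _ hr]
      simp_rw [this]
      rw [← measure_iUnion _ (fun n => measurableSet_singleton n)]
      · rw [Set.iUnion_of_singleton, measure_univ]
      · intro a b hab
        simpa using hab
    · intro a b hab
      rw [Function.onFun, Set.disjoint_left]
      intro ω h1 h2
      apply hab
      have : (a : ℕ∞) = b := h1.symm.trans h2
      exact_mod_cast this
  rw [ae_iff]
  have := (prob_compl_eq_zero_iff (μ := P)
    (s := {ω | pointCount (fun i => X i ω) B ≠ ⊤}) (by rw [hset]; exact .iUnion hmeas)).2 h1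
  simpa [Set.compl_ofPred] using this

/-- The counts of a Poisson process in disjoint sets are independent Poisson variables. -/
lemma map_counts (h : IsHomogeneousPPP P lam X) (hl : 0 ≤ lam) {ι : Type*} [Fintype ι]
    (B : ι → Set Plane) (hm : ∀ j, MeasurableSet (B j)) (hf : ∀ j, volume (B j) ≠ ⊤)
    (hd : Pairwise fun j l => Disjoint (B j) (B l)) :
    P.map (fun ω j => (pointCount (fun i => X i ω) (B j)).toNat)
      = Measure.pi fun j => poissonMeasure (lam * volume.real (B j)).toNNReal := by
  have hN : ∀ j, Measurable fun ω => (pointCount (fun i => X i ω) (B j)).toNat :=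
    fun j => Measurable.of_discrete.comp (measurable_pointCount h.measurable (hm j))
  refine Measure.ext_of_singleton fun n => ?_
  rw [Measure.map_apply (measurable_pi_iff.2 hN) (measurableSet_singleton _),
    Measure.pi_singleton]
  -- `toNat` sends an infinite count to 0, so the two events agree only almost surely.
  have hae : (fun ω j => (pointCount (fun i => X i ω) (B j)).toNat) ⁻¹' {n}
      =ᵐ[P] {ω | ∀ j, pointCount (fun i => X i ω) (B j) = (n j : ℕ∞)} := by
    filter_upwards [ae_all_iff.2 fun j => h.ae_pointCount_ne_top hl (hm j) (hf j)] with ω hω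
    apply propext
    simp only [Set.preimage, Set.mem_singleton_iff, funext_iff]
    refine forall_congr' fun j => ?_
    rw [← ENat.natCast_inj, ENat.natCast_toNat (hω j)]
  rw [measure_congr hae, ← ofReal_measureReal, h.count_law_fintype B hm hf hd,
    ENNReal.ofReal_prod_of_nonneg (fun j _ => by positivity)]
  refine Finset.prod_congr rfl fun j _ => ?_
  rw [poissonMeasure_singleton, Real.coe_toNNReal _ (by positivity)]

end IsHomogeneousPPP

/-! ### The Laplace functional -/

lemma lintegral_pow_poissonMeasure (r : ℝ≥0) {a : ℝ} (ha : 0 ≤ a) :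
    ∫⁻ n, ENNReal.ofReal a ^ n ∂(poissonMeasure r) = ENNReal.ofReal (Real.exp (-(r * (1 - a)))) := by
  rw [lintegral_countable']
  have : ∀ n : ℕ, ENNReal.ofReal a ^ n * poissonMeasure r {n}
      = ENNReal.ofReal (Real.exp (-r) * ((r * a) ^ n / n.factorial)) := by
    intro n
    rw [poissonMeasure_singleton, ← ENNReal.ofReal_pow ha, ← ENNReal.ofReal_mul (by positivity)]
    congr 1
    rw [mul_pow]; ring
  simp_rw [this]
  have hs : HasSum (fun n : ℕ => Real.exp (-r) * ((r * a) ^ n / n.factorial))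
      (Real.exp (-r) * Real.exp (r * a)) := by
    refine HasSum.mul_left _ ?_
    rw [Real.exp_eq_exp_ℝ]
    exact NormedSpace.expSeries_div_hasSum_exp (r * a : ℝ)
  rw [← ENNReal.ofReal_tsum_of_nonneg (fun n => by positivity) hs.summable, hs.tsum_eq,
    ← Real.exp_add]
  congr 2; ring

/-- The infinite product of the values of `f ≤ 1` at the points of a sequence. -/
def seqProd (f : Plane → ℝ≥0∞) (x : ℕ → Plane) : ℝ≥0∞ := ⨅ m, ∏ i ∈ Finset.range m, f (x i)

lemma antitone_prod_range {f : Plane → ℝ≥0∞} (hf : ∀ y, f y ≤ 1) (x : ℕ → Plane) :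
    Antitone fun m => ∏ i ∈ Finset.range m, f (x i) := by
  refine antitone_nat_of_succ_le fun m => ?_
  rw [Finset.prod_range_succ]
  exact mul_le_of_le_one_right' (hf _)

lemma measurable_seqProd {f : Plane → ℝ≥0∞} (hf : Measurable f) : Measurable (seqProd f) :=
  .iInf fun _ => Finset.measurable_prod _ fun i _ => hf.comp (measurable_pi_apply i)

open Classical in
-- Finite counts make the partial products eventually constant: past the last index of a point in
-- any `B j`, every new factor is 1. Exchanging the two products then counts the factors `a j`.
lemma seqProd_step {ι : Type*} [Fintype ι] (B : ι → Set Plane) (a : ι → ℝ≥0∞) (ha : ∀ j, a j ≤ 1)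
    (x : ℕ → Plane) (hx : ∀ j, pointCount x (B j) ≠ ⊤) :
    seqProd (fun y => ∏ j, if y ∈ B j then a j else 1) x
      = ∏ j, a j ^ (pointCount x (B j)).toNat := by
  have hle : ∀ y, (∏ j, if y ∈ B j then a j else 1) ≤ 1 := fun y =>
    Finset.prod_le_one' fun j _ => by split_ifs <;> simp [ha]
  refine tendsto_nhds_unique (tendsto_atTop_iInf (antitone_prod_range hle x)) ?_
  have hfin : ∀ j, {i | x i ∈ B j}.Finite := fun j => Set.encard_ne_top_iff.1 (hx j)
  refine tendsto_const_nhds.congr' ?_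
  have : ∀ᶠ m in atTop, ∀ j, ∀ i, x i ∈ B j → i < m := by
    refine eventually_all.2 fun j => ?_
    obtain ⟨b, hb⟩ := (hfin j).bddAbove
    filter_upwards [eventually_gt_atTop b] with m hm i hi
    exact lt_of_le_of_lt (hb hi) hm
  filter_upwards [this] with m hm
  rw [Finset.prod_comm]
  refine Finset.prod_congr rfl fun j _ => ?_
  rw [Finset.prod_ite, Finset.prod_const_one, mul_one, Finset.prod_const]
  congr 1
  rw [pointCount, ← Set.ncard, ← Set.ncard_coe_finset]
  congr 1
  ext i
  simp only [Set.mem_ofPred_eq, Finset.coe_filter, Finset.mem_range]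
  exact ⟨fun h => ⟨hm j i h, h⟩, fun h => h.2⟩

namespace IsHomogeneousPPP

variable {Ω : Type*} [MeasurableSpace Ω] {P : Measure Ω} [IsProbabilityMeasure P] {lam : ℝ}
  {X : ℕ → Ω → Plane}

open Classical in
-- By independence of the counts the expectation factors into Poisson generating functions, one for
-- each set.
lemma lintegral_seqProd_step (h : IsHomogeneousPPP P lam X) (hl : 0 ≤ lam) {ι : Type*} [Fintype ι]
    (B : ι → Set Plane) (hm : ∀ j, MeasurableSet (B j)) (hf : ∀ j, volume (B j) ≠ ⊤)
    (hd : Pairwise fun j l => Disjoint (B j) (B l)) (a : ι → ℝ) (ha0 : ∀ j, 0 ≤ a j)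
    (ha : ∀ j, a j ≤ 1) :
    ∫⁻ ω, seqProd (fun y => ∏ j, if y ∈ B j then ENNReal.ofReal (a j) else 1) (fun i => X i ω) ∂P
      = ENNReal.ofReal (Real.exp (-(lam * ∑ j, volume.real (B j) * (1 - a j)))) := by
  have hN : ∀ j, Measurable fun ω => (pointCount (fun i => X i ω) (B j)).toNat :=
    fun j => Measurable.of_discrete.comp (measurable_pointCount h.measurable (hm j))
  have h1 : ∫⁻ ω, seqProd (fun y => ∏ j, if y ∈ B j then ENNReal.ofReal (a j) else 1)
      (fun i => X i ω) ∂P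
      = ∫⁻ ω, ∏ j, ENNReal.ofReal (a j) ^ (pointCount (fun i => X i ω) (B j)).toNat ∂P := by
    refine lintegral_congr_ae ?_
    filter_upwards [ae_all_iff.2 fun j => h.ae_pointCount_ne_top hl (hm j) (hf j)] with ω hω
    exact seqProd_step B _ (fun j => by simpa using ha j) _ hω
  let ν : ι → Measure ℕ := fun j => poissonMeasure (lam * volume.real (B j)).toNNReal
  have h2 : ∫⁻ ω, ∏ j, ENNReal.ofReal (a j) ^ (pointCount (fun i => X i ω) (B j)).toNat ∂P
      = ∫⁻ n, ∏ j, ENNReal.ofReal (a j) ^ (n j) ∂(Measure.pi ν) := by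
    rw [← h.map_counts hl B hm hf hd, lintegral_map (by fun_prop) (measurable_pi_iff.2 hN)]
  have hind : iIndepFun (fun (j : ι) (n : ι → ℕ) => ENNReal.ofReal (a j) ^ (n j))
      (Measure.pi ν) :=
    iIndepFun_pi (X := fun j (n : ℕ) => ENNReal.ofReal (a j) ^ n) fun j =>
      Measurable.of_discrete.aemeasurable
  rw [h1, h2, lintegral_prod_eq_prod_lintegral_of_indepFun _ _ hind (fun j => by fun_prop),
    Finset.mul_sum, ← Finset.sum_neg_distrib, Real.exp_sum,
    ENNReal.ofReal_prod_of_nonneg (fun j _ => (Real.exp_pos _).le)]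
  refine Finset.prod_congr rfl fun j _ => ?_
  rw [(measurePreserving_eval ν j).lintegral_comp (f := fun n : ℕ => ENNReal.ofReal (a j) ^ n)
    Measurable.of_discrete]
  simp only [ν]
  rw [lintegral_pow_poissonMeasure _ (ha0 j)]
  congr 2
  rw [Real.coe_toNNReal _ (by positivity)]
  ring

/-- The Laplace functional of a Poisson process, for simple functions. -/
lemma lintegral_seqProd_simpleFunc (h : IsHomogeneousPPP P lam X) (hl : 0 ≤ lam)
    (φ : SimpleFunc Plane ℝ≥0∞) (hφ : ∀ y, φ y ≤ 1) (hfin : ∫⁻ y, φ y ≠ ⊤) :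
    ∫⁻ ω, seqProd (fun y => 1 - φ y) (fun i => X i ω) ∂P
      = ENNReal.ofReal (Real.exp (-(lam * (∫⁻ y, φ y).toReal))) := by
  classical
  -- The fibre over 0 may have infinite area, and it contributes only factors 1. The other fibres
  -- have finite area because the integral is finite.
  let s := φ.range.filter (· ≠ 0)
  have hle : ∀ c : s, c.1 ≤ 1 := by
    rintro ⟨c, hc⟩
    obtain ⟨y, rfl⟩ := SimpleFunc.mem_range.1 (Finset.mem_filter.1 hc).1
    exact hφ y
  have hne : ∀ c : s, c.1 ≠ ⊤ := fun c => ne_top_of_le_ne_top ENNReal.one_ne_top (hle c)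
  have hle' : ∀ c : s, c.1.toReal ≤ 1 := fun c =>
    ENNReal.toReal_le_of_le_ofReal zero_le_one (by simpa using hle c)
  have hsum : ∫⁻ y, φ y = ∑ c : s, c.1 * volume (φ ⁻¹' {c.1}) := by
    rw [SimpleFunc.lintegral_eq_lintegral, SimpleFunc.lintegral,
      Finset.sum_coe_sort s (fun c => c * volume (φ ⁻¹' {c})),
      Finset.sum_filter_of_ne]
    intro c _ hc h0
    exact hc (by simp [h0])
  have hvol : ∀ c : s, volume (φ ⁻¹' {c.1}) ≠ ⊤ := by
    intro c hc
    apply hfin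
    rw [hsum, ENNReal.sum_eq_top]
    exact ⟨c, Finset.mem_univ _, by rw [hc, ENNReal.mul_top (Finset.mem_filter.1 c.2).2]⟩
  have key := h.lintegral_seqProd_step hl (fun c : s => φ ⁻¹' {c.1})
    (fun c => φ.measurableSet_fiber _) hvol
    (fun c d hcd => by
      simp only
      rw [Set.disjoint_left]
      intro y h1 h2
      exact hcd (Subtype.ext (h1.symm.trans h2)))
    (fun c => 1 - c.1.toReal) (fun c => by linarith [hle' c])
    (fun c => by linarith [ENNReal.toReal_nonneg (a := c.1)])
  have hfun : (fun y => ∏ c : s, if y ∈ φ ⁻¹' {c.1} then ENNReal.ofReal (1 - c.1.toReal) else 1)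
      = fun y => 1 - φ y := by
    ext y
    by_cases h0 : φ y = 0
    · rw [h0, tsub_zero]
      refine Finset.prod_eq_one fun c _ => if_neg ?_
      intro hc
      exact (Finset.mem_filter.1 c.2).2 (hc.symm.trans h0)
    · let c₀ : s := ⟨φ y, Finset.mem_filter.2 ⟨SimpleFunc.mem_range_self _ _, h0⟩⟩
      rw [Finset.prod_eq_single c₀]
      · rw [if_pos (by rfl : y ∈ φ ⁻¹' {c₀.1}), ENNReal.ofReal_sub _ ENNReal.toReal_nonneg,
          ENNReal.ofReal_toReal (hne c₀), ENNReal.ofReal_one]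
      · intro c _ hc
        refine if_neg fun hy => hc (Subtype.ext ?_)
        exact hy.symm
      · simp
  rw [hfun] at key
  rw [key, hsum, ENNReal.toReal_sum (fun c _ => ENNReal.mul_ne_top (hne c) (hvol c))]
  congr 4
  refine Finset.sum_congr rfl fun c _ => ?_
  rw [ENNReal.toReal_mul, Measure.real]
  ring

/-- The Laplace functional of a Poisson process. -/
lemma lintegral_seqProd (h : IsHomogeneousPPP P lam X) (hl : 0 ≤ lam)
    {g : Plane → ℝ≥0∞} (hg : Measurable g) (hg1 : ∀ y, g y ≤ 1) (hfin : ∫⁻ y, g y ≠ ⊤) :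
    ∫⁻ ω, seqProd (fun y => 1 - g y) (fun i => X i ω) ∂P
      = ENNReal.ofReal (Real.exp (-(lam * (∫⁻ y, g y).toReal))) := by
  let φ : ℕ → SimpleFunc Plane ℝ≥0∞ := SimpleFunc.eapprox g
  have hmono : Monotone φ := SimpleFunc.monotone_eapprox g
  have hsup : ∀ y, ⨆ n, φ n y = g y := SimpleFunc.iSup_eapprox_apply hg
  have hle : ∀ n y, φ n y ≤ g y := fun n y => hsup y ▸ le_iSup (fun n => φ n y) n
  have hint : ∀ n, ∫⁻ y, φ n y ≤ ∫⁻ y, g y := fun n => lintegral_mono (hle n)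
  have hstep : ∀ n, ∫⁻ ω, seqProd (fun y => 1 - φ n y) (fun i => X i ω) ∂P
      = ENNReal.ofReal (Real.exp (-(lam * (∫⁻ y, φ n y).toReal))) := fun n =>
    h.lintegral_seqProd_simpleFunc hl (φ n) (fun y => (hle n y).trans (hg1 y))
      (ne_top_of_le_ne_top hfin (hint n))
  have hX : Measurable fun ω i => X i ω := measurable_pi_iff.2 h.measurable
  -- As φ n increases to g, the products decrease, so the limit in n is an infimum and commutes with
  -- the infimum over partial products. Each partial product is finite, hence continuous in its
  -- factors.
  have hseq : ∀ x : ℕ → Plane, seqProd (fun y => 1 - g y) x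
      = ⨅ n, seqProd (fun y => 1 - φ n y) x := by
    intro x
    unfold seqProd
    rw [iInf_comm]
    refine iInf_congr fun m => ?_
    have h1 : Tendsto (fun n => ∏ i ∈ Finset.range m, (1 - φ n (x i))) atTop
        (𝓝 (∏ i ∈ Finset.range m, (1 - g (x i)))) := by
      have h2 : ∀ i, Tendsto (fun n => 1 - φ n (x i)) atTop (𝓝 (1 - g (x i))) := fun i => by
        refine ENNReal.Tendsto.sub tendsto_const_nhds ?_ (Or.inl ENNReal.one_ne_top)
        rw [← hsup]
        exact tendsto_atTop_iSup fun a b hab => hmono hab (x i)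
      clear hstep
      induction m with
      | zero => simp
      | succ m ih =>
        simp_rw [Finset.prod_range_succ]
        have hfinp : ∏ i ∈ Finset.range m, (1 - g (x i)) ≠ ⊤ :=
          ENNReal.prod_ne_top fun i _ => ne_top_of_le_ne_top ENNReal.one_ne_top tsub_le_self
        exact ENNReal.Tendsto.mul ih (Or.inr (ne_top_of_le_ne_top ENNReal.one_ne_top tsub_le_self))
          (h2 m) (Or.inr hfinp)
    refine tendsto_nhds_unique h1 (tendsto_atTop_iInf fun a b hab => ?_)
    exact Finset.prod_le_prod' fun i _ => tsub_le_tsub_left (hmono hab (x i)) 1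
  simp_rw [hseq]
  rw [lintegral_iInf]
  · simp_rw [hstep]
    have hlim : Tendsto (fun n => ENNReal.ofReal (Real.exp (-(lam * (∫⁻ y, φ n y).toReal)))) atTop
        (𝓝 (ENNReal.ofReal (Real.exp (-(lam * (∫⁻ y, g y).toReal))))) := by
      have h1 : Tendsto (fun n => ∫⁻ y, φ n y) atTop (𝓝 (∫⁻ y, g y)) := by
        simp_rw [← hsup]
        exact lintegral_tendsto_of_tendsto_of_monotone (fun n => (φ n).measurable.aemeasurable)
          (ae_of_all _ fun y a b hab => hmono hab y)
          (ae_of_all _ fun y => tendsto_atTop_iSup fun a b hab => hmono hab y)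
      have h2 := (ENNReal.tendsto_toReal hfin).comp h1
      exact ENNReal.tendsto_ofReal ((Real.continuous_exp.tendsto _).comp (h2.const_mul lam).neg)
    refine tendsto_nhds_unique (tendsto_atTop_iInf ?_) hlim
    intro a b hab
    simp only
    gcongr
    · exact ne_top_of_le_ne_top hfin (hint b)
    · exact hmono hab _
  · intro n
    exact (measurable_seqProd (measurable_const.sub (φ n).measurable)).comp hX
  · intro a b hab ω
    refine iInf_mono fun m => Finset.prod_le_prod' fun i _ => tsub_le_tsub_left (hmono hab _) 1
  · refine ne_top_of_le_ne_top ENNReal.one_ne_top ?_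
    calc _ ≤ ∫⁻ _, 1 ∂P := lintegral_mono fun ω => (iInf_le _ 0).trans (by simp)
      _ = 1 := by simp

end IsHomogeneousPPP

/-! ### Independent marks -/

/-- The three hypotheses say that the joint law of the four variables is a product of four laws.
Regrouping amounts to exchanging the two middle integrals by Tonelli. -/
lemma indepFun_prodMk_prodMk_comm {Ω α β γ δ : Type*} [MeasurableSpace Ω] [MeasurableSpace α]
    [MeasurableSpace β] [MeasurableSpace γ] [MeasurableSpace δ] {P : Measure Ω}
    [IsProbabilityMeasure P] {U : Ω → α} {V : Ω → β} {Z : Ω → γ} {W : Ω → δ}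
    (hU : Measurable U) (hV : Measurable V) (hZ : Measurable Z) (hW : Measurable W)
    (hUV : IndepFun U V P) (hZW : IndepFun Z W P)
    (h : IndepFun (fun ω => (U ω, V ω)) (fun ω => (Z ω, W ω)) P) :
    IndepFun (fun ω => (U ω, Z ω)) (fun ω => (V ω, W ω)) P := by
  have hUV' := hUV.map_prod_eq_prod_map_map hU.aemeasurable hV.aemeasurable
  have hZW' := hZW.map_prod_eq_prod_map_map hZ.aemeasurable hW.aemeasurable
  have h' := h.map_prod_eq_prod_map_map (by fun_prop) (by fun_prop)
  rw [hUV', hZW'] at h'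
  have := Measure.isProbabilityMeasure_map (μ := P) hU.aemeasurable
  have := Measure.isProbabilityMeasure_map (μ := P) hV.aemeasurable
  have := Measure.isProbabilityMeasure_map (μ := P) hZ.aemeasurable
  have := Measure.isProbabilityMeasure_map (μ := P) hW.aemeasurable
  have hL : ∀ f : (α × β) × (γ × δ) → ℝ≥0∞, Measurable f →
      ∫⁻ ω, f ((U ω, V ω), (Z ω, W ω)) ∂P
        = ∫⁻ u, ∫⁻ v, ∫⁻ z, ∫⁻ w, f ((u, v), (z, w)) ∂(P.map W) ∂(P.map Z) ∂(P.map V) ∂(P.map U) := by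
    intro f hf
    rw [← lintegral_map (f := f) (g := fun ω => ((U ω, V ω), (Z ω, W ω))) hf (by fun_prop), h',
      lintegral_prod _ hf.aemeasurable, lintegral_prod _ (by fun_prop)]
    refine lintegral_congr fun u => lintegral_congr fun v => ?_
    rw [lintegral_prod _ (by fun_prop)]
  have hUZ : ∀ g : α × γ → ℝ≥0∞, Measurable g →
      ∫⁻ x, g x ∂(P.map fun ω => (U ω, Z ω)) = ∫⁻ u, ∫⁻ z, g (u, z) ∂(P.map Z) ∂(P.map U) := by
    intro g hg
    rw [lintegral_map hg (by fun_prop), hL (fun x => g (x.1.1, x.2.1)) (by fun_prop)]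
    simp
  have hVW : ∀ g : β × δ → ℝ≥0∞, Measurable g →
      ∫⁻ x, g x ∂(P.map fun ω => (V ω, W ω)) = ∫⁻ v, ∫⁻ w, g (v, w) ∂(P.map W) ∂(P.map V) := by
    intro g hg
    rw [lintegral_map hg (by fun_prop), hL (fun x => g (x.1.2, x.2.2)) (by fun_prop)]
    simp
  rw [indepFun_iff_map_prod_eq_prod_map_map (by fun_prop) (by fun_prop)]
  refine Measure.ext_of_lintegral _ fun f hf => ?_
  have := Measure.isProbabilityMeasure_map (μ := P) (f := fun ω => (V ω, W ω)) (by fun_prop)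
  rw [lintegral_map hf (by fun_prop), hL (fun x => f ((x.1.1, x.2.1), (x.1.2, x.2.2))) (by fun_prop),
    lintegral_prod _ hf.aemeasurable, hUZ _ (hf.lintegral_prod_right')]
  refine lintegral_congr fun u => ?_
  rw [lintegral_lintegral_swap (by fun_prop)]
  refine lintegral_congr fun z => ?_
  rw [hVW (fun x => f ((u, z), x)) (by fun_prop)]

/-- Continuity from above along the cylinders that constrain only the first m coordinates. -/
lemma infinitePi_forall_mem {S : Type*} [MeasurableSpace S] (κ : Measure S)
    [IsProbabilityMeasure κ] {t : ℕ → Set S} (ht : ∀ i, MeasurableSet (t i)) :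
    Measure.infinitePi (fun _ : ℕ => κ) {z | ∀ i, z i ∈ t i}
      = ⨅ m, ∏ i ∈ Finset.range m, κ (t i) := by
  have h1 : {z : ℕ → S | ∀ i, z i ∈ t i}
      = ⋂ m : ℕ, (Finset.range m : Set ℕ).pi t := by
    ext z
    simp only [Set.mem_ofPred_eq, Set.mem_iInter, Set.mem_pi, Finset.coe_range, Set.mem_Iio]
    exact ⟨fun h m i _ => h i, fun h i => h (i + 1) i (Nat.lt_succ_self i)⟩
  have hm : ∀ m : ℕ, MeasurableSet ((Finset.range m : Set ℕ).pi t) :=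
    fun m => .pi (Finset.countable_toSet _) fun i _ => ht i
  rw [h1, Antitone.measure_iInter]
  · refine iInf_congr fun m => ?_
    rw [Measure.infinitePi_pi _ fun i _ => ht i]
  · intro a b hab
    exact Set.pi_mono' (fun i _ => subset_rfl) (by simpa using hab)
  · exact fun m => (hm m).nullMeasurableSet
  · exact ⟨0, measure_ne_top _ _⟩

namespace IsHomogeneousPPP

variable {Ω : Type*} [MeasurableSpace Ω] {P : Measure Ω} [IsProbabilityMeasure P] {lam : ℝ}
  {X : ℕ → Ω → Plane} {S : Type*} [MeasurableSpace S] {Z : ℕ → Ω → S} {κ : Measure S}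
  [IsProbabilityMeasure κ]

/-- The void probabilities of an independently marked Poisson process. -/
lemma measure_forall_notMem (h : IsHomogeneousPPP P lam X) (hl : 0 ≤ lam)
    (hZm : ∀ i, Measurable (Z i)) (hZlaw : ∀ i, P.map (Z i) = κ) (hZ : iIndepFun Z P)
    (hXZ : IndepFun (fun ω i => X i ω) (fun ω i => Z i ω) P) {B : Set (Plane × S)}
    (hB : MeasurableSet B) (hfin : ∫⁻ y, κ (Prod.mk y ⁻¹' B) ≠ ⊤) :
    P {ω | ∀ i, (X i ω, Z i ω) ∉ B}
      = ENNReal.ofReal (Real.exp (-(lam * (∫⁻ y, κ (Prod.mk y ⁻¹' B)).toReal))) := by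
  have hX : Measurable fun ω i => X i ω := measurable_pi_iff.2 h.measurable
  have hZ' : Measurable fun ω i => Z i ω := measurable_pi_iff.2 hZm
  have hlawZ : P.map (fun ω i => Z i ω) = Measure.infinitePi fun _ => κ := by
    rw [hZ.map_fun_eq_infinitePi_map hZm]
    simp_rw [hZlaw]
  have hlaw := hXZ.map_prod_eq_prod_map_map hX.aemeasurable hZ'.aemeasurable
  rw [hlawZ] at hlaw
  have hset : MeasurableSet {q : (ℕ → Plane) × (ℕ → S) | ∀ i, (q.1 i, q.2 i) ∉ B} := by
    rw [Set.ofPred_forall]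
    refine .iInter fun i => ?_
    exact hB.compl.preimage (by fun_prop : Measurable fun q : (ℕ → Plane) × (ℕ → S) => (q.1 i, q.2 i))
  have hκ : Measurable fun y => κ (Prod.mk y ⁻¹' B) := measurable_measure_prodMk_left hB
  have h1 : P {ω | ∀ i, (X i ω, Z i ω) ∉ B}
      = P.map (fun ω => ((fun i => X i ω), (fun i => Z i ω)))
        {q | ∀ i, (q.1 i, q.2 i) ∉ B} := by
    rw [Measure.map_apply (hX.prodMk hZ') hset]
    rfl
  rw [h1, hlaw, Measure.prod_apply hset, lintegral_map (measurable_measure_prodMk_left hset) hX,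
    ← h.lintegral_seqProd hl hκ (fun y => prob_le_one) hfin]
  -- Given the positions, the marks are i.i.d., so the conditional void probability is the infinite
  -- product of the 1 - κ(section), which is `seqProd`.
  refine lintegral_congr fun ω => ?_
  have h2 : Prod.mk (fun i => X i ω) ⁻¹' {q : (ℕ → Plane) × (ℕ → S) | ∀ i, (q.1 i, q.2 i) ∉ B}
      = {z | ∀ i, z i ∈ (Prod.mk (X i ω) ⁻¹' B)ᶜ} := rfl
  have hBy : ∀ y : Plane, MeasurableSet (Prod.mk y ⁻¹' B) := fun y => hB.preimage (by fun_prop)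
  rw [h2, infinitePi_forall_mem κ fun i => (hBy _).compl]
  simp_rw [prob_compl_eq_one_sub (hBy _)]
  rfl

/-- The void probabilities of an independently marked Poisson process that is seen from an
independent random point. -/
lemma measure_inter_forall_notMem (h : IsHomogeneousPPP P lam X) (hl : 0 ≤ lam)
    (hZm : ∀ i, Measurable (Z i)) (hZlaw : ∀ i, P.map (Z i) = κ) (hZ : iIndepFun Z P)
    (hXZ : IndepFun (fun ω i => X i ω) (fun ω i => Z i ω) P) {B : Set (Plane × S)}
    (hB : MeasurableSet B) (hfin : ∫⁻ y, κ (Prod.mk y ⁻¹' B) ≠ ⊤)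
    {α : Type*} [MeasurableSpace α] {W : Ω → α} (hW : Measurable W)
    (hind : IndepFun W (fun ω => ((fun i => X i ω), (fun i => Z i ω))) P)
    {v : α → Plane} (hv : Measurable v) {s : Set α} (hs : MeasurableSet s) :
    P {ω | W ω ∈ s ∧ ∀ i, (v (W ω) - X i ω, Z i ω) ∉ B}
      = P (W ⁻¹' s)
        * ENNReal.ofReal (Real.exp (-(lam * (∫⁻ y, κ (Prod.mk y ⁻¹' B)).toReal))) := by
  have hX : Measurable fun ω i => X i ω := measurable_pi_iff.2 h.measurable
  have hZ' : Measurable fun ω i => Z i ω := measurable_pi_iff.2 hZm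
  have hXZm := hX.prodMk hZ'
  have hlaw := hind.map_prod_eq_prod_map_map hW.aemeasurable hXZm.aemeasurable
  let Q : Set (α × ((ℕ → Plane) × (ℕ → S))) :=
    {q | q.1 ∈ s ∧ ∀ i, (v q.1 - q.2.1 i, q.2.2 i) ∉ B}
  have hQ : MeasurableSet Q := by
    have h2 : MeasurableSet {q : α × ((ℕ → Plane) × (ℕ → S)) |
        ∀ i, (v q.1 - q.2.1 i, q.2.2 i) ∉ B} := by
      rw [Set.ofPred_forall]
      refine .iInter fun i => ?_
      exact hB.compl.preimage (by fun_prop :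
        Measurable fun q : α × ((ℕ → Plane) × (ℕ → S)) => (v q.1 - q.2.1 i, q.2.2 i))
    exact (measurable_fst hs).inter h2
  have := Measure.isProbabilityMeasure_map (μ := P) hXZm.aemeasurable
  have h1 : P {ω | W ω ∈ s ∧ ∀ i, (v (W ω) - X i ω, Z i ω) ∉ B}
      = P.map (fun ω => (W ω, ((fun i => X i ω), (fun i => Z i ω)))) Q := by
    rw [Measure.map_apply (hW.prodMk hXZm) hQ]
    rfl
  have h2 : ∀ w, P.map (fun ω => ((fun i => X i ω), (fun i => Z i ω))) (Prod.mk w ⁻¹' Q)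
      = s.indicator (fun _ => ENNReal.ofReal
          (Real.exp (-(lam * (∫⁻ y, κ (Prod.mk y ⁻¹' B)).toReal)))) w := by
    intro w
    rw [Measure.map_apply hXZm (hQ.preimage (by fun_prop))]
    by_cases hw : w ∈ s
    · rw [Set.indicator_of_mem hw]
      have hB' : MeasurableSet ((fun q : Plane × S => (v w - q.1, q.2)) ⁻¹' B) :=
        hB.preimage (by fun_prop)
      -- The map y ↦ v w - y preserves area, so the void probability is the same for every value w
      -- of the independent variable.
      have hint : ∫⁻ y, κ (Prod.mk y ⁻¹' ((fun q : Plane × S => (v w - q.1, q.2)) ⁻¹' B))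
          = ∫⁻ y, κ (Prod.mk y ⁻¹' B) :=
        lintegral_sub_left_eq_self (μ := (volume : Measure Plane))
          (fun y => κ (Prod.mk y ⁻¹' B)) (v w)
      have := h.measure_forall_notMem hl hZm hZlaw hZ hXZ hB' (by rwa [hint])
      rw [hint] at this
      rw [← this]
      congr 1
      ext ω
      simp [Q, hw]
    · rw [Set.indicator_of_notMem hw]
      have : (fun ω => ((fun i => X i ω), (fun i => Z i ω))) ⁻¹' (Prod.mk w ⁻¹' Q) = ∅ := by
        ext ω
        simp [Q, hw]
      rw [this, measure_empty]
  rw [h1, hlaw, Measure.prod_apply hQ]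
  simp_rw [h2]
  rw [lintegral_indicator hs, setLIntegral_const, Measure.map_apply hW hs, mul_comm]

end IsHomogeneousPPP

/-! ### The minimal point of a Poisson process -/

/-- Cutting [s, t] where L takes its midpoint value replaces δ² by 2(δ/2)², so each bisection halves
the bound on the increment. Iterating forces it to vanish. Continuity of L supplies the cutting
point. -/
lemma eq_of_abs_sub_le_sq {F L : ℝ → ℝ} (hmono : Monotone L) (hcont : Continuous L)
    (h : ∀ s t, s ≤ t → |F t - F s| ≤ (L t - L s) ^ 2) {s t : ℝ} (hst : s ≤ t) : F t = F s := by
  have key : ∀ (k : ℕ) (s t : ℝ), s ≤ t → |F t - F s| ≤ (L t - L s) ^ 2 / 2 ^ k := by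
    intro k
    induction k with
    | zero => simpa using h
    | succ k ih =>
      intro s t hst
      obtain ⟨c, hc, hLc⟩ := intermediate_value_Icc hst hcont.continuousOn
        (show (L s + L t) / 2 ∈ Set.Icc (L s) (L t) by
          have := hmono hst
          constructor <;> linarith)
      have h1 := ih s c hc.1
      have h2 := ih c t hc.2
      have h3 := abs_sub_le (F t) (F c) (F s)
      rw [hLc] at h1 h2
      calc |F t - F s| ≤ (L t - (L s + L t) / 2) ^ 2 / 2 ^ k
          + ((L s + L t) / 2 - L s) ^ 2 / 2 ^ k := by linarith
        _ = (L t - L s) ^ 2 / 2 ^ (k + 1) := by ring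
  have hlim : Tendsto (fun k : ℕ => (L t - L s) ^ 2 / 2 ^ k) atTop (𝓝 0) :=
    tendsto_const_nhds.div_atTop (tendsto_pow_atTop_atTop_of_one_lt one_lt_two)
  have := ge_of_tendsto' hlim fun k => key k s t hst
  exact sub_eq_zero.1 (abs_eq_zero.1 (le_antisymm this (abs_nonneg _)))

section Minimizer

variable {Ω S : Type*} [MeasurableSpace Ω] [MeasurableSpace S] {P : Measure Ω}
  [IsProbabilityMeasure P] {Y : ℕ → Ω → S} {ν : Measure S} {T : S → ℝ}

lemma measurableSet_exists_le (hY : ∀ i, Measurable (Y i)) (hT : Measurable T) (t : ℝ) :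
    MeasurableSet {ω | ∃ i, T (Y i ω) ≤ t} := by
  rw [Set.ofPred_exists]
  exact .iUnion fun i => measurableSet_le (hT.comp (hY i)) measurable_const

/-- The event is a difference of two nested void events, for {T ≤ s} and for {T ≤ s} ∪ A. -/
lemma measureReal_exists_le_diff (hY : ∀ i, Measurable (Y i))
    (hvoid : ∀ B, MeasurableSet B → ν B ≠ ⊤ →
      P {ω | ∀ i, Y i ω ∉ B} = ENNReal.ofReal (Real.exp (-ν.real B)))
    (hT : Measurable T) (hfin : ∀ t, ν {y | T y ≤ t} ≠ ⊤) {s t : ℝ}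
    {A : Set S} (hA : MeasurableSet A) (hAt : A ⊆ {y | T y ≤ t}) (hAs : Disjoint {y | T y ≤ s} A) :
    P.real {ω | (∃ i, Y i ω ∈ A) ∧ ∀ i, s < T (Y i ω)}
      = Real.exp (-ν.real {y | T y ≤ s}) * (1 - Real.exp (-ν.real A)) := by
  have hms : MeasurableSet {y | T y ≤ s} := measurableSet_le hT measurable_const
  have hAfin : ν A ≠ ⊤ := ne_top_of_le_ne_top (hfin t) (measure_mono hAt)
  have hvoid' : ∀ B, MeasurableSet B → ν B ≠ ⊤ →
      P.real {ω | ∀ i, Y i ω ∉ B} = Real.exp (-ν.real B) := fun B hB hB' => by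
    rw [Measure.real, hvoid B hB hB', ENNReal.toReal_ofReal (Real.exp_pos _).le]
  have h1 := hvoid' _ hms (hfin s)
  have h2 := hvoid' _ (hms.union hA) (measure_union_ne_top (hfin s) hAfin)
  rw [measureReal_union hAs hA (hfin s) hAfin] at h2
  have hdiff : {ω | (∃ i, Y i ω ∈ A) ∧ ∀ i, s < T (Y i ω)}
      = {ω | ∀ i, Y i ω ∉ {y | T y ≤ s}} \ {ω | ∀ i, Y i ω ∉ {y | T y ≤ s} ∪ A} := by
    ext ω
    simp only [Set.mem_ofPred_eq, Set.mem_sdiff, Set.mem_union, not_or, not_le, not_forall,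
      not_and, not_not]
    constructor
    · rintro ⟨⟨i, hi⟩, h⟩
      exact ⟨h, i, fun _ => hi⟩
    · rintro ⟨h, i, hi⟩
      exact ⟨⟨i, hi (h i)⟩, h⟩
  rw [hdiff, measureReal_sdiff, h1, h2, neg_add, Real.exp_add]
  · ring
  · intro ω h i hi
    exact h i (Or.inl hi)
  · rw [Set.ofPred_forall]
    exact .iInter fun i => ((hms.union hA).preimage (hY i)).compl

/-- If the minimum falls in the strip and `E` occurs, then some point lies in A within the strip and
none lies below it. The bound follows from 1 - exp(-x) ≤ x. Monotonicity of the outer measure is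
enough, so `E` need not be measurable. -/
lemma measureReal_minimizer_le (hY : ∀ i, Measurable (Y i))
    (hvoid : ∀ B, MeasurableSet B → ν B ≠ ⊤ →
      P {ω | ∀ i, Y i ω ∉ B} = ENNReal.ofReal (Real.exp (-ν.real B)))
    (hT : Measurable T) (hfin : ∀ t, ν {y | T y ≤ t} ≠ ⊤)
    {A : Set S} (hA : MeasurableSet A) {E : Set Ω}
    (hE : ∀ᵐ ω ∂P, ∃ i, (∀ j, T (Y i ω) ≤ T (Y j ω)) ∧ (ω ∈ E ↔ Y i ω ∈ A)) (s t : ℝ) :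
    P.real (E ∩ ({ω | ∃ i, T (Y i ω) ≤ t} \ {ω | ∃ i, T (Y i ω) ≤ s}))
      ≤ Real.exp (-ν.real {y | T y ≤ s}) * ν.real (A ∩ {y | s < T y ∧ T y ≤ t}) := by
  have hmA : MeasurableSet (A ∩ {y | s < T y ∧ T y ≤ t}) :=
    hA.inter ((measurableSet_lt measurable_const hT).inter (measurableSet_le hT measurable_const))
  have h1 := measureReal_exists_le_diff hY hvoid hT hfin (s := s) (t := t) hmA
    (fun y hy => hy.2.2) (Set.disjoint_left.2 fun y h1 h2 => absurd h2.2.1 (not_lt.2 h1))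
  calc _ ≤ P.real {ω | (∃ i, Y i ω ∈ A ∩ {y | s < T y ∧ T y ≤ t}) ∧ ∀ i, s < T (Y i ω)} := by
        refine ENNReal.toReal_mono (measure_ne_top _ _) (measure_mono_ae ?_)
        filter_upwards [hE] with ω ⟨i, hi, hiff⟩ ⟨hωE, ⟨k, hk⟩, hs⟩
        have hs' : ∀ i, s < T (Y i ω) := fun i => by
          by_contra hcon
          exact hs ⟨i, not_lt.1 hcon⟩
        exact ⟨⟨i, hiff.1 hωE, hs' i, (hi k).trans hk⟩, hs'⟩
    _ = _ := h1
    _ ≤ _ := by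
        gcongr
        linarith [Real.add_one_le_exp (-ν.real (A ∩ {y | s < T y ∧ T y ≤ t}))]

/-- The probability that the minimizer of `T` over a point process lies in `A`, when the void
probabilities are those of a Poisson process with intensity measure `ν`. -/
theorem measure_minimizer_mem (hY : ∀ i, Measurable (Y i))
    (hvoid : ∀ B, MeasurableSet B → ν B ≠ ⊤ →
      P {ω | ∀ i, Y i ω ∉ B} = ENNReal.ofReal (Real.exp (-ν.real B)))
    (hT : Measurable T) (hfin : ∀ t, ν {y | T y ≤ t} ≠ ⊤)
    (hcont : Continuous fun t => ν.real {y | T y ≤ t}) (h0 : ν {y | T y ≤ 0} = 0)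
    {A : Set S} (hA : MeasurableSet A) {E : Set Ω}
    (hE : ∀ᵐ ω ∂P, ∃ i, (∀ j, T (Y i ω) ≤ T (Y j ω)) ∧ (ω ∈ E ↔ Y i ω ∈ A)) :
    P E = ∫⁻ y in A, ENNReal.ofReal (Real.exp (-ν.real {y' | T y' ≤ T y})) ∂ν := by
  set L : ℝ → ℝ := fun t => ν.real {y | T y ≤ t} with hL
  have hmono : Monotone L := fun a b hab =>
    measureReal_mono (fun y (hy : T y ≤ a) => hy.trans hab) (hfin b)
  have hL0 : ∀ t, 0 ≤ L t := fun t => measureReal_nonneg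
  let R : ℝ → Set Ω := fun t => {ω | ∃ i, T (Y i ω) ≤ t}
  have hR : ∀ t, MeasurableSet (R t) := measurableSet_exists_le hY hT
  have hRmono : Monotone R := fun a b hab ω ⟨i, hi⟩ => ⟨i, hi.trans hab⟩
  have hmt : ∀ t, MeasurableSet {y | T y ≤ t} := fun t => measurableSet_le hT measurable_const
  let w : S → ℝ≥0∞ := fun y => ENNReal.ofReal (Real.exp (-L (T y)))
  have hw : Measurable w := by
    have := hmono.measurable
    fun_prop
  have hw1 : ∀ y, w y ≤ 1 := fun y => by
    simp only [w, ENNReal.ofReal_le_one, Real.exp_le_one_iff, Left.neg_nonpos_iff]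
    exact hL0 _
  let G₁ : ℝ → ℝ := fun t => P.real (E ∩ R t)
  let G₂' : ℝ → ℝ≥0∞ := fun t => ∫⁻ y in A ∩ {y | T y ≤ t}, w y ∂ν
  let G₂ : ℝ → ℝ := fun t => (G₂' t).toReal
  have hG₂fin : ∀ t, G₂' t ≠ ⊤ := fun t => by
    refine ne_top_of_le_ne_top (hfin t) ?_
    calc G₂' t ≤ ∫⁻ y in A ∩ {y | T y ≤ t}, 1 ∂ν := lintegral_mono hw1
      _ ≤ _ := by
        rw [setLIntegral_one]
        exact measure_mono Set.inter_subset_right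
  have hstrip : ∀ s t, s ≤ t → {y | T y ≤ t} = {y | T y ≤ s} ∪ {y | s < T y ∧ T y ≤ t} := by
    intro s t hst
    ext y
    simp only [Set.mem_ofPred_eq, Set.mem_union]
    constructor
    · intro h
      rcases le_or_gt (T y) s with h' | h'
      · exact Or.inl h'
      · exact Or.inr ⟨h', h⟩
    · rintro (h | h)
      · exact h.trans hst
      · exact h.2
  have hms : ∀ s t, MeasurableSet {y | s < T y ∧ T y ≤ t} := fun s t =>
    (measurableSet_lt measurable_const hT).inter (hmt t)
  have hsfin : ∀ s t, ν {y | s < T y ∧ T y ≤ t} ≠ ⊤ := fun s t =>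
    ne_top_of_le_ne_top (hfin t) (measure_mono fun y hy => hy.2)
  have hdisj : ∀ s t, Disjoint {y | T y ≤ s} {y | s < T y ∧ T y ≤ t} := fun s t =>
    Set.disjoint_left.2 fun y h1 h2 => absurd h2.1 (not_lt.2 h1)
  have hLdiff : ∀ s t, s ≤ t → ν.real {y | s < T y ∧ T y ≤ t} = L t - L s := by
    intro s t hst
    simp only [hL]
    rw [hstrip s t hst, measureReal_union (hdisj s t) (hms s t) (hfin s) (hsfin s t)]
    ring
  have hG₁diff : ∀ s t, s ≤ t → G₁ t - G₁ s = P.real (E ∩ (R t \ R s)) := by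
    intro s t hst
    have h1 := measureReal_inter_add_sdiff (μ := P) (s := E ∩ R t) (hR s)
    have h2 : E ∩ R t ∩ R s = E ∩ R s := by
      rw [Set.inter_assoc, Set.inter_eq_right.2 (hRmono hst)]
    rw [h2, Set.inter_sdiff_assoc] at h1
    simp only [G₁]
    linarith
  have hG₂diff : ∀ s t, s ≤ t →
      G₂' t = G₂' s + ∫⁻ y in A ∩ {y | s < T y ∧ T y ≤ t}, w y ∂ν := by
    intro s t hst
    simp only [G₂']
    rw [hstrip s t hst, Set.inter_union_distrib_left, lintegral_union (hA.inter (hms s t))]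
    exact (hdisj s t).mono Set.inter_subset_right Set.inter_subset_right
  have hexp : ∀ x : ℝ, 0 ≤ x → Real.exp (-x) ≤ 1 := fun x hx => by
    rw [Real.exp_le_one_iff]; linarith
  have hG₂low : ∀ s t, s ≤ t →
      Real.exp (-L t) * ν.real (A ∩ {y | s < T y ∧ T y ≤ t}) ≤ G₂ t - G₂ s := by
    intro s t hst
    have hne : ∫⁻ y in A ∩ {y | s < T y ∧ T y ≤ t}, w y ∂ν ≠ ⊤ :=
      ne_top_of_le_ne_top (hG₂fin t) (by rw [hG₂diff s t hst]; exact le_add_self)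
    simp only [G₂]
    rw [hG₂diff s t hst, ENNReal.toReal_add (hG₂fin s) hne, add_sub_cancel_left,
      ← ENNReal.ofReal_le_iff_le_toReal hne, ENNReal.ofReal_mul (Real.exp_pos _).le,
      ofReal_measureReal (ne_top_of_le_ne_top (hsfin s t) (measure_mono Set.inter_subset_right)),
      ← setLIntegral_const]
    refine setLIntegral_mono hw fun y hy => ENNReal.ofReal_le_ofReal (Real.exp_le_exp.2 ?_)
    exact neg_le_neg (hmono hy.2.2)
  have hG₂up : ∀ s t, s ≤ t →
      G₂ t - G₂ s ≤ Real.exp (-L s) * ν.real (A ∩ {y | s < T y ∧ T y ≤ t}) := by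
    intro s t hst
    have hne : ∫⁻ y in A ∩ {y | s < T y ∧ T y ≤ t}, w y ∂ν ≠ ⊤ :=
      ne_top_of_le_ne_top (hG₂fin t) (by rw [hG₂diff s t hst]; exact le_add_self)
    simp only [G₂]
    rw [hG₂diff s t hst, ENNReal.toReal_add (hG₂fin s) hne, add_sub_cancel_left]
    refine ENNReal.toReal_le_of_le_ofReal (by positivity) ?_
    rw [ENNReal.ofReal_mul (Real.exp_pos _).le,
      ofReal_measureReal (ne_top_of_le_ne_top (hsfin s t) (measure_mono Set.inter_subset_right)),
      ← setLIntegral_const]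
    refine setLIntegral_mono measurable_const fun y hy =>
      ENNReal.ofReal_le_ofReal (Real.exp_le_exp.2 ?_)
    exact neg_le_neg (hmono hy.2.1.le)
  -- The upper bound applied to the complement of `E`, subtracted from the exact probability that
  -- the minimum lies in the strip, yields the matching lower bound for `E`.
  have hEc : ∀ᵐ ω ∂P, ∃ i, (∀ j, T (Y i ω) ≤ T (Y j ω)) ∧ (ω ∈ Eᶜ ↔ Y i ω ∈ Aᶜ) := by
    filter_upwards [hE] with ω ⟨i, hi, hiff⟩
    exact ⟨i, hi, not_congr hiff⟩
  have hall : ∀ s t, s ≤ t → P.real (R t \ R s) = Real.exp (-L s) - Real.exp (-L t) := by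
    intro s t hst
    have h1 := measureReal_exists_le_diff hY hvoid hT hfin (s := s) (t := t) (hms s t)
      (fun y hy => hy.2) (hdisj s t)
    rw [hLdiff s t hst] at h1
    have h2 : R t \ R s = {ω | (∃ i, Y i ω ∈ {y | s < T y ∧ T y ≤ t}) ∧ ∀ i, s < T (Y i ω)} := by
      ext ω
      simp only [R, Set.mem_sdiff, Set.mem_ofPred_eq, not_exists, not_le]
      constructor
      · rintro ⟨⟨i, hi⟩, h⟩
        exact ⟨⟨i, h i, hi⟩, h⟩
      · rintro ⟨⟨i, hi⟩, h⟩
        exact ⟨⟨i, hi.2⟩, h⟩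
    rw [h2, h1, mul_sub, mul_one, ← Real.exp_add]
    congr 2
    simp only [hL]
    ring
  have hsplit : ∀ s t, s ≤ t → ν.real (A ∩ {y | s < T y ∧ T y ≤ t})
      + ν.real (Aᶜ ∩ {y | s < T y ∧ T y ≤ t}) = L t - L s := by
    intro s t hst
    rw [← hLdiff s t hst, ← measureReal_inter_add_sdiff (μ := ν)
      (s := {y | s < T y ∧ T y ≤ t}) hA (hsfin s t), Set.inter_comm, Set.sdiff_eq, Set.inter_comm Aᶜ]
  have hbound : ∀ s t, s ≤ t → |(G₁ t - G₂ t) - (G₁ s - G₂ s)| ≤ (L t - L s) ^ 2 := by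
    intro s t hst
    have hup := measureReal_minimizer_le hY hvoid hT hfin hA hE s t
    have hup' := measureReal_minimizer_le hY hvoid hT hfin hA.compl hEc s t
    have hsub : P.real (R t \ R s) ≤ P.real (E ∩ (R t \ R s)) + P.real (Eᶜ ∩ (R t \ R s)) := by
      refine le_trans (measureReal_mono ?_) (measureReal_union_le _ _)
      intro ω hω
      by_cases h : ω ∈ E
      · exact Or.inl ⟨h, hω⟩
      · exact Or.inr ⟨h, hω⟩
    rw [hall s t hst] at hsub
    have hd1 := hG₁diff s t hst
    have hlow := hG₂low s t hst
    have hupp := hG₂up s t hst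
    have hsp := hsplit s t hst
    change P.real (E ∩ (R t \ R s)) ≤ Real.exp (-L s) * _ at hup
    change P.real (Eᶜ ∩ (R t \ R s)) ≤ Real.exp (-L s) * _ at hup'
    set a := ν.real (A ∩ {y | s < T y ∧ T y ≤ t})
    set a' := ν.real (Aᶜ ∩ {y | s < T y ∧ T y ≤ t})
    have ha : 0 ≤ a := measureReal_nonneg
    have ha' : 0 ≤ a' := measureReal_nonneg
    have hδ : 0 ≤ L t - L s := by linarith
    have hes := hexp _ (hL0 s)
    have hes0 := Real.exp_pos (-L s)
    have hmul : Real.exp (-L t) = Real.exp (-L s) * Real.exp (-(L t - L s)) := by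
      rw [← Real.exp_add]; congr 1; ring
    set δ := L t - L s
    have hlow1 : 1 - δ ≤ Real.exp (-δ) := by linarith [Real.add_one_le_exp (-δ)]
    -- From exp(-δ) ≤ 1/(1 + δ), since (1 - δ + δ²)(1 + δ) = 1 + δ³ ≥ 1.
    have hupp1 : Real.exp (-δ) ≤ 1 - δ + δ ^ 2 := by
      have h1 : Real.exp (-δ) * (1 + δ) ≤ 1 := by
        calc Real.exp (-δ) * (1 + δ) ≤ Real.exp (-δ) * Real.exp δ := by
              gcongr
              linarith [Real.add_one_le_exp δ]
          _ = 1 := by rw [← Real.exp_add]; simp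
      have h2 : (1 - δ + δ ^ 2) * (1 + δ) = 1 + δ ^ 3 := by ring
      have h3 : 0 ≤ δ ^ 3 := by positivity
      by_contra hcon
      push Not at hcon
      have := mul_lt_mul_of_pos_right hcon (by linarith : 0 < 1 + δ)
      linarith
    rw [hmul] at hsub hlow
    rw [abs_le]
    set e := Real.exp (-L s)
    set d := Real.exp (-δ)
    constructor
    -- Lower side: the increment of `G₁` is at least e(1 - d) - e a', that of `G₂` is at most e a,
    -- and a + a' = δ.
    · have h1 : (G₁ t - G₂ t) - (G₁ s - G₂ s) ≥ e * (1 - d - δ) := by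
        rw [← hsp]
        nlinarith
      have h2 : e * (1 - d - δ) ≥ e * (-δ ^ 2) := by gcongr; linarith
      nlinarith [sq_nonneg δ]
    -- Upper side: the increment of `G₁` is at most e a and that of `G₂` at least e d a, while both
    -- a and 1 - d are at most δ.
    · have h1 : (G₁ t - G₂ t) - (G₁ s - G₂ s) ≤ e * (a * (1 - d)) := by nlinarith
      have h2 : a * (1 - d) ≤ δ * δ := by
        have : d ≤ 1 := hexp δ hδ
        exact mul_le_mul (by linarith) (by linarith) (by linarith) hδ
      have h3 : e * (a * (1 - d)) ≤ e * (δ * δ) := by gcongr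
      nlinarith [sq_nonneg δ]
  have hzero : G₁ 0 = 0 ∧ G₂ 0 = 0 := by
    constructor
    · have h1 : P {ω | ∀ i, Y i ω ∉ {y | T y ≤ 0}} = 1 := by
        rw [hvoid _ (hmt 0) (hfin 0), Measure.real, h0]
        simp
      have h2 : P (R 0) = 0 := by
        have h3 : (R 0)ᶜ = {ω | ∀ i, Y i ω ∉ {y | T y ≤ 0}} := by
          ext ω
          simp [R]
        rw [← prob_compl_eq_one_iff (hR 0), h3, h1]
      simp only [G₁, Measure.real]
      rw [measure_mono_null Set.inter_subset_right h2, ENNReal.toReal_zero]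
    · simp only [G₂, G₂']
      rw [setLIntegral_measure_zero _ _ (measure_mono_null Set.inter_subset_right h0),
        ENNReal.toReal_zero]
  have heq : ∀ n : ℕ, P (E ∩ R n) = G₂' n := by
    intro n
    have h1 := eq_of_abs_sub_le_sq (F := fun t => G₁ t - G₂ t) hmono hcont hbound
      (Nat.cast_nonneg n : (0 : ℝ) ≤ n)
    beta_reduce at h1
    rw [hzero.1, hzero.2, sub_zero, sub_eq_zero] at h1
    exact (ENNReal.toReal_eq_toReal_iff' (measure_ne_top _ _) (hG₂fin n)).1 h1
  -- Point 0 always exists, so the events `R n` exhaust the sample space and the truncation can be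
  -- removed.
  have hE' : P E = ⨆ n : ℕ, P (E ∩ R n) := by
    rw [← Monotone.measure_iUnion]
    · congr 1
      rw [← Set.inter_iUnion]
      refine (Set.inter_eq_left.2 fun ω _ => ?_).symm
      obtain ⟨n, hn⟩ := exists_nat_ge (T (Y 0 ω))
      exact Set.mem_iUnion.2 ⟨n, 0, hn⟩
    · intro a b hab
      exact Set.inter_subset_inter_right _ (hRmono (Nat.cast_le.2 hab))
  have hA' : ∫⁻ y in A, w y ∂ν = ⨆ n : ℕ, G₂' n := by
    have h1 : ∀ n : ℕ, G₂' n = ∫⁻ y in A, {y | T y ≤ n}.indicator w y ∂ν := by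
      intro n
      rw [lintegral_indicator (hmt n), Measure.restrict_restrict (hmt n), Set.inter_comm]
    simp_rw [h1]
    rw [← lintegral_iSup (fun n => hw.indicator (hmt n))]
    · refine lintegral_congr fun y => ?_
      obtain ⟨n, hn⟩ := exists_nat_ge (T y)
      refine le_antisymm ?_ (iSup_le fun n => Set.indicator_le_self _ _ _)
      refine le_iSup_of_le n ?_
      rw [Set.indicator_of_mem (by exact hn)]
    · intro a b hab y
      refine Set.indicator_le_indicator_of_subset ?_ (fun _ => zero_le) y
      intro y (hy : T y ≤ a)
      exact hy.trans (Nat.cast_le.2 hab)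
  rw [hE', hA']
  exact iSup_congr heq

end Minimizer

/-! ### Gamma distributions -/

lemma integrableOn_upperGamma {a x : ℝ} (ha : 0 < a) (hx : 0 ≤ x) :
    IntegrableOn (fun t : ℝ => t ^ (a - 1) * Real.exp (-t)) (Set.Ioi x) := by
  have := (Real.GammaIntegral_convergent ha).mono_set (Set.Ioi_subset_Ioi hx)
  simpa only [mul_comm] using this

lemma gammaMeasure_Ici {a x : ℝ} (ha : 0 < a) (hx : 0 ≤ x) :
    gammaMeasure a 1 (Set.Ici x) = ENNReal.ofReal (upperGamma a x / Real.Gamma a) := by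
  rw [gammaMeasure, withDensity_apply _ measurableSet_Ici, ← setLIntegral_congr Ioi_ae_eq_Ici,
    upperGamma, ← integral_div, ofReal_integral_eq_lintegral_ofReal]
  · refine setLIntegral_congr_fun measurableSet_Ioi fun y hy => ?_
    rw [gammaPDF_of_nonneg (hx.trans (le_of_lt hy))]
    simp only [Real.one_rpow, one_mul]
    congr 1
    ring
  · exact (integrableOn_upperGamma ha hx).div_const _
  · filter_upwards [self_mem_ae_restrict measurableSet_Ioi] with y hy
    have : 0 < y := lt_of_le_of_lt hx hy
    have := Real.Gamma_pos_of_pos ha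
    positivity

lemma gammaMeasure_Ioi (a x : ℝ) :
    gammaMeasure a 1 (Set.Ioi x) = gammaMeasure a 1 (Set.Ici x) := by
  rw [gammaMeasure, withDensity_apply _ measurableSet_Ici, withDensity_apply _ measurableSet_Ioi,
    setLIntegral_congr Ioi_ae_eq_Ici]

lemma hasDerivAt_exp_mul_sum (n : ℕ) (y : ℝ) :
    HasDerivAt (fun y : ℝ => -(Real.exp (-y) * ∑ m ∈ Finset.range (n + 1), y ^ m / m.factorial))
      (Real.exp (-y) * y ^ n / n.factorial) y := by
  have he : HasDerivAt (fun y : ℝ => Real.exp (-y)) (-Real.exp (-y)) y := by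
    simpa using (hasDerivAt_neg y).exp
  induction n with
  | zero =>
    refine (he.neg.congr_deriv (by simp)).congr_of_eventuallyEq (.of_forall fun z => ?_)
    simp
  | succ n ih =>
    have h1 : HasDerivAt (fun y : ℝ => y ^ (n + 1) / ((n + 1).factorial : ℝ))
        (y ^ n / n.factorial) y := by
      have h2 := (hasDerivAt_pow (n + 1) y).div_const ((n + 1).factorial : ℝ)
      refine h2.congr_deriv ?_
      rw [Nat.factorial_succ]
      push_cast
      field_simp
    have h3 := ih.sub (he.mul h1)
    refine (h3.congr_deriv (by ring)).congr_of_eventuallyEq (.of_forall fun z => ?_)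
    simp only [Pi.sub_apply, Pi.mul_apply]
    rw [Finset.sum_range_succ _ (n + 1)]
    ring

/-- For integer shape the density has the explicit antiderivative of `hasDerivAt_exp_mul_sum`, whose
derivative telescopes; it vanishes at infinity. -/
lemma upperGamma_natCast {n : ℕ} (hn : 0 < n) {x : ℝ} (hx : 0 ≤ x) :
    upperGamma n x / Real.Gamma n
      = Real.exp (-x) * ∑ m ∈ Finset.range n, x ^ m / m.factorial := by
  obtain ⟨n, rfl⟩ := Nat.exists_eq_add_of_lt hn
  rw [zero_add]
  have hn' : (0 : ℝ) < (n + 1 : ℕ) := by positivity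
  have hint := integrableOn_upperGamma hn' hx
  have hΓ : Real.Gamma ((n + 1 : ℕ) : ℝ) = n.factorial := by
    rw [Nat.cast_succ, Real.Gamma_nat_eq_factorial]
  have heq : ∀ t : ℝ, t ^ (((n + 1 : ℕ) : ℝ) - 1) * Real.exp (-t) / n.factorial
      = Real.exp (-t) * t ^ n / n.factorial := by
    intro t
    rw [Nat.cast_succ, add_sub_cancel_right, Real.rpow_natCast, mul_comm]
  have hlim : Tendsto (fun y : ℝ => -(Real.exp (-y) * ∑ m ∈ Finset.range (n + 1),
      y ^ m / m.factorial)) atTop (𝓝 0) := by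
    rw [← neg_zero]
    refine Tendsto.neg ?_
    simp_rw [Finset.mul_sum]
    rw [← Finset.sum_const_zero (s := Finset.range (n + 1))]
    refine tendsto_finsetSum _ fun m _ => ?_
    have := (Real.tendsto_pow_mul_exp_neg_atTop_nhds_zero m).div_const (m.factorial : ℝ)
    rw [zero_div] at this
    refine this.congr fun y => ?_
    ring
  have h := integral_Ioi_of_hasDerivAt_of_tendsto' (a := x)
    (fun y _ => hasDerivAt_exp_mul_sum n y) (by
      have := hint.div_const (n.factorial : ℝ)
      simp_rw [heq] at this
      exact this) hlim
  rw [upperGamma, hΓ, ← integral_div]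
  simp_rw [heq]
  rw [h]
  ring

/-! ### Independent families of marks -/

/-- Injectivity of `e` on pairs says that the groups of variables are disjoint and without
repetition. Currying the infinite product law then shows that the groups are independent. -/
lemma iIndepFun_tuple {Ω ι S : Type*} [MeasurableSpace Ω] [MeasurableSpace S] {P : Measure Ω}
    {f : ι → Ω → ℝ} (hf : ∀ a, Measurable (f a)) (h : iIndepFun f P) {m : ℕ} {e : ℕ → Fin m → ι}
    (he : Function.Injective fun q : ℕ × Fin m => e q.1 q.2) {g : (Fin m → ℝ) → S}
    (hg : Measurable g) : iIndepFun (fun i ω => g fun j => f (e i j) ω) P := by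
  have := h.isProbabilityMeasure
  have hp : ∀ a, IsProbabilityMeasure (P.map (f a)) := fun a =>
    Measure.isProbabilityMeasure_map (hf a).aemeasurable
  have h1 : iIndepFun (fun i ω (j : Fin m) => f (e i j) ω) P := by
    rw [iIndepFun_iff_map_fun_eq_infinitePi_map (by fun_prop)]
    have hrow : ∀ i, P.map (fun ω (j : Fin m) => f (e i j) ω)
        = Measure.infinitePi fun j => P.map (f (e i j)) := fun i =>
      (h.precomp (g := e i) fun a b hab => by
        have := @he (i, a) (i, b) hab
        simpa using this).map_fun_eq_infinitePi_map fun j => hf _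
    have hall := (h.precomp he).map_fun_eq_infinitePi_map fun q => hf _
    simp_rw [hrow]
    rw [← Measure.infinitePi_map_curry (fun i j => P.map (f (e i j))), ← hall,
      Measure.map_map (by fun_prop) (by fun_prop)]
    rfl
  exact h1.comp (fun _ => g) fun _ => hg

lemma indepFun_families {Ω ι κ₁ κ₂ : Type*} [MeasurableSpace Ω] {P : Measure Ω}
    {f : ι → Ω → ℝ} (hf : ∀ a, Measurable (f a)) (h : iIndepFun f P) (e₁ : κ₁ → ι) (e₂ : κ₂ → ι)
    (hne : ∀ a b, e₁ a ≠ e₂ b) :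
    IndepFun (fun ω a => f (e₁ a) ω) (fun ω b => f (e₂ b) ω) P := by
  have h1 := indep_iSup_of_disjoint (fun a => (hf a).comap_le) h.iIndep
    (S := Set.range e₁) (T := Set.range e₂) (by
      rw [Set.disjoint_left]
      rintro _ ⟨a, rfl⟩ ⟨b, hb⟩
      exact hne a b hb.symm)
  refine indep_of_indep_of_le_left (indep_of_indep_of_le_right h1 ?_) ?_
  · rw [← measurable_iff_comap_le]
    refine @measurable_pi_lambda _ _ _ (_) _ _ fun b => ?_
    refine Measurable.mono (comap_measurable (f (e₂ b))) ?_ le_rfl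
    exact le_iSup₂_of_le (e₂ b) ⟨b, rfl⟩ le_rfl
  · rw [← measurable_iff_comap_le]
    refine @measurable_pi_lambda _ _ _ (_) _ _ fun b => ?_
    refine Measurable.mono (comap_measurable (f (e₁ b))) ?_ le_rfl
    exact le_iSup₂_of_le (e₁ b) ⟨b, rfl⟩ le_rfl

/-! ### Averages over a blockage variable -/

lemma lintegral_uniform_ite {q : ℝ} (h0 : 0 ≤ q) (h1 : q ≤ 1) (a b : ℝ≥0∞) :
    ∫⁻ u in Set.Icc (0 : ℝ) 1, (if u < q then a else b)
      = ENNReal.ofReal q * a + ENNReal.ofReal (1 - q) * b := by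
  have : (fun u : ℝ => if u < q then a else b)
      = fun u => (Set.Iio q).indicator (fun _ => a) u + (Set.Ici q).indicator (fun _ => b) u := by
    ext u
    by_cases hu : u < q
    · simp [hu, not_le.2 hu]
    · simp [hu, not_lt.1 hu]
  rw [this, lintegral_add_left (measurable_const.indicator measurableSet_Iio),
    lintegral_indicator measurableSet_Iio, lintegral_indicator measurableSet_Ici,
    setLIntegral_const, setLIntegral_const, Measure.restrict_apply measurableSet_Iio,
    Measure.restrict_apply measurableSet_Ici]
  have e1 : Set.Iio q ∩ Set.Icc (0 : ℝ) 1 = Set.Ico 0 q := by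
    ext u
    simp only [Set.mem_inter_iff, Set.mem_Iio, Set.mem_Icc, Set.mem_Ico]
    constructor
    · rintro ⟨h, h', _⟩; exact ⟨h', h⟩
    · rintro ⟨h, h'⟩; exact ⟨h', h, by linarith⟩
  have e2 : Set.Ici q ∩ Set.Icc (0 : ℝ) 1 = Set.Icc q 1 := by
    ext u
    simp only [Set.mem_inter_iff, Set.mem_Ici, Set.mem_Icc]
    constructor
    · rintro ⟨h, _, h'⟩; exact ⟨h, h'⟩
    · rintro ⟨h, h'⟩; exact ⟨h, by linarith, h'⟩
  rw [e1, e2, Real.volume_Ico, Real.volume_Icc, sub_zero, mul_comm a, mul_comm b]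

/-! ### Polar coordinates -/

lemma integral_plane_norm (f : ℝ → ℝ) :
    ∫ x : Plane, f ‖x‖ = 2 * Real.pi * ∫ r in Set.Ioi (0 : ℝ), r * f r := by
  rw [integral_fun_norm_addHaar]
  have : (volume : Measure Plane).real (Metric.ball 0 1) = Real.pi := by
    rw [Measure.real, EuclideanSpace.volume_ball_fin_two]
    simp [Real.pi_pos.le]
  rw [this]
  simp [finrank_euclideanSpace, smul_eq_mul, mul_assoc]

lemma integrable_plane_norm {f : ℝ → ℝ} :
    Integrable (fun x : Plane => f ‖x‖) ↔ IntegrableOn (fun r => r * f r) (Set.Ioi 0) := by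
  rw [integrable_fun_norm_addHaar]
  simp [finrank_euclideanSpace]

/-- The tail `P(X ≥ x)` of a gamma variable with integer shape `n` and scale `1`. -/
def gammaTail (n : ℕ) (x : ℝ) : ℝ := Real.exp (-x) * ∑ m ∈ Finset.range n, x ^ m / m.factorial

lemma measurable_gammaTail (n : ℕ) : Measurable (gammaTail n) := by
  unfold gammaTail
  fun_prop

lemma gammaTail_nonneg (n : ℕ) {x : ℝ} (hx : 0 ≤ x) : 0 ≤ gammaTail n x := by
  unfold gammaTail
  positivity

lemma gammaMeasure_Ici_natCast {n : ℕ} (hn : 0 < n) {x : ℝ} (hx : 0 ≤ x) :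
    gammaMeasure n 1 (Set.Ici x) = ENNReal.ofReal (gammaTail n x) := by
  rw [gammaMeasure_Ici (by exact_mod_cast hn) hx, upperGamma_natCast hn hx, gammaTail]

/-! ### Effective lengths of links and the intensity of the marked BSs -/

namespace Params

variable (p : Params)

instance isProbabilityMeasure_gammaL : IsProbabilityMeasure (gammaMeasure (p.NL : ℝ) 1) :=
  isProbabilityMeasure_gammaMeasure (by exact_mod_cast p.NL_pos) one_pos

instance isProbabilityMeasure_gammaN : IsProbabilityMeasure (gammaMeasure (p.NN : ℝ) 1) :=
  isProbabilityMeasure_gammaMeasure (by exact_mod_cast p.NN_pos) one_pos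

instance isProbabilityMeasure_block :
    IsProbabilityMeasure (volume.restrict (Set.Icc (0 : ℝ) 1)) := ⟨by simp⟩

lemma measurable_qLOS : Measurable p.qLOS :=
  Measurable.ite measurableSet_Iic measurable_const measurable_const

lemma qLOS_nonneg (r : ℝ) : 0 ≤ p.qLOS r := by
  unfold qLOS
  split_ifs
  exacts [p.C_nonneg, le_rfl]

lemma qLOS_le_one (r : ℝ) : p.qLOS r ≤ 1 := by
  unfold qLOS
  split_ifs
  exacts [p.C_le_one, zero_le_one]

/-- The length of the NLOS link with the same path loss as a LOS link of length `r`. -/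
def nlosLength (r : ℝ) : ℝ := (p.CN / p.CL) ^ (1 / p.aN) * r ^ (p.aL / p.aN)

/-- The length of the LOS link with the same path loss as a NLOS link of length `t`. -/
def losLength (t : ℝ) : ℝ := (p.CL / p.CN) ^ (1 / p.aL) * t ^ (p.aN / p.aL)

lemma nlosLength_nonneg {r : ℝ} (hr : 0 ≤ r) : 0 ≤ p.nlosLength r := by
  have := p.CN_pos
  have := p.CL_pos
  unfold nlosLength
  positivity

lemma losLength_nonneg {r : ℝ} (hr : 0 ≤ r) : 0 ≤ p.losLength r := by
  have := p.CN_pos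
  have := p.CL_pos
  unfold losLength
  positivity

lemma nlosLength_pos {r : ℝ} (hr : 0 < r) : 0 < p.nlosLength r := by
  have := p.CN_pos
  have := p.CL_pos
  unfold nlosLength
  positivity

lemma losLength_nlosLength {r : ℝ} (hr : 0 ≤ r) : p.losLength (p.nlosLength r) = r := by
  have h1 := p.CN_pos
  have h2 := p.CL_pos
  have h3 := p.aL_pos
  have h4 := p.aN_pos
  unfold losLength nlosLength
  rw [Real.mul_rpow (by positivity) (by positivity), ← Real.rpow_mul (by positivity),
    ← Real.rpow_mul hr, show p.aL / p.aN * (p.aN / p.aL) = 1 by field_simp,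
    show 1 / p.aN * (p.aN / p.aL) = 1 / p.aL by field_simp, Real.rpow_one, ← mul_assoc,
    ← Real.mul_rpow (by positivity) (by positivity),
    show p.CL / p.CN * (p.CN / p.CL) = 1 by field_simp, Real.one_rpow, one_mul]

lemma losLength_mono {s t : ℝ} (hs : 0 ≤ s) (hst : s ≤ t) : p.losLength s ≤ p.losLength t := by
  have h1 := p.CN_pos
  have h2 := p.CL_pos
  have h3 := p.aL_pos
  have h4 := p.aN_pos
  unfold losLength
  gcongr

/-- `losLength` is strictly increasing and inverts `nlosLength`. -/
lemma nlosLength_le_iff {r t : ℝ} (hr : 0 ≤ r) (ht : 0 ≤ t) :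
    p.nlosLength r ≤ t ↔ r ≤ p.losLength t := by
  constructor
  · intro h
    rw [← p.losLength_nlosLength hr]
    exact p.losLength_mono (p.nlosLength_nonneg hr) h
  · intro h
    by_contra hcon
    push Not at hcon
    have h1 := p.CN_pos
    have h2 := p.CL_pos
    have h3 := p.aL_pos
    have h4 := p.aN_pos
    have : p.losLength t < p.losLength (p.nlosLength r) := by
      unfold losLength
      gcongr
    rw [p.losLength_nlosLength hr] at this
    linarith

lemma measurable_nlosLength : Measurable p.nlosLength := by
  unfold nlosLength
  fun_prop

lemma continuous_losLength : Continuous p.losLength :=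
  continuous_const.mul (Real.continuous_rpow_const (div_pos p.aN_pos p.aL_pos).le)

/-- The mean number of BSs whose link to the origin is at least as strong as a NLOS link of
length `t`. -/
def strongerMean (t : ℝ) : ℝ :=
  p.lamB * (Real.pi * (p.C * (min p.D (p.losLength t)) ^ 2 + t ^ 2 - p.C * (min p.D t) ^ 2))

lemma continuous_strongerMean : Continuous p.strongerMean := by
  have := p.continuous_losLength
  unfold strongerMean
  fun_prop

/-- The law of the marks of a link to the typical user. -/
def userMarkLaw : Measure (ℝ × ℝ × ℝ) :=
  (volume.restrict (Set.Icc (0 : ℝ) 1)).prod ((gammaMeasure p.NL 1).prod (gammaMeasure p.NN 1))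

instance : IsProbabilityMeasure p.userMarkLaw := by
  unfold userMarkLaw
  infer_instance

/-- The blockage variable selects one of the two gains; the other integrates out to mass 1. -/
lemma lintegral_userMarkLaw {q : ℝ} (h0 : 0 ≤ q) (h1 : q ≤ 1) {f g : ℝ → ℝ≥0∞}
    (hf : Measurable f) (hg : Measurable g) :
    ∫⁻ z, (if z.1 < q then f z.2.1 else g z.2.2) ∂p.userMarkLaw
      = ENNReal.ofReal q * ∫⁻ x, f x ∂(gammaMeasure p.NL 1)
        + ENNReal.ofReal (1 - q) * ∫⁻ x, g x ∂(gammaMeasure p.NN 1) := by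
  have hm : Measurable fun z : ℝ × ℝ × ℝ => if z.1 < q then f z.2.1 else g z.2.2 :=
    Measurable.ite (measurableSet_lt measurable_fst measurable_const) (by fun_prop) (by fun_prop)
  rw [userMarkLaw, lintegral_prod _ hm.aemeasurable, ← lintegral_uniform_ite h0 h1]
  refine lintegral_congr fun u => ?_
  by_cases hu : u < q
  · simp only [hu, if_true]
    rw [lintegral_prod _ (by fun_prop)]
    simp
  · simp only [hu, if_false]
    rw [lintegral_prod _ (by fun_prop)]
    simp

/-- The length of the NLOS link with the same path loss as a given link. -/
def effLength (y : Plane × (ℝ × ℝ × ℝ)) : ℝ :=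
  if y.2.1 < p.qLOS ‖y.1‖ then p.nlosLength ‖y.1‖ else ‖y.1‖

lemma measurableSet_los : MeasurableSet {y : Plane × (ℝ × ℝ × ℝ) | y.2.1 < p.qLOS ‖y.1‖} :=
  measurableSet_lt (by fun_prop) (p.measurable_qLOS.comp (by fun_prop))

lemma measurable_effLength : Measurable p.effLength :=
  Measurable.ite p.measurableSet_los (p.measurable_nlosLength.comp (by fun_prop)) (by fun_prop)

lemma effLength_nonneg (y : Plane × (ℝ × ℝ × ℝ)) : 0 ≤ p.effLength y := by
  unfold effLength
  split_ifs
  exacts [p.nlosLength_nonneg (norm_nonneg _), norm_nonneg _]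

lemma effLength_pos {y : Plane × (ℝ × ℝ × ℝ)} (hy : 0 < ‖y.1‖) : 0 < p.effLength y := by
  unfold effLength
  split_ifs
  exacts [p.nlosLength_pos hy, hy]

lemma norm_le_of_effLength_le {y : Plane × (ℝ × ℝ × ℝ)} {t : ℝ} (ht : p.effLength y ≤ t) :
    ‖y.1‖ ≤ max t (p.losLength t) := by
  have h0 := (p.effLength_nonneg y).trans ht
  unfold effLength at ht
  split_ifs at ht
  · exact le_max_of_le_right ((p.nlosLength_le_iff (norm_nonneg _) h0).1 ht)
  · exact le_max_of_le_left ht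

/-- Path loss is one decreasing function of the effective length for LOS and NLOS links alike, so
maximizing the former is minimizing the latter. -/
lemma pathLoss_eq {y : Plane × (ℝ × ℝ × ℝ)} (hy : 0 < ‖y.1‖) :
    p.pathLoss (y.2.1 < p.qLOS ‖y.1‖) ‖y.1‖ = p.CN * p.effLength y ^ (-p.aN) := by
  have h1 := p.CN_pos
  have h2 := p.CL_pos
  have h3 := p.aL_pos
  have h4 := p.aN_pos
  unfold pathLoss effLength
  by_cases h : y.2.1 < p.qLOS ‖y.1‖
  · rw [if_pos h, if_pos h, nlosLength, Real.mul_rpow (by positivity) (by positivity),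
      ← Real.rpow_mul (by positivity), ← Real.rpow_mul hy.le,
      show 1 / p.aN * -p.aN = -1 by field_simp, show p.aL / p.aN * -p.aN = -p.aL by field_simp,
      Real.rpow_neg_one, ← mul_assoc]
    congr 1
    field_simp
  · rw [if_neg h, if_neg h]

/-- Three discs contribute: LOS links up to min(D, `losLength t`) with weight C, NLOS links up to
min(D, t) with weight 1 - C, and the annulus between min(D, t) and t, where a link within reach is
surely NLOS. -/
lemma lintegral_effLength_le {t : ℝ} (ht : 0 ≤ t) :
    ∫⁻ x, p.userMarkLaw (Prod.mk x ⁻¹' {y | p.effLength y ≤ t})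
      = ENNReal.ofReal
          (Real.pi * (p.C * (min p.D (p.losLength t)) ^ 2 + t ^ 2 - p.C * (min p.D t) ^ 2)) := by
  classical
  have hC0 := p.C_nonneg
  have hC1 := p.C_le_one
  have hD := p.D_pos
  have hlos := p.losLength_nonneg ht
  have hκ : ∀ x : Plane, p.userMarkLaw (Prod.mk x ⁻¹' {y | p.effLength y ≤ t})
      = ENNReal.ofReal p.C
          * (Metric.closedBall (0 : Plane) (min p.D (p.losLength t))).indicator 1 x
        + (ENNReal.ofReal (1 - p.C) * (Metric.closedBall (0 : Plane) (min p.D t)).indicator 1 x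
        + (Metric.closedBall (0 : Plane) t \ Metric.closedBall 0 (min p.D t)).indicator 1 x) := by
    intro x
    have hm : MeasurableSet (Prod.mk x ⁻¹' {y | p.effLength y ≤ t}) :=
      (measurableSet_le p.measurable_effLength measurable_const).preimage (by fun_prop)
    have h1 : p.userMarkLaw (Prod.mk x ⁻¹' {y | p.effLength y ≤ t})
        = ∫⁻ z, (if z.1 < p.qLOS ‖x‖ then (if p.nlosLength ‖x‖ ≤ t then 1 else 0)
            else (if ‖x‖ ≤ t then 1 else 0)) ∂p.userMarkLaw := by
      rw [← lintegral_indicator_one hm]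
      refine lintegral_congr fun z => ?_
      simp only [Set.indicator_apply, Set.mem_preimage, Set.mem_ofPred_eq, effLength, Pi.one_apply]
      by_cases h : z.1 < p.qLOS ‖x‖ <;> simp [h]
    rw [h1, p.lintegral_userMarkLaw (f := fun _ => if p.nlosLength ‖x‖ ≤ t then 1 else 0)
      (g := fun _ => if ‖x‖ ≤ t then 1 else 0) (p.qLOS_nonneg _) (p.qLOS_le_one _)
      measurable_const measurable_const]
    simp only [lintegral_const, measure_univ, mul_one, Set.indicator_apply, Set.mem_sdiff,
      mem_closedBall_zero_iff, le_min_iff, Pi.one_apply, p.nlosLength_le_iff (norm_nonneg x) ht,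
      qLOS]
    by_cases h1 : ‖x‖ ≤ p.D <;> by_cases h2 : ‖x‖ ≤ t <;> simp [h1, h2]
  have hball : ∀ s : ℝ, 0 ≤ s → volume (Metric.closedBall (0 : Plane) s)
      = ENNReal.ofReal (Real.pi * s ^ 2) := by
    intro s hs
    rw [EuclideanSpace.volume_closedBall_fin_two, ← ENNReal.ofReal_pow hs,
      ← ENNReal.ofReal_mul (by positivity), mul_comm]
  have hmin : 0 ≤ min p.D t := le_min hD.le ht
  have hmin' : min p.D t ≤ t := min_le_right _ _
  have hsq : (min p.D t) ^ 2 ≤ t ^ 2 := by gcongr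
  have hmb : ∀ s : ℝ, MeasurableSet (Metric.closedBall (0 : Plane) s) :=
    fun s => Metric.isClosed_closedBall.measurableSet
  simp_rw [hκ]
  rw [lintegral_add_left ((measurable_one.indicator (hmb _)).const_mul _),
    lintegral_add_left ((measurable_one.indicator (hmb _)).const_mul _),
    lintegral_const_mul _ (measurable_one.indicator (hmb _)),
    lintegral_const_mul _ (measurable_one.indicator (hmb _)),
    lintegral_indicator_one (hmb _), lintegral_indicator_one (hmb _),
    lintegral_indicator_one ((hmb _).diff (hmb _)),
    measure_sdiff (Metric.closedBall_subset_closedBall hmin') (hmb _).nullMeasurableSet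
      (by rw [hball _ hmin]; exact ENNReal.ofReal_ne_top),
    hball _ (le_min hD.le hlos), hball _ hmin, hball _ ht,
    ← ENNReal.ofReal_sub _ (by positivity), ← ENNReal.ofReal_mul hC0,
    ← ENNReal.ofReal_mul (by linarith), ← ENNReal.ofReal_add
      (mul_nonneg (by linarith) (by positivity)) (by
        have := mul_le_mul_of_nonneg_left hsq Real.pi_pos.le
        linarith),
    ← ENNReal.ofReal_add (by positivity) (by
        have := mul_le_mul_of_nonneg_left hsq Real.pi_pos.le
        have h2 : 0 ≤ (1 - p.C) * (Real.pi * (min p.D t) ^ 2) :=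
          mul_nonneg (by linarith) (by positivity)
        linarith)]
  congr 1
  ring

/-- The intensity measure of the marked process of BSs. -/
def userIntensity : Measure (Plane × (ℝ × ℝ × ℝ)) :=
  (ENNReal.ofReal p.lamB • (volume : Measure Plane)).prod p.userMarkLaw

lemma userIntensity_apply {B : Set (Plane × (ℝ × ℝ × ℝ))} (hB : MeasurableSet B) :
    p.userIntensity B = ENNReal.ofReal p.lamB * ∫⁻ x, p.userMarkLaw (Prod.mk x ⁻¹' B) := by
  rw [userIntensity, Measure.prod_apply hB, lintegral_smul_measure, smul_eq_mul]

lemma strongerMean_nonneg {t : ℝ} (ht : 0 ≤ t) : 0 ≤ p.strongerMean t := by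
  have hC0 := p.C_nonneg
  have hC1 := p.C_le_one
  have hl := p.lamB_pos
  have hD := p.D_pos
  have h1 : (min p.D t) ^ 2 ≤ t ^ 2 := by
    have := le_min hD.le ht
    gcongr
    exact min_le_right _ _
  have h2 : p.C * (min p.D t) ^ 2 ≤ 1 * t ^ 2 := by gcongr
  have h3 : 0 ≤ p.C * (min p.D (p.losLength t)) ^ 2 := by positivity
  unfold strongerMean
  have := Real.pi_pos
  refine mul_nonneg hl.le (mul_nonneg this.le ?_)
  linarith

lemma userIntensity_effLength_le {t : ℝ} (ht : 0 ≤ t) :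
    p.userIntensity {y | p.effLength y ≤ t} = ENNReal.ofReal (p.strongerMean t) := by
  rw [p.userIntensity_apply (measurableSet_le p.measurable_effLength measurable_const),
    p.lintegral_effLength_le ht, ← ENNReal.ofReal_mul p.lamB_pos.le, strongerMean]

/-- Truncating at 0 gives one formula for all real t, from which continuity of the intensity in t
can be read off. -/
lemma userIntensity_effLength_le_max (t : ℝ) :
    p.userIntensity {y | p.effLength y ≤ t} = ENNReal.ofReal (p.strongerMean (max t 0)) := by
  rcases le_or_gt 0 t with ht | ht
  · rw [max_eq_left ht, p.userIntensity_effLength_le ht]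
  · have h1 : {y | p.effLength y ≤ t} = ∅ := by
      ext y
      have := p.effLength_nonneg y
      simp only [Set.mem_ofPred_eq, Set.mem_empty_iff_false, iff_false, not_le]
      linarith
    have h2 : p.strongerMean 0 = 0 := by
      have h3 : p.losLength 0 = 0 := by
        unfold losLength
        rw [Real.zero_rpow (div_pos p.aN_pos p.aL_pos).ne', mul_zero]
      unfold strongerMean
      rw [h3, min_eq_right p.D_pos.le]
      ring
    rw [max_eq_right ht.le, h1, h2, measure_empty, ENNReal.ofReal_zero]

lemma userIntensity_real_effLength_le (t : ℝ) :
    p.userIntensity.real {y | p.effLength y ≤ t} = p.strongerMean (max t 0) := by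
  rw [Measure.real, userIntensity_effLength_le_max,
    ENNReal.toReal_ofReal (p.strongerMean_nonneg (le_max_right _ _))]

end Params

/-! ### Null sets and local finiteness of a Poisson process -/

namespace IsHomogeneousPPP

variable {Ω : Type*} [MeasurableSpace Ω] {P : Measure Ω} [IsProbabilityMeasure P] {lam : ℝ}
  {X : ℕ → Ω → Plane}

lemma ae_forall_notMem (h : IsHomogeneousPPP P lam X) {B : Set Plane} (hB : MeasurableSet B)
    (h0 : volume B = 0) : ∀ᵐ ω ∂P, ∀ i, X i ω ∉ B := by
  have h1 := h.count_single hB (by simp [h0]) 0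
  have h2 : volume.real B = 0 := by simp [Measure.real, h0]
  rw [h2] at h1
  simp only [mul_zero, neg_zero, Real.exp_zero, pow_zero, Nat.factorial_zero, Nat.cast_one, mul_one,
    div_one, Nat.cast_zero] at h1
  have hm : MeasurableSet {ω | pointCount (fun i => X i ω) B = 0} :=
    measurable_pointCount h.measurable hB (measurableSet_singleton _)
  have h3 := (prob_compl_eq_zero_iff hm).2 (by
    rw [← ofReal_measureReal (μ := P), h1, ENNReal.ofReal_one])
  have h4 : ∀ᵐ ω ∂P, pointCount (fun i => X i ω) B = 0 := h3
  filter_upwards [h4] with ω hω i hi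
  have : {i | X i ω ∈ B} = ∅ := Set.encard_eq_zero.1 hω
  exact Set.eq_empty_iff_forall_notMem.1 this i hi

lemma ae_finite_norm_le (h : IsHomogeneousPPP P lam X) (hl : 0 ≤ lam) :
    ∀ᵐ ω ∂P, ∀ R : ℝ, {i | ‖X i ω‖ ≤ R}.Finite := by
  have h1 : ∀ n : ℕ, ∀ᵐ ω ∂P, pointCount (fun i => X i ω) (Metric.closedBall 0 n) ≠ ⊤ := fun n =>
    h.ae_pointCount_ne_top hl Metric.isClosed_closedBall.measurableSet
      measure_closedBall_lt_top.ne
  filter_upwards [ae_all_iff.2 h1] with ω hω R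
  obtain ⟨n, hn⟩ := exists_nat_ge R
  refine (Set.encard_ne_top_iff.1 (hω n)).subset fun i hi => ?_
  exact mem_closedBall_zero_iff.2 (le_trans hi hn)

end IsHomogeneousPPP

/-! ### Marked BSs with successful reception -/

namespace Params

variable (p : Params)

/-- The marked BSs for which the received SNR of the typical user is at least `Tc`. -/
def acceptSet (Tc : ℝ) : Set (Plane × (ℝ × ℝ × ℝ)) :=
  {y | Tc ≤ p.Pt * p.Ms * p.pathLoss (y.2.1 < p.qLOS ‖y.1‖) ‖y.1‖
    * (if y.2.1 < p.qLOS ‖y.1‖ then y.2.2.1 else y.2.2.2) / p.N0}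

lemma measurable_pathLoss {α : Type*} [MeasurableSpace α] {los : α → Prop}
    (hlos : MeasurableSet {a | los a}) {r : α → ℝ} (hr : Measurable r) :
    Measurable fun a => p.pathLoss (los a) (r a) := by
  classical
  unfold pathLoss
  refine Measurable.ite hlos ?_ ?_ <;> fun_prop

lemma measurableSet_acceptSet (Tc : ℝ) : MeasurableSet (p.acceptSet Tc) := by
  refine measurableSet_le measurable_const ?_
  have h1 : Measurable fun y : Plane × (ℝ × ℝ × ℝ) =>
      p.pathLoss (y.2.1 < p.qLOS ‖y.1‖) ‖y.1‖ :=
    p.measurable_pathLoss p.measurableSet_los (by fun_prop)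
  have h2 : Measurable fun y : Plane × (ℝ × ℝ × ℝ) =>
      if y.2.1 < p.qLOS ‖y.1‖ then y.2.2.1 else y.2.2.2 :=
    Measurable.ite p.measurableSet_los (by fun_prop) (by fun_prop)
  exact ((h1.const_mul _).mul h2).div_const _

/-- The channel gain that makes the SNR of the typical user equal to `Tc`. -/
def userThreshold (Tc c a r : ℝ) : ℝ := p.N0 * Tc * r ^ a / (p.Pt * p.Ms * c)

lemma userThreshold_nonneg {Tc c a r : ℝ} (hTc : 0 < Tc) (hc : 0 < c) (hr : 0 ≤ r) :
    0 ≤ p.userThreshold Tc c a r := by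
  have := p.N0_pos
  have := p.Pt_pos
  have := p.Ms_pos
  unfold userThreshold
  positivity

lemma le_snr_iff {Tc c a r g : ℝ} (hc : 0 < c) (hr : 0 < r) :
    Tc ≤ p.Pt * p.Ms * (c * r ^ (-a)) * g / p.N0 ↔ p.userThreshold Tc c a r ≤ g := by
  have h1 := p.N0_pos
  have h2 := p.Pt_pos
  have h3 := p.Ms_pos
  have h4 : 0 < r ^ a := Real.rpow_pos_of_pos hr a
  unfold userThreshold
  rw [le_div_iff₀ h1, div_le_iff₀ (by positivity), Real.rpow_neg hr.le,
    show p.Pt * p.Ms * (c * (r ^ a)⁻¹) * g = (g * (p.Pt * p.Ms * c)) / r ^ a by field_simp,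
    le_div_iff₀ h4]
  rw [mul_comm Tc]

/-- The intensity at distance `r` of a LOS serving BS with successful reception. -/
def acceptLOS (Tc r : ℝ) : ℝ :=
  p.qLOS r * gammaTail p.NL (p.userThreshold Tc p.CL p.aL r)
    * Real.exp (-p.strongerMean (p.nlosLength r))

/-- The intensity at distance `r` of a NLOS serving BS with successful reception. -/
def acceptNLOS (Tc r : ℝ) : ℝ :=
  (1 - p.qLOS r) * gammaTail p.NN (p.userThreshold Tc p.CN p.aN r) * Real.exp (-p.strongerMean r)

lemma measurable_userThreshold (Tc c a : ℝ) : Measurable (p.userThreshold Tc c a) := by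
  unfold userThreshold
  fun_prop

lemma measurable_acceptLOS (Tc : ℝ) : Measurable (p.acceptLOS Tc) :=
  (p.measurable_qLOS.mul ((measurable_gammaTail p.NL).comp (p.measurable_userThreshold _ _ _))).mul
    (Real.measurable_exp.comp
      (p.continuous_strongerMean.measurable.comp p.measurable_nlosLength).neg)

lemma measurable_acceptNLOS (Tc : ℝ) : Measurable (p.acceptNLOS Tc) :=
  ((measurable_const.sub p.measurable_qLOS).mul
    ((measurable_gammaTail p.NN).comp (p.measurable_userThreshold _ _ _))).mul
    (Real.measurable_exp.comp p.continuous_strongerMean.measurable.neg)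

lemma acceptLOS_nonneg {Tc r : ℝ} (hTc : 0 < Tc) (hr : 0 ≤ r) : 0 ≤ p.acceptLOS Tc r := by
  have h1 := p.qLOS_nonneg r
  have h3 := gammaTail_nonneg p.NL (p.userThreshold_nonneg (a := p.aL) hTc p.CL_pos hr)
  unfold acceptLOS
  positivity

lemma acceptNLOS_nonneg {Tc r : ℝ} (hTc : 0 < Tc) (hr : 0 ≤ r) : 0 ≤ p.acceptNLOS Tc r := by
  have h4 := gammaTail_nonneg p.NN (p.userThreshold_nonneg (a := p.aN) hTc p.CN_pos hr)
  have h5 : 0 ≤ 1 - p.qLOS r := sub_nonneg.2 (p.qLOS_le_one r)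
  unfold acceptNLOS
  positivity

/-- At a fixed position the weight depends on the marks only through the link state, so integrating
out the gains leaves one gamma tail per state. -/
lemma lintegral_acceptSet {Tc : ℝ} (hTc : 0 < Tc) :
    ∫⁻ y in p.acceptSet Tc, ENNReal.ofReal
        (Real.exp (-p.userIntensity.real {y' | p.effLength y' ≤ p.effLength y})) ∂p.userIntensity
      = ENNReal.ofReal p.lamB * ∫⁻ x : Plane, ENNReal.ofReal (p.acceptLOS Tc ‖x‖ + p.acceptNLOS Tc ‖x‖) := by
  have hT := p.measurable_effLength
  have hF : Measurable fun y => ENNReal.ofReal (Real.exp (-p.strongerMean (p.effLength y))) :=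
    (Real.measurable_exp.comp (p.continuous_strongerMean.measurable.comp hT).neg).ennreal_ofReal
  simp_rw [p.userIntensity_real_effLength_le, max_eq_left (p.effLength_nonneg _)]
  rw [← lintegral_indicator (p.measurableSet_acceptSet Tc), userIntensity,
    lintegral_prod _ (hF.indicator (p.measurableSet_acceptSet Tc)).aemeasurable,
    lintegral_smul_measure, smul_eq_mul]
  congr 1
  refine lintegral_congr_ae ?_
  have hne : ∀ᵐ x : Plane, x ≠ 0 := by simp [ae_iff]
  filter_upwards [hne] with x hx
  have hr : 0 < ‖x‖ := norm_pos_iff.2 hx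
  let wL := ENNReal.ofReal (Real.exp (-p.strongerMean (p.nlosLength ‖x‖)))
  let wN := ENNReal.ofReal (Real.exp (-p.strongerMean ‖x‖))
  have h1 : ∀ z, (p.acceptSet Tc).indicator
      (fun y => ENNReal.ofReal (Real.exp (-p.strongerMean (p.effLength y)))) (x, z)
      = if z.1 < p.qLOS ‖x‖
        then (Set.Ici (p.userThreshold Tc p.CL p.aL ‖x‖)).indicator (fun _ => wL) z.2.1
        else (Set.Ici (p.userThreshold Tc p.CN p.aN ‖x‖)).indicator (fun _ => wN) z.2.2 := by
    classical
    intro z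
    simp only [Set.indicator_apply, acceptSet, Set.mem_ofPred_eq, Set.mem_Ici, pathLoss, effLength,
      wL, wN]
    by_cases h : z.1 < p.qLOS ‖x‖
    · simp only [h, if_true, p.le_snr_iff p.CL_pos hr]
    · simp only [h, if_false, p.le_snr_iff p.CN_pos hr]
  simp_rw [h1]
  have hq0 := p.qLOS_nonneg ‖x‖
  have hq1 := p.qLOS_le_one ‖x‖
  have hL := p.userThreshold_nonneg (a := p.aL) hTc p.CL_pos hr.le
  have hN := p.userThreshold_nonneg (a := p.aN) hTc p.CN_pos hr.le
  have hgL := gammaTail_nonneg p.NL hL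
  have hgN := gammaTail_nonneg p.NN hN
  have hq2 : 0 ≤ 1 - p.qLOS ‖x‖ := by linarith
  rw [p.lintegral_userMarkLaw hq0 hq1 (measurable_const.indicator measurableSet_Ici)
    (measurable_const.indicator measurableSet_Ici), lintegral_indicator_const measurableSet_Ici,
    lintegral_indicator_const measurableSet_Ici, gammaMeasure_Ici_natCast p.NL_pos hL,
    gammaMeasure_Ici_natCast p.NN_pos hN, acceptLOS, acceptNLOS,
    ENNReal.ofReal_add (by positivity) (by positivity), ENNReal.ofReal_mul (by positivity),
    ENNReal.ofReal_mul (by positivity), ENNReal.ofReal_mul (by positivity),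
    ENNReal.ofReal_mul (by positivity)]
  ring

end Params

/-! ### The connection probability as a radial integral -/

namespace Network

variable {p : Params} {Ω : Type*} [MeasurableSpace Ω] {P : Measure Ω} (M : Network p P)

/-- The marks of the link from BS `i` to the typical user. -/
def userMarks (i : ℕ) (ω : Ω) : ℝ × ℝ × ℝ :=
  (M.mark (.userBlock i) ω, M.mark (.userGainL i) ω, M.mark (.userGainN i) ω)

lemma measurable_userMarks (i : ℕ) : Measurable (M.userMarks i) :=
  (M.mark_measurable _).prodMk ((M.mark_measurable _).prodMk (M.mark_measurable _))

lemma iIndepFun_userMarks : iIndepFun M.userMarks P := by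
  have := iIndepFun_tuple M.mark_measurable M.mark_indep
    (e := fun i => ![Mark.userBlock i, Mark.userGainL i, Mark.userGainN i])
    (by
      rintro ⟨i, a⟩ ⟨j, b⟩ hab
      fin_cases a <;> fin_cases b <;> simp_all)
    (g := fun v : Fin 3 → ℝ => (v 0, v 1, v 2)) (by fun_prop)
  exact this

lemma indepFun_bs_userMarks : IndepFun (fun ω i => M.bs i ω) (fun ω i => M.userMarks i ω) P := by
  have := M.points_indep_mark.comp (φ := fun q : (ℕ → Plane) × (ℕ → Plane) => q.1)
    (ψ := fun a : Mark → ℝ => fun i : ℕ => (a (.userBlock i), a (.userGainL i), a (.userGainN i)))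
    (by fun_prop) (by fun_prop)
  exact this

variable [IsProbabilityMeasure P]

lemma map_userMarks (i : ℕ) : P.map (M.userMarks i) = p.userMarkLaw := by
  have h1 := (M.mark_indep.indepFun_prodMk M.mark_measurable (.userGainL i) (.userGainN i)
    (.userBlock i) (by simp) (by simp)).symm
  have h2 := M.mark_indep.indepFun (i := .userGainL i) (j := .userGainN i) (by simp)
  have hm := M.mark_measurable
  unfold userMarks
  rw [h1.map_prod_eq_prod_map_map (hm _).aemeasurable ((hm _).prodMk (hm _)).aemeasurable,
    h2.map_prod_eq_prod_map_map (hm _).aemeasurable (hm _).aemeasurable, M.mark_law, M.mark_law,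
    M.mark_law]
  rfl

lemma measure_user_void {B : Set (Plane × (ℝ × ℝ × ℝ))} (hB : MeasurableSet B)
    (hfin : p.userIntensity B ≠ ⊤) :
    P {ω | ∀ i, (M.bs i ω, M.userMarks i ω) ∉ B}
      = ENNReal.ofReal (Real.exp (-p.userIntensity.real B)) := by
  have hl := p.lamB_pos
  rw [p.userIntensity_apply hB] at hfin
  have hfin' : ∫⁻ x, p.userMarkLaw (Prod.mk x ⁻¹' B) ≠ ⊤ := by
    intro h
    rw [h, ENNReal.mul_top (by simpa using hl)] at hfin
    exact hfin rfl
  rw [M.bs_poisson.measure_forall_notMem hl.le M.measurable_userMarks M.map_userMarks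
    M.iIndepFun_userMarks M.indepFun_bs_userMarks hB hfin', Measure.real, p.userIntensity_apply hB,
    ENNReal.toReal_mul, ENNReal.toReal_ofReal hl.le]

lemma ae_bs_pos : ∀ᵐ ω ∂P, ∀ i, 0 < ‖M.bs i ω‖ := by
  filter_upwards [M.bs_poisson.ae_forall_notMem (measurableSet_singleton 0) (by simp)] with ω hω i
  exact norm_pos_iff.2 (hω i)

/-- Almost surely the serving BS exists. -/
lemma ae_serving : ∀ᵐ ω ∂P, ∀ j, M.userLoss j ω ≤ M.userLoss (M.serving ω) ω := by
  filter_upwards [M.ae_bs_pos, M.bs_poisson.ae_finite_norm_le p.lamB_pos.le] with ω hpos hfin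
  let T : ℕ → ℝ := fun i => p.effLength (M.bs i ω, M.userMarks i ω)
  have hloss : ∀ i, M.userLoss i ω = p.CN * T i ^ (-p.aN) := fun i =>
    p.pathLoss_eq (y := (M.bs i ω, M.userMarks i ω)) (hpos i)
  have hT : ∀ i, 0 < T i := fun i => p.effLength_pos (y := (M.bs i ω, M.userMarks i ω)) (hpos i)
  -- Only finitely many BSs compete with BS 0, by local finiteness, so the minimum is attained and
  -- the set in `serving` is nonempty.
  have hf : {j | T j ≤ T 0}.Finite :=
    (hfin (max (T 0) (p.losLength (T 0)))).subset fun j hj =>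
      p.norm_le_of_effLength_le (y := (M.bs j ω, M.userMarks j ω)) hj
  obtain ⟨i, hi, hmin⟩ := Set.exists_min_image _ T hf ⟨0, le_refl (T 0)⟩
  have hne : {i | ∀ j, M.userLoss j ω ≤ M.userLoss i ω}.Nonempty := by
    refine ⟨i, fun j => ?_⟩
    have hij : T i ≤ T j := by
      rcases le_or_gt (T j) (T 0) with h | h
      · exact hmin j h
      · exact hi.trans h.le
    rw [hloss, hloss]
    exact mul_le_mul_of_nonneg_left
      (Real.rpow_le_rpow_of_nonpos (hT i) hij (neg_nonpos.2 p.aN_pos.le)) p.CN_pos.le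
  have := Nat.sInf_mem hne
  exact this

/-- The connection probability as an integral over the length of the serving link. -/
theorem pCon_eq_integral {Tc : ℝ} (hTc : 0 < Tc) :
    M.pCon Tc = p.lamB * (2 * Real.pi *
      ((∫ r in Set.Ioi (0 : ℝ), r * p.acceptLOS Tc r)
        + ∫ r in Set.Ioi (0 : ℝ), r * p.acceptNLOS Tc r)) := by
  have hl := p.lamB_pos
  have hE : ∀ᵐ ω ∂P, ∃ i, (∀ j, p.effLength (M.bs i ω, M.userMarks i ω)
      ≤ p.effLength (M.bs j ω, M.userMarks j ω)) ∧
      (ω ∈ {ω | Tc ≤ M.snrUser ω} ↔ (M.bs i ω, M.userMarks i ω) ∈ p.acceptSet Tc) := by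
    filter_upwards [M.ae_bs_pos, M.ae_serving] with ω hpos hs
    refine ⟨M.serving ω, fun j => ?_, ?_⟩
    · have hloss : ∀ i, M.userLoss i ω
          = p.CN * p.effLength (M.bs i ω, M.userMarks i ω) ^ (-p.aN) := fun i =>
        p.pathLoss_eq (y := (M.bs i ω, M.userMarks i ω)) (hpos i)
      have hT : ∀ i, 0 < p.effLength (M.bs i ω, M.userMarks i ω) := fun i =>
        p.effLength_pos (y := (M.bs i ω, M.userMarks i ω)) (hpos i)
      have h1 := hs j
      rw [hloss, hloss, mul_le_mul_iff_right₀ p.CN_pos,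
        Real.rpow_le_rpow_iff_of_neg (hT _) (hT _) (neg_lt_zero.2 p.aN_pos)] at h1
      exact h1
    · simp only [Set.mem_ofPred_eq, snrUser, Params.acceptSet, userLoss, userGain, userLOS,
        userMarks]
      congr!
  have key := measure_minimizer_mem (P := P) (Y := fun i ω => (M.bs i ω, M.userMarks i ω))
    (fun i => (M.bs_poisson.measurable i).prodMk (M.measurable_userMarks i))
    (fun B hB hB' => M.measure_user_void hB hB') p.measurable_effLength
    (fun t => by rw [p.userIntensity_effLength_le_max]; exact ENNReal.ofReal_ne_top)
    (by
      simp_rw [p.userIntensity_real_effLength_le]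
      exact p.continuous_strongerMean.comp (by fun_prop))
    (by
      rw [p.userIntensity_effLength_le le_rfl]
      have h3 : p.losLength 0 = 0 := by
        unfold Params.losLength
        rw [Real.zero_rpow (div_pos p.aN_pos p.aL_pos).ne', mul_zero]
      unfold Params.strongerMean
      rw [h3, min_eq_right p.D_pos.le]
      simp)
    (p.measurableSet_acceptSet Tc) hE
  rw [p.lintegral_acceptSet hTc] at key
  have hm : Measurable fun x : Plane => (p.acceptLOS Tc ‖x‖ + p.acceptNLOS Tc ‖x‖) :=
    ((p.measurable_acceptLOS Tc).comp measurable_norm).add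
      ((p.measurable_acceptNLOS Tc).comp measurable_norm)
  have h0 : ∀ x : Plane, 0 ≤ (p.acceptLOS Tc ‖x‖ + p.acceptNLOS Tc ‖x‖) := fun x =>
    add_nonneg (p.acceptLOS_nonneg hTc (norm_nonneg x)) (p.acceptNLOS_nonneg hTc (norm_nonneg x))
  -- Finiteness is free: λ_B times this integral is a probability.
  have hfin : ∫⁻ x : Plane, ENNReal.ofReal (p.acceptLOS Tc ‖x‖ + p.acceptNLOS Tc ‖x‖) ≠ ⊤ := by
    intro h
    rw [h, ENNReal.mul_top (by simpa using hl)] at key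
    exact measure_ne_top _ _ key
  have hint : Integrable fun x : Plane => (p.acceptLOS Tc ‖x‖ + p.acceptNLOS Tc ‖x‖) := by
    refine ⟨hm.aestronglyMeasurable, ?_⟩
    rw [hasFiniteIntegral_iff_ofReal (ae_of_all _ h0)]
    exact hfin.lt_top
  have hsum := integrable_plane_norm (f := fun r => p.acceptLOS Tc r + p.acceptNLOS Tc r) |>.1 hint
  have hpart : ∀ f : ℝ → ℝ, Measurable f →
      (∀ r, 0 < r → 0 ≤ f r ∧ f r ≤ p.acceptLOS Tc r + p.acceptNLOS Tc r) →
      IntegrableOn (fun r => r * f r) (Set.Ioi 0) := by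
    intro f hf hle
    refine hsum.mono' (measurable_id.mul hf).aestronglyMeasurable ?_
    filter_upwards [self_mem_ae_restrict measurableSet_Ioi] with r (hr : 0 < r)
    have := hle r hr
    rw [Real.norm_of_nonneg (mul_nonneg hr.le this.1)]
    exact mul_le_mul_of_nonneg_left this.2 hr.le
  have hL := hpart _ (p.measurable_acceptLOS Tc) fun r hr =>
    ⟨p.acceptLOS_nonneg hTc hr.le, le_add_of_nonneg_right (p.acceptNLOS_nonneg hTc hr.le)⟩
  have hN := hpart _ (p.measurable_acceptNLOS Tc) fun r hr =>
    ⟨p.acceptNLOS_nonneg hTc hr.le, le_add_of_nonneg_left (p.acceptLOS_nonneg hTc hr.le)⟩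
  rw [← integral_add hL hN]
  simp_rw [← mul_add]
  rw [← integral_plane_norm fun r => p.acceptLOS Tc r + p.acceptNLOS Tc r, pCon, Measure.real, key,
    ENNReal.toReal_mul, ENNReal.toReal_ofReal hl.le,
    integral_eq_lintegral_of_nonneg_ae (ae_of_all _ h0) hm.aestronglyMeasurable]

end Network

/-! ### Agreement with the closed-form association probabilities and densities -/

namespace Params

variable (p : Params)

lemma nlosLength_sq {r : ℝ} (hr : 0 ≤ r) :
    p.nlosLength r ^ 2 = (p.CN / p.CL) ^ (2 / p.aN) * r ^ (2 * p.aL / p.aN) := by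
  have h1 := p.CN_pos
  have h2 := p.CL_pos
  unfold nlosLength
  rw [mul_pow, ← Real.rpow_natCast, ← Real.rpow_natCast, ← Real.rpow_mul (by positivity),
    ← Real.rpow_mul hr]
  congr 2 <;> push_cast <;> ring

lemma losLength_sq {r : ℝ} (hr : 0 ≤ r) :
    p.losLength r ^ 2 = (p.CL / p.CN) ^ (2 / p.aL) * r ^ (2 * p.aN / p.aL) := by
  have h1 := p.CN_pos
  have h2 := p.CL_pos
  unfold losLength
  rw [mul_pow, ← Real.rpow_natCast, ← Real.rpow_natCast, ← Real.rpow_mul (by positivity),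
    ← Real.rpow_mul hr]
  congr 2 <;> push_cast <;> ring

/-- The inequality μ ≤ D: a NLOS link of length D is no stronger than a LOS link of length D. -/
lemma nlosLength_D_le (hD : p.CN * p.D ^ (-p.aN) ≤ p.CL * p.D ^ (-p.aL)) :
    p.nlosLength p.D ≤ p.D := by
  have h1 := p.CN_pos
  have h2 := p.CL_pos
  have h3 := p.aL_pos
  have h4 := p.aN_pos
  have h5 := p.D_pos
  rw [p.nlosLength_le_iff h5.le h5.le]
  have h6 : p.D ^ p.aL ≤ p.CL / p.CN * p.D ^ p.aN := by
    rw [Real.rpow_neg h5.le, Real.rpow_neg h5.le, ← div_eq_mul_inv, ← div_eq_mul_inv,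
      div_le_div_iff₀ (by positivity) (by positivity)] at hD
    rw [div_mul_eq_mul_div, le_div_iff₀ h1]
    linarith
  calc p.D = (p.D ^ p.aL) ^ (1 / p.aL) := by
        rw [← Real.rpow_mul h5.le, mul_one_div_cancel h3.ne', Real.rpow_one]
    _ ≤ (p.CL / p.CN * p.D ^ p.aN) ^ (1 / p.aL) := by gcongr
    _ = p.losLength p.D := by
        rw [Real.mul_rpow (by positivity) (by positivity), ← Real.rpow_mul h5.le, losLength]
        congr 2
        ring

lemma AN_eq : p.AN = (∫ x in (0 : ℝ)..(p.nlosLength p.D),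
      (Real.exp (-(Real.pi * p.C * p.lamB * (p.CL / p.CN) ^ (2 / p.aL) * x ^ (2 * p.aN / p.aL)))
        - Real.exp (-(Real.pi * p.C * p.lamB * p.D ^ 2)))
      * (2 * Real.pi * (1 - p.C) * p.lamB * x) * Real.exp (-(Real.pi * (1 - p.C) * p.lamB * x ^ 2)))
    + Real.exp (-(Real.pi * p.C * p.lamB * p.D ^ 2)) := by
  have h1 := p.CN_pos
  have h2 := p.CL_pos
  have h3 : (p.CL / p.CN) ^ (-(1 / p.aN)) = (p.CN / p.CL) ^ (1 / p.aN) := by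
    rw [Real.rpow_neg (by positivity), ← Real.inv_rpow (by positivity), inv_div]
  rw [AN, h3]
  rfl

lemma exp_losLength_ge {x : ℝ} (h0 : 0 ≤ x) (hx : x ≤ p.nlosLength p.D) :
    Real.exp (-(Real.pi * p.C * p.lamB * p.D ^ 2))
      ≤ Real.exp (-(Real.pi * p.C * p.lamB * (p.CL / p.CN) ^ (2 / p.aL) * x ^ (2 * p.aN / p.aL))) := by
  have hC := p.C_nonneg
  have hl := p.lamB_pos
  have hlos := p.losLength_nonneg h0
  have h1 : p.losLength x ≤ p.D := by
    rw [← p.losLength_nlosLength p.D_pos.le]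
    exact p.losLength_mono h0 hx
  rw [mul_assoc (Real.pi * p.C * p.lamB) ((p.CL / p.CN) ^ (2 / p.aL)), ← p.losLength_sq h0]
  gcongr

lemma AN_pos : 0 < p.AN := by
  have hC := p.C_nonneg
  have hC1 := p.C_le_one
  have hl := p.lamB_pos
  rw [p.AN_eq]
  refine add_pos_of_nonneg_of_pos ?_ (Real.exp_pos _)
  refine intervalIntegral.integral_nonneg (p.nlosLength_nonneg p.D_pos.le) fun x hx => ?_
  have h1 := p.exp_losLength_ge hx.1 hx.2
  have h2 : 0 ≤ 1 - p.C := by linarith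
  have h3 := hx.1
  have h4 := sub_nonneg.2 h1
  positivity

/-- Bounding the first exponential in the integrand by 1 makes the integral explicit: with b = πCλ_B
D² and k = π(1 - C)λ_B, A_N ≤ 1 - exp(-kμ²)(1 - exp(-b)). This makes A_L nonzero, so that it cancels
against the denominator of f_L. -/
lemma AN_lt_one (hC : 0 < p.C) : p.AN < 1 := by
  have hC1 := p.C_le_one
  have hl := p.lamB_pos
  have hD := p.D_pos
  have hμ := p.nlosLength_nonneg hD.le
  have hπ := Real.pi_pos
  set b := Real.pi * p.C * p.lamB * p.D ^ 2 with hb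
  have hb0 : 0 < b := by positivity
  set k := Real.pi * (1 - p.C) * p.lamB with hk
  have hk0 : 0 ≤ k := by
    have : 0 ≤ 1 - p.C := by linarith
    positivity
  have hint : ∫ x in (0 : ℝ)..(p.nlosLength p.D), (2 * k * x) * Real.exp (-(k * x ^ 2))
      = 1 - Real.exp (-(k * p.nlosLength p.D ^ 2)) := by
    have hder : ∀ x : ℝ, HasDerivAt (fun x : ℝ => -Real.exp (-(k * x ^ 2)))
        ((2 * k * x) * Real.exp (-(k * x ^ 2))) x := by
      intro x
      have h1 := (((hasDerivAt_pow 2 x).const_mul k).neg.exp).neg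
      refine h1.congr_deriv ?_
      simp only [Pi.neg_apply]
      push_cast
      ring
    rw [intervalIntegral.integral_eq_sub_of_hasDerivAt (fun x _ => hder x)
      (Continuous.intervalIntegrable (by fun_prop) _ _)]
    simp
    ring
  have hexp : 0 ≤ 2 * p.aN / p.aL := by
    have := p.aN_pos
    have := p.aL_pos
    positivity
  have hcont : Continuous fun x : ℝ => x ^ (2 * p.aN / p.aL) := Real.continuous_rpow_const hexp
  have hle : (∫ x in (0 : ℝ)..(p.nlosLength p.D),
      (Real.exp (-(Real.pi * p.C * p.lamB * (p.CL / p.CN) ^ (2 / p.aL) * x ^ (2 * p.aN / p.aL)))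
        - Real.exp (-b))
      * (2 * Real.pi * (1 - p.C) * p.lamB * x) * Real.exp (-(k * x ^ 2)))
      ≤ ∫ x in (0 : ℝ)..(p.nlosLength p.D),
        (1 - Real.exp (-b)) * ((2 * k * x) * Real.exp (-(k * x ^ 2))) := by
    refine intervalIntegral.integral_mono_on hμ (Continuous.intervalIntegrable (by fun_prop) _ _)
      (Continuous.intervalIntegrable (by fun_prop) _ _) fun x hx => ?_
    have hx0 := hx.1
    have h1 : Real.exp (-(Real.pi * p.C * p.lamB * (p.CL / p.CN) ^ (2 / p.aL)
        * x ^ (2 * p.aN / p.aL))) ≤ 1 := by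
      rw [Real.exp_le_one_iff, neg_nonpos]
      have := p.CN_pos
      have := p.CL_pos
      positivity
    rw [mul_assoc, show 2 * Real.pi * (1 - p.C) * p.lamB * x = 2 * k * x by rw [hk]; ring]
    gcongr
  rw [intervalIntegral.integral_const_mul, hint] at hle
  rw [p.AN_eq]
  have h1 : Real.exp (-b) < 1 := by
    rw [← Real.exp_zero, Real.exp_lt_exp]
    linarith
  have h2 := Real.exp_pos (-(k * p.nlosLength p.D ^ 2))
  nlinarith [mul_pos h2 (sub_pos.2 h1)]

/-- For r ≤ D the length `nlosLength r` is at most μ ≤ D, which resolves both minima. -/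
lemma strongerMean_nlosLength (hD : p.CN * p.D ^ (-p.aN) ≤ p.CL * p.D ^ (-p.aL)) {r : ℝ}
    (h0 : 0 ≤ r) (hr : r ≤ p.D) :
    p.strongerMean (p.nlosLength r)
      = p.lamB * (Real.pi * (p.C * r ^ 2 + (1 - p.C) * p.nlosLength r ^ 2)) := by
  have h1 : p.nlosLength r ≤ p.nlosLength p.D := by
    rw [p.nlosLength_le_iff h0 (p.nlosLength_nonneg p.D_pos.le), p.losLength_nlosLength p.D_pos.le]
    exact hr
  rw [strongerMean, p.losLength_nlosLength h0, min_eq_right hr,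
    min_eq_right (h1.trans (p.nlosLength_D_le hD))]
  ring

lemma fL_mul_AL (hD : p.CN * p.D ^ (-p.aN) ≤ p.CL * p.D ^ (-p.aL)) {r : ℝ}
    (h0 : 0 ≤ r) (hr : r ≤ p.D) :
    p.fL r * p.AL
      = p.lamB * (2 * Real.pi * (r * (p.qLOS r * Real.exp (-p.strongerMean (p.nlosLength r))))) := by
  rw [p.strongerMean_nlosLength hD h0 hr, p.nlosLength_sq h0, fL, qLOS, if_pos hr]
  -- For C = 0 the division by A_L is unavailable, but both sides carry the factor C.
  rcases p.C_nonneg.eq_or_lt with hC | hC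
  · simp [← hC]
  · have hAL : p.AL ≠ 0 := (sub_pos.2 (p.AN_lt_one hC)).ne'
    rw [div_mul_cancel₀ _ hAL, mul_right_comm, ← Real.exp_add,
      show -((1 - p.C) * p.lamB * Real.pi * (p.CN / p.CL) ^ (2 / p.aN) * r ^ (2 * p.aL / p.aN))
        + -(p.C * p.lamB * Real.pi * r ^ 2)
        = -(p.lamB * (Real.pi * (p.C * r ^ 2
          + (1 - p.C) * ((p.CN / p.CL) ^ (2 / p.aN) * r ^ (2 * p.aL / p.aN))))) by ring]
    ring

/-- There are three regimes: r ≤ μ, μ < r < D and r > D. Below μ the subtracted exponential of the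
second summand cancels the first summand. The radius D is excluded because both indicators equal 1
there; it is a null set. -/
lemma fN_mul_AN (hD : p.CN * p.D ^ (-p.aN) ≤ p.CL * p.D ^ (-p.aL)) {r : ℝ}
    (h0 : 0 < r) (hr : r ≠ p.D) :
    p.fN r * p.AN
      = p.lamB * (2 * Real.pi * (r * ((1 - p.qLOS r) * Real.exp (-p.strongerMean r)))) := by
  have hμD := p.nlosLength_D_le hD
  have hAN := p.AN_pos.ne'
  have hμ : (p.CN / p.CL) ^ (1 / p.aN) * p.D ^ (p.aL / p.aN) = p.nlosLength p.D := rfl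
  rw [fN, hμ, add_mul, div_mul_cancel₀ _ hAN, mul_right_comm _ _ p.AN, div_mul_cancel₀ _ hAN,
    qLOS, strongerMean]
  rcases lt_or_gt_of_ne hr with hlt | hgt
  · rw [if_pos hlt.le, if_neg (not_le.2 hlt), if_pos hlt.le, min_eq_right hlt.le]
    have e1 : Real.exp (-(Real.pi * p.lamB * r ^ 2))
        * Real.exp (Real.pi * p.C * p.lamB * (r ^ 2 - p.D ^ 2))
        = Real.exp (-((1 - p.C) * p.lamB * Real.pi * r ^ 2))
          * Real.exp (-(p.C * p.lamB * Real.pi * p.D ^ 2)) := by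
      rw [← Real.exp_add, ← Real.exp_add]
      congr 1
      ring
    rcases le_or_gt r (p.nlosLength p.D) with hle | hgt
    · have hlos : p.losLength r ≤ p.D := by
        rw [← p.losLength_nlosLength p.D_pos.le]
        exact p.losLength_mono h0.le hle
      have e2 : Real.exp (-(p.lamB * (Real.pi * (p.C * p.losLength r ^ 2 + r ^ 2 - p.C * r ^ 2))))
          = Real.exp (-((1 - p.C) * p.lamB * Real.pi * r ^ 2))
            * Real.exp (-(p.C * p.lamB * Real.pi * (p.CL / p.CN) ^ (2 / p.aL)
              * r ^ (2 * p.aN / p.aL))) := by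
        rw [← Real.exp_add, p.losLength_sq h0.le]
        congr 1
        ring
      rw [if_pos hle, min_eq_right hlos, e2]
      linear_combination (2 * Real.pi * p.lamB * r * (1 - p.C)) * e1
    · have hlos : p.D ≤ p.losLength r := by
        rw [← p.nlosLength_le_iff p.D_pos.le h0.le]
        exact hgt.le
      have e2 : Real.exp (-(p.lamB * (Real.pi * (p.C * p.D ^ 2 + r ^ 2 - p.C * r ^ 2))))
          = Real.exp (-((1 - p.C) * p.lamB * Real.pi * r ^ 2))
            * Real.exp (-(p.C * p.lamB * Real.pi * p.D ^ 2)) := by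
        rw [← Real.exp_add]
        congr 1
        ring
      rw [if_neg (not_le.2 hgt), min_eq_left hlos, e2]
      linear_combination (2 * Real.pi * p.lamB * r * (1 - p.C)) * e1
  · have hlos : p.D ≤ p.losLength r := by
      rw [← p.nlosLength_le_iff p.D_pos.le h0.le]
      exact hμD.trans hgt.le
    have e2 : Real.exp (-(p.lamB * (Real.pi * (p.C * p.D ^ 2 + r ^ 2 - p.C * p.D ^ 2))))
        = Real.exp (-(Real.pi * p.lamB * r ^ 2)) := by
      congr 1
      ring
    rw [if_neg (not_le.2 hgt), if_pos hgt.le, if_neg (not_le.2 (hμD.trans_lt hgt)),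
      if_neg (not_le.2 hgt), min_eq_left hlos, min_eq_left hgt.le, e2]
    ring

lemma integral_acceptLOS (hD : p.CN * p.D ^ (-p.aN) ≤ p.CL * p.D ^ (-p.aL)) {Tc : ℝ}
    (hTc : 0 < Tc) :
    p.lamB * (2 * Real.pi * ∫ r in Set.Ioi (0 : ℝ), r * p.acceptLOS Tc r)
      = (∫ r in (0 : ℝ)..p.D,
          upperGamma p.NL (p.N0 * Tc * r ^ p.aL / (p.Pt * p.Ms * p.CL)) / Real.Gamma p.NL
            * p.fL r) * p.AL := by
  have h1 : ∫ r in Set.Ioi (0 : ℝ), r * p.acceptLOS Tc r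
      = ∫ r in Set.Ioc (0 : ℝ) p.D, r * p.acceptLOS Tc r := by
    refine setIntegral_eq_of_subset_of_forall_sdiff_eq_zero measurableSet_Ioi
      Set.Ioc_subset_Ioi_self fun r hr => ?_
    have h2 : ¬ r ≤ p.D := fun h => hr.2 ⟨hr.1, h⟩
    simp [acceptLOS, qLOS, h2]
  rw [h1, intervalIntegral.integral_of_le p.D_pos.le, ← integral_const_mul, ← integral_const_mul,
    ← integral_mul_const]
  refine setIntegral_congr_fun measurableSet_Ioc fun r hr => ?_
  have h3 := p.userThreshold_nonneg (a := p.aL) hTc p.CL_pos hr.1.le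
  have h4 := p.fL_mul_AL hD hr.1.le hr.2
  have h5 := upperGamma_natCast p.NL_pos h3
  rw [userThreshold] at h5
  rw [mul_assoc _ (p.fL r), h4, h5, acceptLOS, gammaTail, userThreshold]
  ring

lemma integral_acceptNLOS (hD : p.CN * p.D ^ (-p.aN) ≤ p.CL * p.D ^ (-p.aL)) {Tc : ℝ}
    (hTc : 0 < Tc) :
    p.lamB * (2 * Real.pi * ∫ r in Set.Ioi (0 : ℝ), r * p.acceptNLOS Tc r)
      = (∫ r in Set.Ioi (0 : ℝ),
          upperGamma p.NN (p.N0 * Tc * r ^ p.aN / (p.Pt * p.Ms * p.CN)) / Real.Gamma p.NN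
            * p.fN r) * p.AN := by
  rw [← integral_const_mul, ← integral_const_mul, ← integral_mul_const]
  refine setIntegral_congr_ae measurableSet_Ioi ?_
  have hne : ∀ᵐ r : ℝ, r ≠ p.D := by simp [ae_iff]
  filter_upwards [hne] with r hrD (hr : 0 < r)
  have h3 := p.userThreshold_nonneg (a := p.aN) hTc p.CN_pos hr.le
  have h4 := p.fN_mul_AN hD hr hrD
  have h5 := upperGamma_natCast p.NN_pos h3
  rw [userThreshold] at h5
  rw [mul_assoc _ (p.fN r), h4, h5, acceptNLOS, gammaTail, userThreshold]
  ring

end Params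

/-! ### Radial integrals of gamma tails -/

/-- Substitution u = r^a / K, performed as y = r^a followed by y = K u. -/
lemma integral_mul_comp_rpow_div {a K : ℝ} (ha : 0 < a) (hK : 0 < K) (φ : ℝ → ℝ) :
    ∫ r in Set.Ioi (0 : ℝ), r * φ (r ^ a / K)
      = K ^ (2 / a) / a * ∫ u in Set.Ioi (0 : ℝ), u ^ (2 / a - 1) * φ u := by
  have h1 := integral_comp_rpow_Ioi (fun y : ℝ => y ^ (2 / a - 1) * φ (y / K)) ha.ne'
  have h2 := integral_comp_mul_left_Ioi (fun y : ℝ => y ^ (2 / a - 1) * φ (y / K)) 0 hK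
  rw [mul_zero] at h2
  have e1 : ∫ r in Set.Ioi (0 : ℝ), (|a| * r ^ (a - 1)) • ((r ^ a) ^ (2 / a - 1) * φ (r ^ a / K))
      = a * ∫ r in Set.Ioi (0 : ℝ), r * φ (r ^ a / K) := by
    rw [← integral_const_mul]
    refine setIntegral_congr_fun measurableSet_Ioi fun r (hr : 0 < r) => ?_
    have : r ^ (a - 1) * (r ^ a) ^ (2 / a - 1) = r := by
      rw [← Real.rpow_mul hr.le, ← Real.rpow_add hr,
        show a - 1 + a * (2 / a - 1) = 1 by field_simp; ring, Real.rpow_one]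
    simp only [smul_eq_mul, abs_of_pos ha]
    rw [show a * r ^ (a - 1) * ((r ^ a) ^ (2 / a - 1) * φ (r ^ a / K))
      = a * ((r ^ (a - 1) * (r ^ a) ^ (2 / a - 1)) * φ (r ^ a / K)) by ring, this]
  have e2 : ∫ u in Set.Ioi (0 : ℝ), (K * u) ^ (2 / a - 1) * φ (K * u / K)
      = K ^ (2 / a - 1) * ∫ u in Set.Ioi (0 : ℝ), u ^ (2 / a - 1) * φ u := by
    rw [← integral_const_mul]
    refine setIntegral_congr_fun measurableSet_Ioi fun u (hu : 0 < u) => ?_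
    rw [Real.mul_rpow hK.le hu.le, mul_div_cancel_left₀ _ hK.ne', mul_assoc]
  rw [e1] at h1
  rw [e2, ← h1, smul_eq_mul] at h2
  have h3 : K ^ (2 / a) = K ^ (2 / a - 1) * K := by
    rw [← Real.rpow_add_one hK.ne', sub_add_cancel]
  rw [h3]
  field_simp at h2 ⊢
  linarith

lemma integrableOn_mul_comp_rpow_div {a K : ℝ} (ha : 0 < a) (hK : 0 < K) {φ : ℝ → ℝ}
    (hφ : IntegrableOn (fun u => u ^ (2 / a - 1) * φ u) (Set.Ioi 0)) :
    IntegrableOn (fun r => r * φ (r ^ a / K)) (Set.Ioi 0) := by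
  have h1 := integrableOn_Ioi_comp_rpow_iff (fun y : ℝ => y ^ (2 / a - 1) * φ (y / K)) ha.ne'
  have h2 := integrableOn_Ioi_comp_mul_left_iff (fun y : ℝ => y ^ (2 / a - 1) * φ (y / K)) 0 hK
  rw [mul_zero] at h2
  have h3 : IntegrableOn (fun u : ℝ => (K * u) ^ (2 / a - 1) * φ (K * u / K)) (Set.Ioi 0) := by
    refine IntegrableOn.congr_fun (hφ.const_mul (K ^ (2 / a - 1))) (fun u (hu : 0 < u) => ?_)
      measurableSet_Ioi
    rw [Real.mul_rpow hK.le hu.le, mul_div_cancel_left₀ _ hK.ne', mul_assoc]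
  have h4 := (h1.2 (h2.1 h3)).const_mul a⁻¹
  refine IntegrableOn.congr_fun h4 (fun r (hr : 0 < r) => ?_) measurableSet_Ioi
  have : r ^ (a - 1) * (r ^ a) ^ (2 / a - 1) = r := by
    rw [← Real.rpow_mul hr.le, ← Real.rpow_add hr,
      show a - 1 + a * (2 / a - 1) = 1 by field_simp; ring, Real.rpow_one]
  simp only [smul_eq_mul, abs_of_pos ha]
  rw [show a⁻¹ * (a * r ^ (a - 1) * ((r ^ a) ^ (2 / a - 1) * φ (r ^ a / K)))
    = (a⁻¹ * a) * ((r ^ (a - 1) * (r ^ a) ^ (2 / a - 1)) * φ (r ^ a / K)) by ring, this,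
    inv_mul_cancel₀ ha.ne', one_mul]

lemma rpow_mul_gammaTail {b u : ℝ} (n : ℕ) (hu : 0 < u) :
    u ^ (b - 1) * gammaTail n u
      = ∑ m ∈ Finset.range n, u ^ (m + b - 1) * Real.exp (-u) / m.factorial := by
  rw [gammaTail, Finset.mul_sum, Finset.mul_sum]
  refine Finset.sum_congr rfl fun m _ => ?_
  rw [show (m : ℝ) + b - 1 = b - 1 + m by ring, Real.rpow_add hu, Real.rpow_natCast]
  ring

lemma integrableOn_rpow_mul_exp {b : ℝ} (hb : 0 < b) (m : ℕ) :
    IntegrableOn (fun u : ℝ => u ^ (m + b - 1) * Real.exp (-u) / m.factorial) (Set.Ioi 0) :=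
  (integrableOn_upperGamma (by positivity) le_rfl).div_const _

lemma integrableOn_rpow_mul_gammaTail {b : ℝ} (hb : 0 < b) (n : ℕ) :
    IntegrableOn (fun u : ℝ => u ^ (b - 1) * gammaTail n u) (Set.Ioi 0) := by
  have h1 : IntegrableOn (fun u : ℝ => ∑ m ∈ Finset.range n,
      u ^ (m + b - 1) * Real.exp (-u) / m.factorial) (Set.Ioi 0) :=
    integrable_finsetSum _ fun m _ => integrableOn_rpow_mul_exp hb m
  exact h1.congr_fun (fun u hu => (rpow_mul_gammaTail n hu).symm) measurableSet_Ioi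

lemma setIntegral_rpow_mul_gammaTail {b : ℝ} (hb : 0 < b) (n : ℕ) {s : Set ℝ}
    (hs : MeasurableSet s) (hs0 : s ⊆ Set.Ioi 0) :
    ∫ u in s, u ^ (b - 1) * gammaTail n u
      = ∑ m ∈ Finset.range n, (∫ u in s, u ^ (m + b - 1) * Real.exp (-u)) / m.factorial := by
  rw [setIntegral_congr_fun hs fun u hu => rpow_mul_gammaTail n (hs0 hu),
    integral_finsetSum _ fun m _ => (integrableOn_rpow_mul_exp hb m).mono_set hs0]
  simp_rw [integral_div]

lemma integrableOn_mul_gammaTail {a K : ℝ} (ha : 0 < a) (hK : 0 < K) (n : ℕ) :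
    IntegrableOn (fun r => r * gammaTail n (r ^ a / K)) (Set.Ioi 0) :=
  integrableOn_mul_comp_rpow_div ha hK (integrableOn_rpow_mul_gammaTail (by positivity) n)

/-- Arbitrary sets related by the substitution let the disc of radius D and its exterior be treated
together; they give the lower and the upper incomplete gamma functions. -/
lemma setIntegral_mul_gammaTail {a K : ℝ} (ha : 0 < a) (hK : 0 < K) (n : ℕ) {s s' : Set ℝ}
    (hs : MeasurableSet s) (hs' : MeasurableSet s') (hs0 : s ⊆ Set.Ioi 0) (hs0' : s' ⊆ Set.Ioi 0)
    (h : ∀ r, 0 < r → (r ∈ s ↔ r ^ a / K ∈ s')) :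
    ∫ r in s, r * gammaTail n (r ^ a / K)
      = K ^ (2 / a) / a * ∑ m ∈ Finset.range n,
        (∫ u in s', u ^ (m + 2 / a - 1) * Real.exp (-u)) / m.factorial := by
  classical
  have h1 := integral_mul_comp_rpow_div ha hK (s'.indicator (gammaTail n))
  have e1 : ∫ r in Set.Ioi (0 : ℝ), r * s'.indicator (gammaTail n) (r ^ a / K)
      = ∫ r in s, r * gammaTail n (r ^ a / K) := by
    rw [← Set.inter_eq_right.2 hs0, ← setIntegral_indicator hs]
    refine setIntegral_congr_fun measurableSet_Ioi fun r (hr : 0 < r) => ?_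
    simp only [Set.indicator_apply, h r hr, mul_ite, mul_zero]
  have e2 : ∫ u in Set.Ioi (0 : ℝ), u ^ (2 / a - 1) * s'.indicator (gammaTail n) u
      = ∫ u in s', u ^ (2 / a - 1) * gammaTail n u := by
    conv_rhs => rw [← Set.inter_eq_right.2 hs0', ← setIntegral_indicator hs']
    refine setIntegral_congr_fun measurableSet_Ioi fun r (hr : 0 < r) => ?_
    simp only [Set.indicator_apply, mul_ite, mul_zero]
  rw [e1, e2, setIntegral_rpow_mul_gammaTail (by positivity) n hs' hs0'] at h1
  exact h1

namespace Params

variable (p : Params)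

/-! ### The law of the marks of an eavesdropper -/

/-- The law of the angle off the boresight. -/
def angleLaw : Measure ℝ := (360 : ENNReal)⁻¹ • volume.restrict (Set.Icc (-180) 180)

instance isProbabilityMeasure_angleLaw : IsProbabilityMeasure angleLaw := ⟨by
  rw [angleLaw, Measure.smul_apply, Measure.restrict_apply_univ, Real.volume_Icc, smul_eq_mul]
  norm_num
  exact ENNReal.inv_mul_cancel (by norm_num) (by norm_num)⟩

lemma measurable_arrayGain : Measurable p.arrayGain :=
  Measurable.ite (measurableSet_le measurable_id.abs measurable_const) measurable_const
    measurable_const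

lemma prMain_nonneg : 0 ≤ p.prMain := div_nonneg p.thetaB_nonneg (by norm_num)

lemma prSide_nonneg : 0 ≤ p.prSide := div_nonneg (sub_nonneg.2 p.thetaB_le) (by norm_num)

lemma angleLaw_main : angleLaw {θ | |θ| ≤ p.thetaB} = ENNReal.ofReal p.prMain := by
  have h0 := p.thetaB_nonneg
  have h1 := p.thetaB_le
  have hset : {θ : ℝ | |θ| ≤ p.thetaB} ∩ Set.Icc (-180) 180 = Set.Icc (-p.thetaB) p.thetaB := by
    ext θ
    simp only [Set.mem_inter_iff, Set.mem_ofPred_eq, Set.mem_Icc, abs_le]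
    constructor
    · exact fun h => h.1
    · exact fun h => ⟨h, by linarith [h.1], by linarith [h.2]⟩
  rw [angleLaw, Measure.smul_apply, Measure.restrict_apply
    (measurableSet_le (by fun_prop) measurable_const :
      MeasurableSet {θ : ℝ | |θ| ≤ p.thetaB}), hset, Real.volume_Icc, smul_eq_mul,
    show (360 : ℝ≥0∞)⁻¹ = ENNReal.ofReal (360⁻¹) by
      rw [ENNReal.ofReal_inv_of_pos (by norm_num)]; norm_num,
    ← ENNReal.ofReal_mul (by norm_num), prMain]
  congr 1
  ring

lemma lintegral_arrayGain (F : ℝ → ℝ≥0∞) :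
    ∫⁻ θ, F (p.arrayGain θ) ∂angleLaw
      = ENNReal.ofReal p.prMain * F p.Ms + ENNReal.ofReal p.prSide * F p.ms := by
  have hm : MeasurableSet {θ : ℝ | |θ| ≤ p.thetaB} :=
    measurableSet_le measurable_id.abs measurable_const
  have hc : angleLaw {θ : ℝ | |θ| ≤ p.thetaB}ᶜ = ENNReal.ofReal p.prSide := by
    rw [prob_compl_eq_one_sub hm, p.angleLaw_main, ← ENNReal.ofReal_one,
      ← ENNReal.ofReal_sub _ p.prMain_nonneg, prMain, prSide]
    congr 1
    ring
  rw [← lintegral_add_compl _ hm,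
    setLIntegral_congr_fun hm (g := fun _ => F p.Ms) fun θ hθ => by
      simp only [arrayGain]; rw [if_pos (by exact hθ)],
    setLIntegral_congr_fun hm.compl (g := fun _ => F p.ms) fun θ hθ => by
      simp only [arrayGain]; rw [if_neg (by exact hθ)],
    setLIntegral_const, setLIntegral_const, hc, p.angleLaw_main, mul_comm (F _), mul_comm (F _)]

/-- The law of the marks (blockage, angle), (LOS gain, NLOS gain) of a link to an eavesdropper. -/
def eveMarkLaw : Measure ((ℝ × ℝ) × (ℝ × ℝ)) :=
  ((volume.restrict (Set.Icc (0 : ℝ) 1)).prod angleLaw).prod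
    ((gammaMeasure p.NL 1).prod (gammaMeasure p.NN 1))

instance : IsProbabilityMeasure p.eveMarkLaw := by
  unfold eveMarkLaw
  infer_instance

lemma lintegral_eveMarkLaw {q : ℝ} (h0 : 0 ≤ q) (h1 : q ≤ 1) {f g : ℝ → ℝ → ℝ≥0∞}
    (hf : Measurable (Function.uncurry f)) (hg : Measurable (Function.uncurry g)) :
    ∫⁻ z, (if z.1.1 < q then f z.1.2 z.2.1 else g z.1.2 z.2.2) ∂p.eveMarkLaw
      = ENNReal.ofReal q * ∫⁻ θ, ∫⁻ x, f θ x ∂(gammaMeasure p.NL 1) ∂angleLaw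
        + ENNReal.ofReal (1 - q) * ∫⁻ θ, ∫⁻ x, g θ x ∂(gammaMeasure p.NN 1) ∂angleLaw := by
  have hf' : Measurable fun z : (ℝ × ℝ) × (ℝ × ℝ) => f z.1.2 z.2.1 :=
    hf.comp (by fun_prop : Measurable fun z : (ℝ × ℝ) × (ℝ × ℝ) => (z.1.2, z.2.1))
  have hg' : Measurable fun z : (ℝ × ℝ) × (ℝ × ℝ) => g z.1.2 z.2.2 :=
    hg.comp (by fun_prop : Measurable fun z : (ℝ × ℝ) × (ℝ × ℝ) => (z.1.2, z.2.2))
  have hm : Measurable fun z : (ℝ × ℝ) × (ℝ × ℝ) =>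
      if z.1.1 < q then f z.1.2 z.2.1 else g z.1.2 z.2.2 :=
    Measurable.ite (measurableSet_lt (by fun_prop) measurable_const) hf' hg'
  rw [eveMarkLaw, lintegral_prod _ hm.aemeasurable,
    lintegral_prod _ (hm.lintegral_prod_right').aemeasurable, ← lintegral_uniform_ite h0 h1]
  refine lintegral_congr fun u => ?_
  by_cases hu : u < q
  · simp only [hu, if_true]
    refine lintegral_congr fun θ => ?_
    have : Measurable fun x => f θ x := hf.comp measurable_prodMk_left
    rw [lintegral_prod (fun y : ℝ × ℝ => f θ y.1) (this.comp measurable_fst).aemeasurable]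
    simp
  · simp only [hu, if_false]
    refine lintegral_congr fun θ => ?_
    have : Measurable fun x => g θ x := hg.comp measurable_prodMk_left
    rw [lintegral_prod (fun y : ℝ × ℝ => g θ y.2) (this.comp measurable_snd).aemeasurable]
    simp

/-- The marked eavesdroppers, in coordinates relative to the serving BS, whose received SNR exceeds
`Te`. -/
def detectSet (Te : ℝ) : Set (Plane × ((ℝ × ℝ) × (ℝ × ℝ))) :=
  {y | Te < p.Pt * p.arrayGain y.2.1.2 * p.pathLoss (y.2.1.1 < p.qLOS ‖y.1‖) ‖y.1‖
    * (if y.2.1.1 < p.qLOS ‖y.1‖ then y.2.2.1 else y.2.2.2) / p.N0}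

lemma measurableSet_detectSet (Te : ℝ) : MeasurableSet (p.detectSet Te) := by
  have h0 : MeasurableSet {y : Plane × ((ℝ × ℝ) × (ℝ × ℝ)) | y.2.1.1 < p.qLOS ‖y.1‖} :=
    measurableSet_lt (by fun_prop) (p.measurable_qLOS.comp (by fun_prop))
  have h1 : Measurable fun y : Plane × ((ℝ × ℝ) × (ℝ × ℝ)) =>
      p.pathLoss (y.2.1.1 < p.qLOS ‖y.1‖) ‖y.1‖ :=
    p.measurable_pathLoss h0 (by fun_prop)
  have h2 : Measurable fun y : Plane × ((ℝ × ℝ) × (ℝ × ℝ)) =>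
      if y.2.1.1 < p.qLOS ‖y.1‖ then y.2.2.1 else y.2.2.2 :=
    Measurable.ite h0 (by fun_prop) (by fun_prop)
  have h3 : Measurable fun y : Plane × ((ℝ × ℝ) × (ℝ × ℝ)) => p.arrayGain y.2.1.2 :=
    p.measurable_arrayGain.comp (by fun_prop)
  exact measurableSet_lt measurable_const ((((h3.const_mul _).mul h1).mul h2).div_const _)

/-- Strict inequality is needed here: secrecy fails exactly when some SNR exceeds `Te`. The gamma
law has no atoms, so its tail is unaffected. -/
lemma lt_snr_iff {Te V c a r g : ℝ} (hTe : 0 < Te) (hV : 0 < V) (hc : 0 < c) (hr : 0 < r) :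
    Te < p.Pt * V * (c * r ^ (-a)) * g / p.N0 ↔ r ^ a / (V * c * (p.Pt / (Te * p.N0))) < g := by
  have h1 := p.N0_pos
  have h2 := p.Pt_pos
  have h4 : 0 < r ^ a := Real.rpow_pos_of_pos hr a
  rw [lt_div_iff₀ h1, div_lt_iff₀ (by positivity), Real.rpow_neg hr.le,
    show p.Pt * V * (c * (r ^ a)⁻¹) * g = (p.Pt * V * c * g) / r ^ a by field_simp,
    lt_div_iff₀ h4,
    show g * (V * c * (p.Pt / (Te * p.N0))) = (p.Pt * V * c * g) / (Te * p.N0) by field_simp,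
    lt_div_iff₀ (by positivity)]
  rw [mul_comm (r ^ a)]

/-- The probability that the gain of a link of length `r` in a fixed state exceeds the detection
threshold. -/
def detectTail (c a : ℝ) (n : ℕ) (t r : ℝ) : ℝ :=
  p.prMain * gammaTail n (r ^ a / (p.Ms * c * t)) + p.prSide * gammaTail n (r ^ a / (p.ms * c * t))

lemma detectTail_nonneg {c : ℝ} (hc : 0 < c) (a : ℝ) (n : ℕ) {t r : ℝ} (ht : 0 < t) (hr : 0 ≤ r) :
    0 ≤ p.detectTail c a n t r := by
  have h1 := p.Ms_pos
  have h2 := p.ms_pos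
  have h3 := p.prMain_nonneg
  have h4 := p.prSide_nonneg
  have h5 := gammaTail_nonneg n (x := r ^ a / (p.Ms * c * t)) (by positivity)
  have h6 := gammaTail_nonneg n (x := r ^ a / (p.ms * c * t)) (by positivity)
  unfold detectTail
  positivity

lemma integrableOn_detectTail {c a : ℝ} (hc : 0 < c) (ha : 0 < a) (n : ℕ) {t : ℝ} (ht : 0 < t) :
    IntegrableOn (fun r => r * p.detectTail c a n t r) (Set.Ioi 0) := by
  have h1 := p.Ms_pos
  have h2 := p.ms_pos
  have h3 := (integrableOn_mul_gammaTail ha (K := p.Ms * c * t) (by positivity) n).const_mul p.prMain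
  have h4 := (integrableOn_mul_gammaTail ha (K := p.ms * c * t) (by positivity) n).const_mul p.prSide
  refine (h3.add h4).congr (ae_of_all _ fun r => ?_)
  simp only [Pi.add_apply, detectTail]
  ring

lemma setIntegral_detectTail_in {c a : ℝ} (hc : 0 < c) (ha : 0 < a) (n : ℕ) {t : ℝ} (ht : 0 < t) :
    ∫ r in Set.Ioc 0 p.D, r * p.detectTail c a n t r
      = p.omegaIn p.prMain p.Ms c a n t + p.omegaIn p.prSide p.ms c a n t := by
  have h1 := p.Ms_pos
  have h2 := p.ms_pos
  have hsub : Set.Ioc 0 p.D ⊆ Set.Ioi (0 : ℝ) := Set.Ioc_subset_Ioi_self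
  have key : ∀ V, 0 < V → ∫ r in Set.Ioc 0 p.D, r * gammaTail n (r ^ a / (V * c * t))
      = (V * c * t) ^ (2 / a) / a * ∑ m ∈ Finset.range n,
        lowerGamma (m + 2 / a) (p.D ^ a / (V * c * t)) / m.factorial := by
    intro V hV
    refine setIntegral_mul_gammaTail ha (by positivity) n measurableSet_Ioc
      (s' := Set.Ioc 0 (p.D ^ a / (V * c * t))) measurableSet_Ioc hsub Set.Ioc_subset_Ioi_self
      fun r hr => ?_
    have h3 : 0 < r ^ a / (V * c * t) := by positivity
    simp only [Set.mem_Ioc, hr, h3, true_and]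
    rw [div_le_div_iff_of_pos_right (by positivity), Real.rpow_le_rpow_iff hr.le p.D_pos.le ha]
  have h3 := ((integrableOn_mul_gammaTail ha (K := p.Ms * c * t) (by positivity) n).mono_set
    hsub).const_mul p.prMain
  have h4 := ((integrableOn_mul_gammaTail ha (K := p.ms * c * t) (by positivity) n).mono_set
    hsub).const_mul p.prSide
  have h5 : ∀ r, r * p.detectTail c a n t r
      = p.prMain * (r * gammaTail n (r ^ a / (p.Ms * c * t)))
        + p.prSide * (r * gammaTail n (r ^ a / (p.ms * c * t))) := fun r => by
    rw [detectTail]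
    ring
  simp_rw [h5]
  rw [integral_add h3 h4, integral_const_mul, integral_const_mul, key _ h1, key _ h2, omegaIn,
    omegaIn]
  ring

lemma setIntegral_detectTail_out {c a : ℝ} (hc : 0 < c) (ha : 0 < a) (n : ℕ) {t : ℝ} (ht : 0 < t) :
    ∫ r in Set.Ioi p.D, r * p.detectTail c a n t r
      = p.omegaOut p.prMain p.Ms c a n t + p.omegaOut p.prSide p.ms c a n t := by
  have h1 := p.Ms_pos
  have h2 := p.ms_pos
  have hD := p.D_pos
  have hsub : Set.Ioi p.D ⊆ Set.Ioi (0 : ℝ) := Set.Ioi_subset_Ioi hD.le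
  have key : ∀ V, 0 < V → ∫ r in Set.Ioi p.D, r * gammaTail n (r ^ a / (V * c * t))
      = (V * c * t) ^ (2 / a) / a * ∑ m ∈ Finset.range n,
        upperGamma (m + 2 / a) (p.D ^ a / (V * c * t)) / m.factorial := by
    intro V hV
    refine setIntegral_mul_gammaTail ha (by positivity) n measurableSet_Ioi
      (s' := Set.Ioi (p.D ^ a / (V * c * t))) measurableSet_Ioi hsub
      (Set.Ioi_subset_Ioi (by positivity)) fun r hr => ?_
    simp only [Set.mem_Ioi]
    rw [div_lt_div_iff_of_pos_right (by positivity), Real.rpow_lt_rpow_iff p.D_pos.le hr.le ha]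
  have h3 := ((integrableOn_mul_gammaTail ha (K := p.Ms * c * t) (by positivity) n).mono_set
    hsub).const_mul p.prMain
  have h4 := ((integrableOn_mul_gammaTail ha (K := p.ms * c * t) (by positivity) n).mono_set
    hsub).const_mul p.prSide
  have h5 : ∀ r, r * p.detectTail c a n t r
      = p.prMain * (r * gammaTail n (r ^ a / (p.Ms * c * t)))
        + p.prSide * (r * gammaTail n (r ^ a / (p.ms * c * t))) := fun r => by
    rw [detectTail]
    ring
  simp_rw [h5]
  rw [integral_add h3 h4, integral_const_mul, integral_const_mul, key _ h1, key _ h2, omegaOut,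
    omegaOut]
  ring

/-- The probability that an eavesdropper at distance `r` of the serving BS detects its signal. -/
def detectProb (t r : ℝ) : ℝ :=
  p.qLOS r * p.detectTail p.CL p.aL p.NL t r + (1 - p.qLOS r) * p.detectTail p.CN p.aN p.NN t r

lemma detectProb_nonneg {t r : ℝ} (ht : 0 < t) (hr : 0 ≤ r) : 0 ≤ p.detectProb t r := by
  have h1 := p.qLOS_nonneg r
  have h2 := sub_nonneg.2 (p.qLOS_le_one r)
  have h3 := p.detectTail_nonneg p.CL_pos p.aL p.NL ht hr
  have h4 := p.detectTail_nonneg p.CN_pos p.aN p.NN ht hr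
  unfold detectProb
  positivity

lemma eveMarkLaw_detectSet {Te : ℝ} (hTe : 0 < Te) {x : Plane} (hx : x ≠ 0) :
    p.eveMarkLaw (Prod.mk x ⁻¹' p.detectSet Te)
      = ENNReal.ofReal (p.detectProb (p.Pt / (Te * p.N0)) ‖x‖) := by
  classical
  have hr : 0 < ‖x‖ := norm_pos_iff.2 hx
  have hN0 := p.N0_pos
  have hPt := p.Pt_pos
  have hMs := p.Ms_pos
  have hms := p.ms_pos
  have hgain : ∀ θ, 0 < p.arrayGain θ := fun θ => by
    unfold arrayGain
    split_ifs
    exacts [hMs, hms]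
  set t := p.Pt / (Te * p.N0) with ht
  have ht0 : 0 < t := by positivity
  have hm : MeasurableSet (Prod.mk x ⁻¹' p.detectSet Te) :=
    (p.measurableSet_detectSet Te).preimage (by fun_prop)
  let F : ℝ → ℝ → ℝ → ℝ → ℝ≥0∞ := fun c a θ g =>
    (Set.Ioi (‖x‖ ^ a / (p.arrayGain θ * c * t))).indicator 1 g
  have h1 : p.eveMarkLaw (Prod.mk x ⁻¹' p.detectSet Te)
      = ∫⁻ z, (if z.1.1 < p.qLOS ‖x‖ then F p.CL p.aL z.1.2 z.2.1
          else F p.CN p.aN z.1.2 z.2.2) ∂p.eveMarkLaw := by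
    rw [← lintegral_indicator_one hm]
    refine lintegral_congr fun z => ?_
    simp only [Set.indicator_apply, Set.mem_preimage, detectSet, Set.mem_ofPred_eq, Pi.one_apply, F,
      Set.mem_Ioi, pathLoss]
    by_cases h : z.1.1 < p.qLOS ‖x‖
    · simp only [h, if_true, p.lt_snr_iff hTe (hgain _) p.CL_pos hr, ht]
    · simp only [h, if_false, p.lt_snr_iff hTe (hgain _) p.CN_pos hr, ht]
  have hF : ∀ c a, Measurable (Function.uncurry (F c a)) := fun c a => by
    have h2 : MeasurableSet {q : ℝ × ℝ | ‖x‖ ^ a / (p.arrayGain q.1 * c * t) < q.2} :=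
      measurableSet_lt (measurable_const.div (((p.measurable_arrayGain.comp
        measurable_fst).mul_const _).mul_const _)) measurable_snd
    exact (measurable_one.indicator h2 : Measurable ({q : ℝ × ℝ |
      ‖x‖ ^ a / (p.arrayGain q.1 * c * t) < q.2}.indicator (1 : ℝ × ℝ → ℝ≥0∞)))
  have hint : ∀ c a, 0 < c → ∀ n : ℕ, 0 < n →
      ∫⁻ θ, ∫⁻ g, F c a θ g ∂(gammaMeasure n 1) ∂angleLaw
        = ENNReal.ofReal (p.detectTail c a n t ‖x‖) := by
    intro c a hc n hn
    have h2 : ∀ θ, ∫⁻ g, F c a θ g ∂(gammaMeasure n 1)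
        = ENNReal.ofReal (gammaTail n (‖x‖ ^ a / (p.arrayGain θ * c * t))) := by
      intro θ
      have := hgain θ
      rw [lintegral_indicator_one measurableSet_Ioi, gammaMeasure_Ioi,
        gammaMeasure_Ici_natCast hn (by positivity)]
    simp_rw [h2]
    have h5 := gammaTail_nonneg n (x := ‖x‖ ^ a / (p.Ms * c * t)) (by positivity)
    have h6 := gammaTail_nonneg n (x := ‖x‖ ^ a / (p.ms * c * t)) (by positivity)
    rw [p.lintegral_arrayGain fun V => ENNReal.ofReal (gammaTail n (‖x‖ ^ a / (V * c * t))),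
      ← ENNReal.ofReal_mul p.prMain_nonneg, ← ENNReal.ofReal_mul p.prSide_nonneg,
      ← ENNReal.ofReal_add (mul_nonneg p.prMain_nonneg h5) (mul_nonneg p.prSide_nonneg h6),
      detectTail]
  have hq0 := p.qLOS_nonneg ‖x‖
  have hq1 := p.qLOS_le_one ‖x‖
  rw [h1, p.lintegral_eveMarkLaw hq0 hq1 (hF _ _) (hF _ _), hint _ _ p.CL_pos _ p.NL_pos,
    hint _ _ p.CN_pos _ p.NN_pos, ← ENNReal.ofReal_mul hq0, ← ENNReal.ofReal_mul (by linarith),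
    ← ENNReal.ofReal_add
      (mul_nonneg hq0 (p.detectTail_nonneg p.CL_pos _ _ ht0 hr.le))
      (mul_nonneg (by linarith) (p.detectTail_nonneg p.CN_pos _ _ ht0 hr.le)), detectProb]

/-- Splitting at D: both link states contribute inside, with weights C and 1 - C, and only NLOS
links outside. -/
lemma integral_detectProb {t : ℝ} (ht : 0 < t) :
    IntegrableOn (fun r => r * p.detectProb t r) (Set.Ioi 0) ∧
      p.lamE * (2 * Real.pi * ∫ r in Set.Ioi (0 : ℝ), r * p.detectProb t r) = p.LambdaE t := by
  have hsub1 : Set.Ioc 0 p.D ⊆ Set.Ioi (0 : ℝ) := Set.Ioc_subset_Ioi_self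
  have hsub2 : Set.Ioi p.D ⊆ Set.Ioi (0 : ℝ) := Set.Ioi_subset_Ioi p.D_pos.le
  have hL := p.integrableOn_detectTail p.CL_pos p.aL_pos p.NL ht
  have hN := p.integrableOn_detectTail p.CN_pos p.aN_pos p.NN ht
  have hin : ∀ r ∈ Set.Ioc 0 p.D, p.C * (r * p.detectTail p.CL p.aL p.NL t r)
      + (1 - p.C) * (r * p.detectTail p.CN p.aN p.NN t r) = r * p.detectProb t r := by
    intro r hr
    rw [detectProb, qLOS, if_pos hr.2]
    ring
  have hout : ∀ r ∈ Set.Ioi p.D, r * p.detectTail p.CN p.aN p.NN t r = r * p.detectProb t r := by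
    intro r hr
    rw [detectProb, qLOS, if_neg (not_le.2 hr)]
    ring
  have h1 := (hL.mono_set hsub1).const_mul p.C
  have h2 := (hN.mono_set hsub1).const_mul (1 - p.C)
  have hI1 : IntegrableOn (fun r => r * p.detectProb t r) (Set.Ioc 0 p.D) :=
    IntegrableOn.congr_fun (h1.add h2) hin measurableSet_Ioc
  have hI2 : IntegrableOn (fun r => r * p.detectProb t r) (Set.Ioi p.D) :=
    (hN.mono_set hsub2).congr_fun hout measurableSet_Ioi
  rw [← Set.Ioc_union_Ioi_eq_Ioi p.D_pos.le]
  refine ⟨hI1.union hI2, ?_⟩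
  rw [setIntegral_union (Set.Ioc_disjoint_Ioi le_rfl) measurableSet_Ioi hI1 hI2,
    ← setIntegral_congr_fun measurableSet_Ioc hin, ← setIntegral_congr_fun measurableSet_Ioi hout,
    integral_add h1 h2, integral_const_mul, integral_const_mul,
    p.setIntegral_detectTail_in p.CL_pos p.aL_pos _ ht,
    p.setIntegral_detectTail_in p.CN_pos p.aN_pos _ ht,
    p.setIntegral_detectTail_out p.CN_pos p.aN_pos _ ht, LambdaE]
  ring

lemma lintegral_eveMarkLaw_detectSet {Te : ℝ} (hTe : 0 < Te) :
    ∫⁻ x, p.eveMarkLaw (Prod.mk x ⁻¹' p.detectSet Te) ≠ ⊤ ∧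
      p.lamE * (∫⁻ x, p.eveMarkLaw (Prod.mk x ⁻¹' p.detectSet Te)).toReal
        = p.LambdaE (p.Pt / (Te * p.N0)) := by
  have hN0 := p.N0_pos
  have hPt := p.Pt_pos
  have ht : 0 < p.Pt / (Te * p.N0) := by positivity
  obtain ⟨h1, h2⟩ := p.integral_detectProb ht
  have hint := integrable_plane_norm.2 h1
  have hne : ∀ᵐ x : Plane, x ≠ 0 := by simp [ae_iff]
  have h3 : ∫⁻ x, p.eveMarkLaw (Prod.mk x ⁻¹' p.detectSet Te)
      = ENNReal.ofReal (∫ x : Plane, p.detectProb (p.Pt / (Te * p.N0)) ‖x‖) := by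
    rw [ofReal_integral_eq_lintegral_ofReal hint
      (ae_of_all _ fun x => p.detectProb_nonneg ht (norm_nonneg x))]
    refine lintegral_congr_ae ?_
    filter_upwards [hne] with x hx
    exact p.eveMarkLaw_detectSet hTe hx
  rw [h3]
  refine ⟨ENNReal.ofReal_ne_top, ?_⟩
  rw [ENNReal.toReal_ofReal (integral_nonneg fun x => p.detectProb_nonneg ht (norm_nonneg x)),
    integral_plane_norm, h2]

end Params

/-! ### Measurability of the serving index and the secrecy probability -/

lemma measurable_sInf_nat {α : Type*} [MeasurableSpace α] {Q : ℕ → Set α}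
    (hQ : ∀ i, MeasurableSet (Q i)) : Measurable fun a => sInf {i | a ∈ Q i} := by
  refine measurable_to_countable' fun n => ?_
  -- Since `sInf ∅ = 0`, the fibre over 0 also contains the points lying in no `Q i`; the second
  -- member of the union accounts for them.
  have h : (fun a => sInf {i | a ∈ Q i}) ⁻¹' {n}
      = (Q n ∩ ⋂ i : {i // i < n}, (Q i)ᶜ) ∪ ((⋂ i, (Q i)ᶜ) ∩ {_a | n = 0}) := by
    ext a
    simp only [Set.mem_preimage, Set.mem_singleton_iff, Set.mem_union, Set.mem_inter_iff,
      Set.mem_iInter, Set.mem_compl_iff, Set.mem_ofPred_eq, Subtype.forall]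
    by_cases hne : {i | a ∈ Q i}.Nonempty
    · constructor
      · rintro rfl
        exact Or.inl ⟨Nat.sInf_mem hne, fun i hi => Nat.notMem_of_lt_sInf hi⟩
      · rintro (⟨h1, h2⟩ | ⟨h1, _⟩)
        · refine le_antisymm (Nat.sInf_le h1) ?_
          by_contra hcon
          exact h2 _ (not_le.1 hcon) (Nat.sInf_mem hne)
        · obtain ⟨i, hi⟩ := hne
          exact absurd hi (h1 i)
    · have hemp := Set.not_nonempty_iff_eq_empty.1 hne
      have hno : ∀ i, a ∉ Q i := fun i => Set.eq_empty_iff_forall_notMem.1 hemp i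
      rw [hemp, Nat.sInf_empty]
      constructor
      · rintro rfl
        exact Or.inr ⟨hno, rfl⟩
      · rintro (⟨h1, _⟩ | ⟨_, h2⟩)
        · exact absurd h1 (hno n)
        · exact h2.symm
  rw [h]
  exact ((hQ n).inter (.iInter fun i : {i // i < n} => (hQ i).compl)).union
    ((MeasurableSet.iInter fun i => (hQ i).compl).inter (.const _))

namespace Network

variable {p : Params} {Ω : Type*} [MeasurableSpace Ω] {P : Measure Ω} (M : Network p P)

/-- The marks of the link from BS `s` to eavesdropper `k`. -/
def eveMarks (s k : ℕ) (ω : Ω) : (ℝ × ℝ) × (ℝ × ℝ) :=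
  ((M.mark (.eveBlock s k) ω, M.mark (.eveAngle s k) ω),
    (M.mark (.eveGainL s k) ω, M.mark (.eveGainN s k) ω))

lemma measurable_eveMarks (s k : ℕ) : Measurable (M.eveMarks s k) :=
  ((M.mark_measurable _).prodMk (M.mark_measurable _)).prodMk
    ((M.mark_measurable _).prodMk (M.mark_measurable _))

lemma iIndepFun_eveMarks (s : ℕ) : iIndepFun (M.eveMarks s) P := by
  have := iIndepFun_tuple M.mark_measurable M.mark_indep
    (e := fun k => ![Mark.eveBlock s k, Mark.eveAngle s k, Mark.eveGainL s k, Mark.eveGainN s k])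
    (by
      rintro ⟨i, a⟩ ⟨j, b⟩ hab
      fin_cases a <;> fin_cases b <;> simp_all)
    (g := fun v : Fin 4 → ℝ => ((v 0, v 1), (v 2, v 3))) (by fun_prop)
  exact this

lemma indepFun_eve_eveMarks (s : ℕ) :
    IndepFun (fun ω k => M.eve k ω) (fun ω k => M.eveMarks s k ω) P := by
  have := M.points_indep_mark.comp (φ := fun q : (ℕ → Plane) × (ℕ → Plane) => q.2)
    (ψ := fun a : Mark → ℝ => fun k : ℕ =>
      ((a (.eveBlock s k), a (.eveAngle s k)), (a (.eveGainL s k), a (.eveGainN s k))))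
    (by fun_prop) (by fun_prop)
  exact this

/-- The data that determine the serving BS. -/
def userData (ω : Ω) : (ℕ → Plane) × (ℕ → ℝ) :=
  ((fun i => M.bs i ω), fun i => M.mark (.userBlock i) ω)

lemma measurable_userData : Measurable M.userData :=
  (measurable_pi_iff.2 M.bs_poisson.measurable).prodMk
    (measurable_pi_iff.2 fun _ => M.mark_measurable _)

/-- The serving BS as a function of the positions and blockage variables of all BSs. -/
def servingIndex (p : Params) (w : (ℕ → Plane) × (ℕ → ℝ)) : ℕ :=
  sInf {i | w ∈ {w : (ℕ → Plane) × (ℕ → ℝ) | ∀ j, p.pathLoss (w.2 j < p.qLOS ‖w.1 j‖) ‖w.1 j‖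
    ≤ p.pathLoss (w.2 i < p.qLOS ‖w.1 i‖) ‖w.1 i‖}}

lemma measurable_servingIndex : Measurable (servingIndex p) := by
  refine measurable_sInf_nat fun i => ?_
  have h : ∀ j, Measurable fun w : (ℕ → Plane) × (ℕ → ℝ) =>
      p.pathLoss (w.2 j < p.qLOS ‖w.1 j‖) ‖w.1 j‖ := fun j =>
    p.measurable_pathLoss (measurableSet_lt (by fun_prop) (p.measurable_qLOS.comp (by fun_prop)))
      (by fun_prop)
  rw [Set.ofPred_forall]
  exact .iInter fun j => measurableSet_le (h j) (h i)

variable [IsProbabilityMeasure P]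

lemma map_eveMarks (s k : ℕ) : P.map (M.eveMarks s k) = p.eveMarkLaw := by
  have hm := M.mark_measurable
  have h1 := M.mark_indep.indepFun_prodMk_prodMk hm (.eveBlock s k) (.eveAngle s k)
    (.eveGainL s k) (.eveGainN s k) (by simp) (by simp) (by simp) (by simp)
  have h2 := M.mark_indep.indepFun (i := .eveBlock s k) (j := .eveAngle s k) (by simp)
  have h3 := M.mark_indep.indepFun (i := .eveGainL s k) (j := .eveGainN s k) (by simp)
  unfold eveMarks
  rw [h1.map_prod_eq_prod_map_map ((hm _).prodMk (hm _)).aemeasurable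
    ((hm _).prodMk (hm _)).aemeasurable,
    h2.map_prod_eq_prod_map_map (hm _).aemeasurable (hm _).aemeasurable,
    h3.map_prod_eq_prod_map_map (hm _).aemeasurable (hm _).aemeasurable, M.mark_law, M.mark_law,
    M.mark_law, M.mark_law]
  rfl

/-- Positions are independent of marks, BSs of eavesdroppers, and user blockages of eavesdropper
marks; regrouping these independences pairs each process with its own marks. -/
lemma indepFun_userData_eve (s : ℕ) :
    IndepFun M.userData (fun ω => ((fun k => M.eve k ω), (fun k => M.eveMarks s k ω))) P := by
  have hm := M.mark_measurable
  have h1 : IndepFun (fun ω (i : ℕ) => M.mark (.userBlock i) ω) (fun ω k => M.eveMarks s k ω) P := by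
    have h := indepFun_families hm M.mark_indep (fun i : ℕ => Mark.userBlock i)
      (fun q : ℕ × Fin 4 => ![Mark.eveBlock s q.1, Mark.eveAngle s q.1, Mark.eveGainL s q.1,
        Mark.eveGainN s q.1] q.2) (by
        rintro i ⟨k, j⟩
        fin_cases j <;> simp)
    have h' := h.comp (φ := fun a : ℕ → ℝ => a)
      (ψ := fun a : ℕ × Fin 4 → ℝ => fun k : ℕ => ((a (k, 0), a (k, 1)), (a (k, 2), a (k, 3))))
      (by fun_prop) (by fun_prop)
    exact h'
  have h2 : IndepFun (fun ω => ((fun i => M.bs i ω), (fun k => M.eve k ω)))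
      (fun ω => ((fun i : ℕ => M.mark (.userBlock i) ω), (fun k => M.eveMarks s k ω))) P := by
    have := M.points_indep_mark.comp (φ := fun q : (ℕ → Plane) × (ℕ → Plane) => q)
      (ψ := fun a : Mark → ℝ => ((fun i : ℕ => a (.userBlock i)), fun k : ℕ =>
        ((a (.eveBlock s k), a (.eveAngle s k)), (a (.eveGainL s k), a (.eveGainN s k)))))
      (by fun_prop) (by fun_prop)
    exact this
  exact indepFun_prodMk_prodMk_comm (measurable_pi_iff.2 M.bs_poisson.measurable)
    (measurable_pi_iff.2 M.eve_poisson.measurable) (measurable_pi_iff.2 fun _ => hm _)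
    (measurable_pi_iff.2 fun k => M.measurable_eveMarks s k) M.bs_indep_eve h1 h2

/-- The secrecy probability of the non-colluding case. -/
theorem pSec_eq {Te : ℝ} (hTe : 0 < Te) :
    M.pSec Te = Real.exp (-p.LambdaE (p.Pt / (Te * p.N0))) := by
  obtain ⟨hfin, hΛ⟩ := p.lintegral_eveMarkLaw_detectSet hTe
  have hB := p.measurableSet_detectSet Te
  -- The marks in use carry the random serving index. Fixing its value s makes them an i.i.d.
  -- family, independent of the event that s serves.
  let Q : ℕ → Set Ω := fun s => {ω | M.userData ω ∈ servingIndex p ⁻¹' {s} ∧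
    ∀ k, ((M.userData ω).1 s - M.eve k ω, M.eveMarks s k ω) ∉ p.detectSet Te}
  have hQm : ∀ s, MeasurableSet (Q s) := by
    intro s
    have h1 : MeasurableSet {ω | ∀ k, ((M.userData ω).1 s - M.eve k ω, M.eveMarks s k ω)
        ∉ p.detectSet Te} := by
      rw [Set.ofPred_forall]
      refine .iInter fun k => hB.compl.preimage ?_
      exact ((M.bs_poisson.measurable s).sub (M.eve_poisson.measurable k)).prodMk
        (M.measurable_eveMarks s k)
    exact ((measurable_servingIndex (measurableSet_singleton s)).preimage
      M.measurable_userData).inter h1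
  have hQ : ∀ s, P (Q s) = P (M.userData ⁻¹' (servingIndex p ⁻¹' {s}))
      * ENNReal.ofReal (Real.exp (-p.LambdaE (p.Pt / (Te * p.N0)))) := by
    intro s
    rw [← hΛ]
    exact M.eve_poisson.measure_inter_forall_notMem p.lamE_pos.le (M.measurable_eveMarks s)
      (M.map_eveMarks s) (M.iIndepFun_eveMarks s) (M.indepFun_eve_eveMarks s) hB hfin
      M.measurable_userData (M.indepFun_userData_eve s) (v := fun w => w.1 s) (by fun_prop)
      (measurable_servingIndex (measurableSet_singleton s))
  have hset : {ω | (⨆ k, (M.snrEve k ω : EReal)) ≤ (Te : EReal)} = ⋃ s, Q s := by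
    ext ω
    have hs : servingIndex p (M.userData ω) = M.serving ω := rfl
    simp only [Set.mem_ofPred_eq, iSup_le_iff, EReal.coe_le_coe_iff, Set.mem_iUnion, Q,
      Set.mem_preimage, Set.mem_singleton_iff, hs, exists_eq_left', Params.detectSet, not_lt]
    refine forall_congr' fun k => ?_
    simp only [snrEve, eveLoss, eveGain, eveLOS, eveMarks, userData]
    congr!
  have hdisj : Pairwise (Function.onFun Disjoint Q) := by
    intro a b hab
    rw [Function.onFun, Set.disjoint_left]
    rintro ω ⟨h1, _⟩ ⟨h2, _⟩
    exact hab (h1.symm.trans h2)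
  -- The serving index is defined everywhere, by its default value if no maximizer exists, so its
  -- fibres partition the sample space.
  have htotal : ∑' s, P (M.userData ⁻¹' (servingIndex p ⁻¹' {s})) = 1 := by
    rw [← measure_iUnion]
    · rw [← Set.preimage_iUnion, ← Set.preimage_iUnion, Set.iUnion_of_singleton, Set.preimage_univ,
        Set.preimage_univ, measure_univ]
    · intro a b hab
      rw [Function.onFun, Set.disjoint_left]
      intro ω h1 h2
      exact hab (h1.symm.trans h2)
    · exact fun s => (measurable_servingIndex (measurableSet_singleton s)).preimage
        M.measurable_userData
  rw [pSec, Measure.real, hset, measure_iUnion hdisj hQm]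
  simp_rw [hQ]
  rw [ENNReal.tsum_mul_right, htotal, one_mul, ENNReal.toReal_ofReal (Real.exp_pos _).le]

end Network

end MmWave

end

theorem theorem2 {Ω : Type*} [MeasurableSpace Ω] (P : Measure Ω) [IsProbabilityMeasure P]
    (p : MmWave.Params) (M : MmWave.Network p P)
    (hD : p.CN * p.D ^ (-p.aN) ≤ p.CL * p.D ^ (-p.aL))
    (Tc Te : ℝ) (hTc : 0 < Tc) (hTe : 0 < Te) :
    M.pCon Tc =
        (∫ r in (0 : ℝ)..p.D,
          MmWave.upperGamma p.NL (p.N0 * Tc * r ^ p.aL / (p.Pt * p.Ms * p.CL)) / Real.Gamma p.NL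
            * p.fL r) * p.AL
        + (∫ r in Set.Ioi (0 : ℝ),
          MmWave.upperGamma p.NN (p.N0 * Tc * r ^ p.aN / (p.Pt * p.Ms * p.CN)) / Real.Gamma p.NN
            * p.fN r) * p.AN
      ∧ M.pSec Te = Real.exp (-p.LambdaE (p.Pt / (Te * p.N0))) := by
  refine ⟨?_, M.pSec_eq hTe⟩
  rw [M.pCon_eq_integral hTc, ← p.integral_acceptLOS hD hTc, ← p.integral_acceptNLOS hD hTc]
  ring
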